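/- **Setting.** Let $H=(V,F)$ be a finite hypergraph: $V$ is a finite set and $F$ is a set of non-empty subsets of $V$; let $d_i$ be the number of $\alpha\in F$ containing $i$. Each $i\in V$ carries a measurable space $\mathcal X_i$, a non-zero $\sigma$-finite base measure $\nu_i$ and a measurable statistic $\phi_i:\mathcal X_i\to\mathbb R^{r_i}$. Each $\alpha\in F$ carries the product measure $\nu_\alpha$ on $\mathcal X_\alpha=\prod_{i\in\alpha}\mathcal X_i$ and a measurable statistic $\phi_\alpha(x_\alpha)=(\phi_{\langle\alpha\rangle}(x_\alpha),(\phi_i(x_i))_{i\in\alpha})$. Let $\mathcal E_i,\mathcal E_\alpha$ be the exponential families of the densities $\exp(\langle\theta,\phi\rangle-\psi(\theta))$, with $\theta$ in the interior $\Theta_i,\Theta_\alpha$ of $\{\psi<\infty\}$, where $\psi_i,\psi_\alpha$ are the log partition functions; let $\Lambda_i,\Lambda_\alpha$ be the maps $\theta\mapsto\mathbb E_\theta[\phi]$, let $Y_i=\Lambda_i(\Theta_i)$, $Y_\alpha=\Lambda_\alpha(\Theta_\alpha)$, and let $\varphi_i,\varphi_\alpha$ be the Legendre transforms of $\psi_i,\psi_\alpha$.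 Assume that these data form an inference family, that is, all covariance matrices of members of $\mathcal E_i$ and $\mathcal E_\alpha$ are invertible and, for $i\in\alpha$, the $i$-marginal of every member of $\mathcal E_\alpha$ lies in $\mathcal E_i$; and that all the families are regular, that is, every set $\{\psi<\infty\}$ is open (this is automatic if all $\mathcal X_i$ are finite). Let $\Psi_\alpha(x_\alpha)=\exp\langle\bar\theta_\alpha,\phi_\alpha(x_\alpha)\rangle$ for each $\alpha\in F$, with $\bar\theta_\alpha=(\bar\theta_{\langle\alpha\rangle},(\bar\theta^\alpha_i)_{i\in\alpha})$ arbitrary. Let $L$ be the set of all $\{\eta_\alpha,\eta_i\}$ with $\eta_\alpha\in Y_\alpha$, $\eta_i\in Y_i$ such that the component of $\eta_\alpha$ belonging to $i$ is $\eta_i$ whenever $i\in\alpha$. The Bethe free energy on $L$ is $$\mathcal F(\eta)=-\sum_{\alpha}\langle\bar\theta_\alpha,\eta_\alpha\rangle+\sum_\alpha\varphi_\alpha(\eta_\alpha)+\sum_i(1-d_i)\varphi_i(\eta_i).$$ Let $S(\Psi)\subset L$ be the set of points such that, for all $\alpha$, the $\langle\alpha\rangle$-component of $\Lambda_\alpha^{-1}(\eta_\alpha)$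 is $\bar\theta_{\langle\alpha\rangle}$. The restricted Bethe free energy $\hat{\mathcal F}$ is the restriction of $\mathcal F$ to $S(\Psi)$, regarded as a function of the coordinates $\{\eta_i\}_{i\in V}$ (which determine the point of $S(\Psi)$), on the set of the values that $\{\eta_i\}$ takes on $S(\Psi)$. A fixed point of loopy belief propagation (LBP) is a family of messages $m_{\alpha\to i}(x_i)=\exp\langle\mu_{\alpha\to i},\phi_i(x_i)\rangle$, $i\in\alpha\in F$, such that $$m_{\alpha\to i}(x_i)\propto\int\Psi_\alpha(x_\alpha)\prod_{j\in\alpha,\,j\ne i}\ \prod_{\beta\ni j,\,\beta\neq\alpha}m_{\beta\to j}(x_j)\,d\nu_{\alpha\smallsetminus i}$$ for $\nu_i$-almost every $x_i$, and such that the beliefs $\prod_{\alpha\ni i}m_{\alpha\to i}$ and $\Psi_\alpha\prod_{j\in\alpha}\prod_{\beta\ni j,\beta\ne\alpha}m_{\beta\to j}$ are integrable. For $\alpha\in F$ and $i,j\in\alpha$ let $$W^\alpha_{i,j}(\Psi)=\sup\Big\{\big\|\mathrm{Corr}_{b_\alpha}(\phi_i,\phi_j)\big\|\ :\ b_\alpha(x_\alpha)\propto\Psi_\alpha(x_\alpha)\prod_{k\in\alpha}f_k(x_k),\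 f_k \text{ positive measurable functions}\Big\},$$ where $\mathrm{Corr}_b(\phi_i,\phi_j)=\mathrm{Var}_b(\phi_i)^{-1/2}\,\mathrm{Cov}_b(\phi_i,\phi_j)\,\mathrm{Var}_b(\phi_j)^{-1/2}$, $\|\cdot\|$ is the largest singular value, and the supremum is over all probability densities $b_\alpha$ of this form for which the correlation matrix is defined ($\phi_i,\phi_j$ square integrable with invertible covariance matrices); the supremum of the empty set is $0$. Let $\mathcal M(\boldsymbol W)$ be the matrix indexed by the directed edges $(\alpha\to i)$, $i\in\alpha\in F$, whose entry at $\big((\alpha\to i),(\beta\to j)\big)$ is $W^\alpha_{i,j}(\Psi)$ if $j\in\alpha$, $j\neq i$ and $\beta\ne\alpha$, and $0$ otherwise. **Theorem.** If the spectral radius of $\mathcal M(\boldsymbol W)$ is less than $1$, then $\hat{\mathcal F}$ is strictly convex (in particular its domain is convex), and LBP has at most one fixed point. If moreover all the sets $\mathcal X_i$ are finite (in particular for multinomial models), then LBP has exactly one fixed point. -/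

import Mathlib

open MeasureTheory ProbabilityTheory
open scoped Matrix Matrix.Norms.L2Operator MatrixOrder

/-- A finite hypergraph (factor graph) on the vertex set `V`: a finite set of non-empty hyperedges
(factors), each of them a set of vertices. -/
structure FactorGraph (V : Type*) where
  /-- The hyperedges. -/
  hyperedges : Finset (Finset V)
  nonempty_of_mem : ∀ α ∈ hyperedges, α.Nonempty

namespace FactorGraph

variable {V : Type*} (H : FactorGraph V)

/-- The type of hyperedges of `H`. -/
abbrev Edge : Type _ := {α : Finset V // α ∈ H.hyperedges}

/-- The directed edges `α → i` of `H`, for `i ∈ α`. -/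
abbrev DirEdge : Type _ := Σ α : H.Edge, {i : V // i ∈ α.1}

/-- The degree `d_i`: the number of hyperedges that contain `i`. -/
def degree [DecidableEq V] (i : V) : ℕ := (H.hyperedges.filter (fun α => i ∈ α)).card

open Classical in
/-- The directed edge matrix `M(w)` with scalar weights `w α i j` attached to `i, j ∈ α`.
Its entry at `(e, e')`, with `e = (α → i)` and `e' = (β → j)`, is `w α i j` if `j ∈ α`, `j ≠ i` and
`β ≠ α`, and it is `0` otherwise. -/
noncomputable def dirEdgeMatrix (w : ∀ α : H.Edge, {i : V // i ∈ α.1} → {i : V // i ∈ α.1} → ℝ) :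
    Matrix H.DirEdge H.DirEdge ℝ :=
  Matrix.of fun e e' =>
    if h : e'.2.1 ∈ e.1.1 then
      if e'.2.1 ≠ e.2.1 ∧ e'.1 ≠ e.1 then w e.1 e.2 ⟨e'.2.1, h⟩ else 0
    else 0

end FactorGraph

/-! ### Correlation coefficient matrices -/

section Correlation

variable {Ω m n : Type*} [MeasurableSpace Ω] [Fintype m] [DecidableEq m] [Fintype n] [DecidableEq n]

/-- The probability measure with density proportional to `g` with respect to `ν`
(for positive `ν`-integrable `g`, and `ν ≠ 0`). -/
noncomputable def normalizedLaw (ν : Measure Ω) (g : Ω → ℝ) : Measure Ω :=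
  ν.withDensity fun x => ENNReal.ofReal (g x / ∫ y, g y ∂ν)

/-- The covariance matrix `Cov_P(f, g)` of two vector-valued functions. -/
noncomputable def covMatrix (P : Measure Ω) (f : Ω → m → ℝ) (g : Ω → n → ℝ) : Matrix m n ℝ :=
  Matrix.of fun a b => covariance (fun x => f x a) (fun x => g x b) P

/-- The correlation coefficient matrix
`Corr_P(f, g) = Var_P(f)^{-1/2} Cov_P(f, g) Var_P(g)^{-1/2}`. -/
noncomputable def corrMatrix (P : Measure Ω) (f : Ω → m → ℝ) (g : Ω → n → ℝ) : Matrix m n ℝ :=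
  (CFC.sqrt (covMatrix P f f))⁻¹ * covMatrix P f g * (CFC.sqrt (covMatrix P g g))⁻¹

end Correlation

/-! ### Exponential families -/

namespace ExpFamily

variable {Ω n : Type*} [MeasurableSpace Ω] [Fintype n] (ν : Measure Ω) (φ : Ω → n → ℝ)

/-- The set of all `θ` with finite log partition function. -/
def fullDomain : Set (n → ℝ) := {θ | Integrable (fun x => Real.exp (θ ⬝ᵥ φ x)) ν}

/-- The natural parameter space `Θ`. -/
def natParams : Set (n → ℝ) := interior (fullDomain ν φ)

/-- The log partition function `ψ`. -/
noncomputable def logPartition (θ : n → ℝ) : ℝ := Real.log (∫ x, Real.exp (θ ⬝ᵥ φ x) ∂ν)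

/-- The member of the family with natural parameter `θ`, as a probability measure; its density is
`exp (⟨θ, φ x⟩ - ψ θ)`. -/
noncomputable def law (θ : n → ℝ) : Measure Ω := normalizedLaw ν fun x => Real.exp (θ ⬝ᵥ φ x)

/-- The expectation parameter `Λ(θ) = E_θ[φ]`. -/
noncomputable def meanMap (θ : n → ℝ) : n → ℝ := fun k => ∫ x, φ x k ∂(law ν φ θ)

/-- The space `Y = Λ(Θ)` of expectation parameters. -/
def meanParams : Set (n → ℝ) := meanMap ν φ '' natParams ν φ

/-- The Legendre transform of the log partition function. -/
noncomputable def legendre (η : n → ℝ) : ℝ :=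
  sSup ((fun θ => θ ⬝ᵥ η - logPartition ν φ θ) '' natParams ν φ)

end ExpFamily

/-! ### Inference families -/

/-- Base measures and sufficient statistics attached to the vertices and the hyperedges of `H`.
The vertex `i` carries a base measure on `X i` and a statistic with values in `ℝ ^ (dimV i)`; the
hyperedge `α` carries, besides the statistics of its vertices, a statistic on `∏_{i ∈ α} X i`
with values in `ℝ ^ (dimF α)`. -/
structure InferenceData {V : Type*} (H : FactorGraph V) (X : V → Type*)
    [∀ i, MeasurableSpace (X i)] where
  /-- The base measures. -/
  ν : ∀ i, Measure (X i)
  sigmaFinite_ν : ∀ i, SigmaFinite (ν i)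
  ν_ne_zero : ∀ i, ν i ≠ 0
  /-- The number of components of the statistic of a vertex. -/
  dimV : V → ℕ
  /-- The number of components of the statistic of a hyperedge. -/
  dimF : H.Edge → ℕ
  /-- The sufficient statistic of a vertex. -/
  φV : ∀ i, X i → Fin (dimV i) → ℝ
  measurable_φV : ∀ i, Measurable (φV i)
  /-- The sufficient statistic of a hyperedge, without the statistics of its vertices. -/
  φF : ∀ α : H.Edge, (∀ i : {i : V // i ∈ α.1}, X i.1) → Fin (dimF α) → ℝ
  measurable_φF : ∀ α, Measurable (φF α)

namespace InferenceData

variable {V : Type*} {H : FactorGraph V} {X : V → Type*} [∀ i, MeasurableSpace (X i)]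
  (I : InferenceData H X)

/-- The configurations `x_α` of the variables of the hyperedge `α`. -/
abbrev Config (_I : InferenceData H X) (α : H.Edge) : Type _ := ∀ i : {i : V // i ∈ α.1}, X i.1

/-- The index set of the components of the full statistic of `α`: `Sum.inl` for the components
that belong to `α` itself, `Sum.inr ⟨i, k⟩` for the `k`-th component of the statistic of `i ∈ α`. -/
abbrev StatIdx (α : H.Edge) : Type _ :=
  Fin (I.dimF α) ⊕ (Σ i : {i : V // i ∈ α.1}, Fin (I.dimV i.1))

/-- The product base measure on `∏_{i ∈ α} X i`. -/
noncomputable def νF (α : H.Edge) : Measure (I.Config α) := Measure.pi fun i => I.ν i.1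

/-- The full statistic of `α`, which includes the statistics of its vertices. -/
def stat (α : H.Edge) (x : I.Config α) : I.StatIdx α → ℝ :=
  Sum.elim (I.φF α x) fun p => I.φV p.1.1 (x p.1) p.2

open Classical in
/-- The two standing assumptions on an inference family: the covariance matrices of all members of
all the exponential families are invertible, and for `i ∈ α` the `i`-marginal of each member
of the family of `α` is a member of the family of `i`. -/
structure IsInferenceFamily : Prop where
  isUnit_covV : ∀ i, ∀ θ ∈ ExpFamily.natParams (I.ν i) (I.φV i),
    IsUnit (covMatrix (ExpFamily.law (I.ν i) (I.φV i) θ) (I.φV i) (I.φV i)).det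
  isUnit_covF : ∀ α, ∀ θ ∈ ExpFamily.natParams (I.νF α) (I.stat α),
    IsUnit (covMatrix (ExpFamily.law (I.νF α) (I.stat α) θ) (I.stat α) (I.stat α)).det
  marginal_mem : ∀ (α : H.Edge) (i : {i : V // i ∈ α.1}),
    ∀ θ ∈ ExpFamily.natParams (I.νF α) (I.stat α),
      ∃ θ' ∈ ExpFamily.natParams (I.ν i.1) (I.φV i.1),
        (ExpFamily.law (I.νF α) (I.stat α) θ).map (fun x => x i) =
          ExpFamily.law (I.ν i.1) (I.φV i.1) θ'

/-- All the exponential families are regular: the sets of parameters with finite log partition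
function are open. This is automatic when all the `X i` are finite. -/
structure IsRegular : Prop where
  isOpen_V : ∀ i, IsOpen (ExpFamily.fullDomain (I.ν i) (I.φV i))
  isOpen_F : ∀ α, IsOpen (ExpFamily.fullDomain (I.νF α) (I.stat α))

/-- The natural parameters of the compatibility functions of a graphical model. -/
abbrev ModelParams : Type _ := ∀ α : H.Edge, I.StatIdx α → ℝ

/-- The compatibility function `Ψ_α(x_α) = exp ⟨θbar_α, φ_α(x_α)⟩`. -/
noncomputable def compat (θbar : I.ModelParams) (α : H.Edge) (x : I.Config α) : ℝ :=
  Real.exp (θbar α ⬝ᵥ I.stat α x)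

/-! ### The Bethe free energy -/

/-- Families `({η_α}, {η_i})` of expectation parameters. -/
abbrev ParamSpace : Type _ := (∀ α : H.Edge, I.StatIdx α → ℝ) × (∀ i, Fin (I.dimV i) → ℝ)

/-- The set `L` of pseudomarginals, in expectation parameters. -/
def pseudomarginals : Set I.ParamSpace :=
  {η | (∀ α, η.1 α ∈ ExpFamily.meanParams (I.νF α) (I.stat α)) ∧
    (∀ i, η.2 i ∈ ExpFamily.meanParams (I.ν i) (I.φV i)) ∧
    ∀ (α : H.Edge) (i : {i : V // i ∈ α.1}) (k : Fin (I.dimV i.1)),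
      η.1 α (Sum.inr ⟨i, k⟩) = η.2 i.1 k}

/-- The Bethe free energy function. -/
noncomputable def bethe [Fintype V] [DecidableEq V] (θbar : I.ModelParams) (η : I.ParamSpace) : ℝ :=
  -(∑ α, θbar α ⬝ᵥ η.1 α) + (∑ α, ExpFamily.legendre (I.νF α) (I.stat α) (η.1 α)) +
    ∑ i, (1 - (H.degree i : ℝ)) * ExpFamily.legendre (I.ν i) (I.φV i) (η.2 i)

/-- The set `S(Ψ)` of the pseudomarginals such that, for each `α`, the components of the natural
parameter of `b_α` that belong to `α` itself agree with those of `Ψ_α`. -/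
def restrictedSet (θbar : I.ModelParams) : Set I.ParamSpace :=
  {η | η ∈ I.pseudomarginals ∧
    ∀ α, ∃ θ ∈ ExpFamily.natParams (I.νF α) (I.stat α),
      ExpFamily.meanMap (I.νF α) (I.stat α) θ = η.1 α ∧
        ∀ k, θ (Sum.inl k) = θbar α (Sum.inl k)}

/-- The range of the coordinates `{η_i}` on `S(Ψ)`. -/
def restrictedDomain (θbar : I.ModelParams) : Set (∀ i, Fin (I.dimV i) → ℝ) :=
  Prod.snd '' I.restrictedSet θbar

/-- The restricted Bethe free energy: the restriction of the Bethe free energy to `S(Ψ)`,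
as a function of the coordinates `{η_i}` (which determine the point of `S(Ψ)`). -/
noncomputable def restrictedBethe [Fintype V] [DecidableEq V] (θbar : I.ModelParams)
    (η : ∀ i, Fin (I.dimV i) → ℝ) : ℝ :=
  I.bethe θbar (Function.invFunOn Prod.snd (I.restrictedSet θbar) η)

/-! ### The weights `W` -/

/-- The values `‖Corr_{b_α}(φ_i, φ_j)‖` (largest singular value), for all probability densities
`b_α ∝ Ψ_α ∏ f_i` with positive functions `f_i` for which this correlation coefficient matrix
is defined. -/
def corrNorms (θbar : I.ModelParams) (α : H.Edge) (i j : {i : V // i ∈ α.1}) : Set ℝ :=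
  {r | ∃ f : ∀ k : {i : V // i ∈ α.1}, X k.1 → ℝ,
    (∀ k, Measurable (f k)) ∧ (∀ k x, 0 < f k x) ∧
    Integrable (fun x => I.compat θbar α x * ∏ k, f k (x k)) (I.νF α) ∧
    ∃ b : Measure (I.Config α),
      b = normalizedLaw (I.νF α) (fun x => I.compat θbar α x * ∏ k, f k (x k)) ∧
      MemLp (fun x : I.Config α => I.φV i.1 (x i)) 2 b ∧
      MemLp (fun x : I.Config α => I.φV j.1 (x j)) 2 b ∧
      (covMatrix b (fun x => I.φV i.1 (x i)) (fun x => I.φV i.1 (x i))).PosDef ∧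
      (covMatrix b (fun x => I.φV j.1 (x j)) (fun x => I.φV j.1 (x j))).PosDef ∧
      r = ‖corrMatrix b (fun x => I.φV i.1 (x i)) (fun x => I.φV j.1 (x j))‖}

/-- The weight `W^α_{i,j}(Ψ)`. -/
noncomputable def weight (θbar : I.ModelParams) (α : H.Edge) (i j : {i : V // i ∈ α.1}) : ℝ :=
  sSup (I.corrNorms θbar α i j)

/-! ### Loopy belief propagation -/

/-- The natural parameters of a set of messages. -/
abbrev Messages : Type _ := ∀ e : H.DirEdge, Fin (I.dimV e.2.1) → ℝ

/-- The message `m_{α → i}(x_i) = exp ⟨μ_{α → i}, φ_i(x_i)⟩`. -/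
noncomputable def msg (μ : I.Messages) (e : H.DirEdge) (x : X e.2.1) : ℝ :=
  Real.exp (μ e ⬝ᵥ I.φV e.2.1 x)

open Classical in
/-- The product `∏_{β ∋ j, β ≠ α} m_{β → j}(x_j)`. -/
noncomputable def cavity (μ : I.Messages) (α : H.Edge) (j : V) (x : X j) : ℝ :=
  ∏ β : {β : H.Edge // j ∈ β.1 ∧ β ≠ α}, I.msg μ ⟨β.1, ⟨j, β.2.1⟩⟩ x

open Classical in
/-- The messages `μ'` arise from the messages `μ` by one parallel update
`m'_{α → i}(x_i) ∝ ∫ Ψ_α(x_α) ∏_{j ∈ α, j ≠ i} ∏_{β ∋ j, β ≠ α} m_{β → j}(x_j) dν_{α ∖ i}`. -/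
def IsUpdate (θbar : I.ModelParams) (μ μ' : I.Messages) : Prop :=
  ∀ (α : H.Edge) (i : {i : V // i ∈ α.1}), ∃ ω : ℝ, 0 < ω ∧ ∀ᵐ x ∂(I.ν i.1),
    I.msg μ' ⟨α, i⟩ x =
      ω * ∫ y : (∀ j : {j : {i : V // i ∈ α.1} // j ≠ i}, X j.1.1),
        I.compat θbar α ((Equiv.piSplitAt i fun k : {i : V // i ∈ α.1} => X k.1).symm (x, y)) *
          ∏ j, I.cavity μ α j.1.1 (y j)
        ∂(Measure.pi fun j => I.ν j.1.1)

open Classical in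
/-- The unnormalized belief `∏_{α ∋ i} m_{α → i}(x_i)` of the vertex `i`. -/
noncomputable def beliefV (μ : I.Messages) (i : V) (x : X i) : ℝ :=
  ∏ α : {α : H.Edge // i ∈ α.1}, I.msg μ ⟨α.1, ⟨i, α.2⟩⟩ x

/-- The unnormalized belief `Ψ_α(x_α) ∏_{j ∈ α} ∏_{β ∋ j, β ≠ α} m_{β → j}(x_j)` of the
hyperedge `α`. -/
noncomputable def beliefF (θbar : I.ModelParams) (μ : I.Messages) (α : H.Edge)
    (x : I.Config α) : ℝ :=
  I.compat θbar α x * ∏ j, I.cavity μ α j.1 (x j)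

/-- Fixed points of loopy belief propagation: messages that are reproduced by the update and
whose beliefs can be normalized. -/
def IsFixedPoint (θbar : I.ModelParams) (μ : I.Messages) : Prop :=
  I.IsUpdate θbar μ μ ∧ (∀ i, Integrable (I.beliefV μ i) (I.ν i)) ∧
    ∀ α, Integrable (I.beliefF θbar μ α) (I.νF α)

end InferenceData

/-! ### Nonnegative matrices of small spectral radius -/

section SpectralRadius

open Filter Topology

variable {ι : Type*} [Fintype ι] [DecidableEq ι]

/-! On S(Ψ) the ⟨α⟩-components of the natural parameters are frozen, so b_α runs through a smaller
exponential family, the slice given by `sliceBase` and `sliceStat`, whose statistic is (φ_i) for i ∈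
α. In the coordinates η_i the Bethe free energy becomes the sum of the Legendre transforms of the
slices, minus a linear term, plus Σ_i (1 - d_i) φ_i(η_i) (`bethe_eq_reducedBethe`). Its domain is
cut out by the mean parameter sets of the vertices and slices. Each of these is the interior of a
convex support (`meanParams_eq_supportInterior`), so the domain is convex and open.

The Hessian is Σ_α R_αᵀ C_α⁻¹ R_α + Σ_i (1 - d_i) Q_i⁻¹, where R_α restricts to α, C_α is the
covariance of the vertex statistics under b_α, and the diagonal blocks of C_α are the vertex
covariances Q_i by the marginalisation hypothesis. For positivity (`betheForm_pos`) the off-diagonal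
blocks of C_α are multiplied by t ∈ [0, 1]. At t = 0 the form is Σ_i v_iᵀ Q_i⁻¹ v_i > 0. If
definiteness were lost, then at the first such t the form would be semidefinite with a kernel vector
v ≠ 0. From v one builds a vector g on directed edges with Q_i g_{α,i} = Σ_{j≠i} Σ_{β≠α} C_{ij}
g_{β,j}. Its Q-norms form a nonnegative vector n ≤ M(W) n, and n = 0 because the powers of M(W) tend
to 0 (`betheForm_nondegenerate`, `eq_zero_of_le_mulVec`). This forces v = 0.

Fixed points of LBP correspond to zeros of the gradient through μ_{α→i} = θ_i - θ_{α,i} +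
θbar_{α,i}: the update equation says that the vertex beliefs are the marginals of the hyperedge
beliefs, and a zero gradient says that the messages into i add up to the natural parameter of i
(`exists_stationary_of_isFixedPoint`, `isFixedPoint_pointMessages`). A positive definite Hessian on
a convex set allows at most one zero. For finite X_i the image of the gradient map is open, since
the Hessian is invertible, and closed, since the messages above are bounded a priori in terms of log
Ψ_α. So the image is the whole space and contains 0 (`exists_gradBethe_eq_zero`). -/

theorem tendsto_pow_of_spectralRadius_lt_one {A : Type*} [NormedRing A] [NormedAlgebra ℂ A]
    [CompleteSpace A] (a : A) (ha : spectralRadius ℂ a < 1) :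
    Tendsto (fun k : ℕ => a ^ k) atTop (𝓝 0) := by
  obtain ⟨r, hr, hr1⟩ := ENNReal.lt_iff_exists_nnreal_btwn.1 ha
  have hr1' : r < 1 := by exact_mod_cast hr1
  -- Gelfand's formula: ‖a ^ k‖ ^ (1 / k) tends to the spectral radius, so it is eventually below r
  -- < 1.
  have h := spectrum.pow_nnnorm_pow_one_div_tendsto_nhds_spectralRadius a
  have h1 := h.eventually (gt_mem_nhds hr)
  rw [tendsto_zero_iff_norm_tendsto_zero]
  refine squeeze_zero' (Eventually.of_forall fun _ => norm_nonneg _) ?_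
    (tendsto_pow_atTop_nhds_zero_of_lt_one (r := (r : ℝ)) r.2 (by exact_mod_cast hr1'))
  filter_upwards [h1, eventually_gt_atTop 0] with k hk hk0
  have h2 : (‖a ^ k‖₊ : ENNReal) ≤ (r : ENNReal) ^ k := by
    have h3 := ENNReal.rpow_le_rpow hk.le (z := (k : ℝ)) (by positivity)
    rw [← ENNReal.rpow_mul, one_div, inv_mul_cancel₀ (by exact_mod_cast hk0.ne'),
      ENNReal.rpow_one, ENNReal.rpow_natCast] at h3
    exact h3
  have h4 : ‖a ^ k‖₊ ≤ r ^ k := by exact_mod_cast h2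
  exact_mod_cast h4

/-- A nonnegative subinvariant vector of a nonnegative matrix with spectral radius `< 1`
vanishes. -/
theorem eq_zero_of_le_mulVec (M : Matrix ι ι ℝ) (hM : ∀ i j, 0 ≤ M i j)
    (hρ : spectralRadius ℂ (M.map (algebraMap ℝ ℂ)) < 1) (x : ι → ℝ) (hx : ∀ i, 0 ≤ x i)
    (hle : ∀ i, x i ≤ (M *ᵥ x) i) : x = 0 := by
  -- Nonnegativity of M allows iteration, x ≤ M x ≤ M² x ≤ …, and the right-hand side tends to 0.
  have hpow : ∀ k : ℕ, ∀ i, x i ≤ ((M ^ k) *ᵥ x) i := by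
    intro k
    induction k with
    | zero => intro i; simp
    | succ k ih =>
      intro i
      refine (hle i).trans ?_
      rw [pow_succ', ← Matrix.mulVec_mulVec]
      exact Finset.sum_le_sum fun j _ => mul_le_mul_of_nonneg_left (ih j) (hM i j)
  have ht := tendsto_pow_of_spectralRadius_lt_one _ hρ
  have ht2 : ∀ i j, Tendsto (fun k : ℕ => (M ^ k) i j) atTop (𝓝 0) := by
    intro i j
    have h1 : Continuous fun B : Matrix ι ι ℂ => (B i j).re :=
      Complex.continuous_re.comp (Continuous.matrix_elem continuous_id i j)
    have h2 := (h1.tendsto 0).comp ht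
    simp only [Matrix.zero_apply, Complex.zero_re] at h2
    refine h2.congr fun k => ?_
    have : (M.map (algebraMap ℝ ℂ)) ^ k = (M ^ k).map (algebraMap ℝ ℂ) :=
      (map_pow (algebraMap ℝ ℂ).mapMatrix M k).symm
    simp only [Function.comp_apply, this]
    simp
  funext i
  refine le_antisymm ?_ (hx i)
  refine ge_of_tendsto' (f := fun k : ℕ => ((M ^ k) *ᵥ x) i) (x := atTop) ?_ fun k => hpow k i
  have : (0 : ℝ) = ∑ j, 0 * x j := by simp
  simp only [Pi.zero_apply]
  rw [this]
  exact tendsto_finsetSum _ fun j _ => (ht2 i j).mul_const _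

end SpectralRadius

/-! ### Positivity of the Bethe Hessian -/

section BetheHessian

/-- If b v u ≠ 0 at a null vector v, a small step along ±u makes the form negative. Only the
expansion `hq` is needed, not bilinearity of `b`. -/
theorem mulVec_eq_zero_of_form_nonneg {E : Type*} [AddCommGroup E] [Module ℝ E]
    (b : E → E → ℝ) (q : E → ℝ) (hq : ∀ (v u : E) (s : ℝ), q (v + s • u) =
      q v + 2 * s * b v u + s ^ 2 * q u) (hpos : ∀ v, 0 ≤ q v) (v : E) (hv : q v = 0) (u : E) :
    b v u = 0 := by
  -- The summand 1 keeps the denominator positive when q u = 0; the value reached is -(b v u)² (q u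
  -- + 2) / (q u + 1)².
  have h := hpos (v + (-(b v u) / (q u + 1)) • u)
  rw [hq, hv] at h
  have hu := hpos u
  have h1 : 0 < q u + 1 := by linarith
  by_contra hne
  have h2 : 0 < (b v u) ^ 2 := by positivity
  have h3 : 0 + 2 * (-(b v u) / (q u + 1)) * b v u + (-(b v u) / (q u + 1)) ^ 2 * q u
      = -((b v u) ^ 2 * (q u + 2)) / (q u + 1) ^ 2 := by
    field_simp; ring
  rw [h3] at h
  have : (b v u) ^ 2 * (q u + 2) / (q u + 1) ^ 2 > 0 := by positivity
  rw [neg_div] at h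
  linarith

/-- A continuous path of quadratic forms on a finite-dimensional space which starts at a positive
definite form and does not pass through a positive semidefinite degenerate form ends at a
positive definite form. -/
theorem form_pos_of_path {E : Type*} [NormedAddCommGroup E] [NormedSpace ℝ E]
    [FiniteDimensional ℝ E] (q : ℝ → E → ℝ)
    (hcont : ContinuousOn (fun p : ℝ × E => q p.1 p.2) (Set.Icc 0 1 ×ˢ Set.univ))
    (hhom : ∀ t (s : ℝ) v, q t (s • v) = s ^ 2 * q t v)
    (h0 : ∀ v, v ≠ 0 → 0 < q 0 v)
    (hker : ∀ t ∈ Set.Icc (0 : ℝ) 1, (∀ v, 0 ≤ q t v) → ∀ v, q t v = 0 → v = 0) :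
    ∀ v, v ≠ 0 → 0 < q 1 v := by
  have := FiniteDimensional.proper ℝ E
  by_contra! hcon
  obtain ⟨v1, hv1, hq1⟩ := hcon
  set S : Set (ℝ × E) := Set.Icc 0 1 ×ˢ Metric.sphere (0 : E) 1 with hS
  have hScomp : IsCompact S := isCompact_Icc.prod (isCompact_sphere _ _)
  set B : Set (ℝ × E) := S ∩ (fun p : ℝ × E => q p.1 p.2) ⁻¹' Set.Iic 0 with hB
  have hc : ContinuousOn (fun p : ℝ × E => q p.1 p.2) S :=
    hcont.mono (Set.prod_mono le_rfl (Set.subset_univ _))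
  have hBcomp : IsCompact B :=
    hScomp.of_isClosed_subset (hc.preimage_isClosed_of_isClosed hScomp.isClosed isClosed_Iic)
      Set.inter_subset_left
  have hn1 : ‖v1‖ ≠ 0 := norm_ne_zero_iff.2 hv1
  have hBne : B.Nonempty := by
    refine ⟨(1, ‖v1‖⁻¹ • v1), ⟨⟨by simp, ?_⟩, ?_⟩⟩
    · simp [norm_smul, hn1]
    · simp only [Set.mem_preimage, Set.mem_Iic, hhom]
      exact mul_nonpos_of_nonneg_of_nonpos (by positivity) hq1
  -- The least t at which the form fails to be positive on the unit sphere. Before t the form is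
  -- positive, so by continuity it is semidefinite at t, with null vector v.
  obtain ⟨⟨t, v⟩, htv, hmin⟩ := hBcomp.exists_isMinOn hBne continuous_fst.continuousOn
  have ht : t ∈ Set.Icc (0 : ℝ) 1 := htv.1.1
  have hv : ‖v‖ = 1 := by simpa using htv.1.2
  have hv0 : v ≠ 0 := by rintro rfl; simp at hv
  have hqv : q t v ≤ 0 := htv.2
  have htpos : 0 < t := by
    rcases ht.1.eq_or_lt with h | h
    · rw [← h] at hqv; exact absurd (h0 v hv0) (not_lt.2 hqv)
    · exact h
  have hlt : ∀ s ∈ Set.Ico (0 : ℝ) t, ∀ u, ‖u‖ = 1 → 0 < q s u := by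
    intro s hs u hu
    by_contra! hcon
    have hmem : (s, u) ∈ B := ⟨⟨⟨hs.1, hs.2.le.trans ht.2⟩, by simpa using hu⟩, hcon⟩
    exact absurd (hmin hmem) (not_le.2 hs.2)
  have hpsd1 : ∀ u, ‖u‖ = 1 → 0 ≤ q t u := by
    intro u hu
    have hcu : ContinuousOn (fun s => q s u) (Set.Icc 0 1) :=
      hcont.comp (f := fun s : ℝ => (s, u)) (by fun_prop) fun s hs => ⟨hs, trivial⟩
    have h1 : Filter.Tendsto (fun s => q s u) (nhdsWithin t (Set.Ico 0 t)) (nhds (q t u)) :=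
      (hcu t ht).mono fun s hs => ⟨hs.1, hs.2.le.trans ht.2⟩
    have hne : (nhdsWithin t (Set.Ico 0 t)).NeBot := by
      rw [nhdsWithin_Ico_eq_nhdsLT htpos]; infer_instance
    refine ge_of_tendsto h1 ?_
    filter_upwards [self_mem_nhdsWithin] with s hs using (hlt s hs u hu).le
  have hpsd : ∀ u, 0 ≤ q t u := by
    intro u
    by_cases hu : u = 0
    · subst hu
      have := hhom t 0 0
      simp at this
      exact this.ge
    have hnu : ‖u‖ ≠ 0 := norm_ne_zero_iff.2 hu
    have h2 := hpsd1 (‖u‖⁻¹ • u) (by simp [norm_smul, hnu])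
    rw [hhom] at h2
    exact nonneg_of_mul_nonneg_right h2 (by positivity)
  exact hv0 (hker t ht hpsd v (le_antisymm hqv (hpsd v)))

end BetheHessian

theorem Finset.sum_coe_eq_sum_dite {ι M : Type*} [Fintype ι] [DecidableEq ι] [AddCommMonoid M]
    (s : Finset ι) (f : {i // i ∈ s} → M) :
    ∑ i, f i = ∑ i : ι, if h : i ∈ s then f ⟨i, h⟩ else 0 := by
  have h1 : ∀ i : {i // i ∈ s}, f i = (fun i => if h : i ∈ s then f ⟨i, h⟩ else 0) i.1 := by
    intro i; simp [i.2]
  rw [Finset.sum_congr rfl fun i _ => h1 i]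
  rw [Finset.sum_coe_sort s (fun i => if h : i ∈ s then f ⟨i, h⟩ else 0)]
  refine Finset.sum_subset (Finset.subset_univ _) fun i _ hi => ?_
  simp [hi]

/-! ### The Bethe form and its nondegeneracy -/

namespace FactorGraph

variable {V : Type*} [Fintype V] [DecidableEq V] (H : FactorGraph V)
  {κ : V → Type*} [∀ i, Fintype (κ i)]

theorem degree_eq_sum (i : V) : (H.degree i : ℝ) = ∑ α : H.Edge, if i ∈ α.1 then 1 else 0 := by
  rw [degree, Finset.card_filter, Nat.cast_sum, ← Finset.sum_coe_sort H.hyperedges]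
  simp

/-- The components of `v` that belong to the vertices of `α`. -/
def restrictEdge (α : H.Edge) (v : ∀ i, κ i → ℝ) : (Σ i : {i : V // i ∈ α.1}, κ i.1) → ℝ :=
  fun p => v p.1.1 p.2

variable [∀ i, DecidableEq (κ i)]

/-- The bilinear form of the Bethe Hessian with edge covariances `C` and vertex covariances `Q`. -/
noncomputable def betheForm
    (C : ∀ α : H.Edge, Matrix (Σ i : {i : V // i ∈ α.1}, κ i.1) (Σ i : {i : V // i ∈ α.1}, κ i.1) ℝ)
    (Q : ∀ i, Matrix (κ i) (κ i) ℝ) (v u : ∀ i, κ i → ℝ) : ℝ :=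
  (∑ α, ((C α)⁻¹ *ᵥ H.restrictEdge α v) ⬝ᵥ H.restrictEdge α u) +
    ∑ i, (1 - (H.degree i : ℝ)) * (((Q i)⁻¹ *ᵥ v i) ⬝ᵥ u i)

variable {H}

theorem dotProduct_restrictEdge (α : H.Edge) (w : (Σ i : {i : V // i ∈ α.1}, κ i.1) → ℝ)
    (u : ∀ i, κ i → ℝ) :
    w ⬝ᵥ H.restrictEdge α u =
      ∑ i, (fun k => if h : i ∈ α.1 then w ⟨⟨i, h⟩, k⟩ else 0) ⬝ᵥ u i := by
  simp only [dotProduct, restrictEdge]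
  rw [Fintype.sum_sigma, Finset.sum_coe_eq_sum_dite]
  refine Finset.sum_congr rfl fun i _ => ?_
  split_ifs <;> simp

variable (H) in
/-- The adjoint of the map from vertex vectors to their restrictions to all the hyperedges and
vertices, with weights `1 - d_i` at the vertices. -/
def gather : ((∀ α : H.Edge, (Σ i : {i : V // i ∈ α.1}, κ i.1) → ℝ) × (∀ i, κ i → ℝ)) →ₗ[ℝ]
    (∀ i, κ i → ℝ) where
  toFun p i k := (∑ α : H.Edge, if h : i ∈ α.1 then p.1 α ⟨⟨i, h⟩, k⟩ else 0) +
    (1 - (H.degree i : ℝ)) * p.2 i k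
  map_add' p q := by
    funext i k
    have h : ∀ α : H.Edge, (if h : i ∈ α.1 then (p + q).1 α ⟨⟨i, h⟩, k⟩ else 0) =
        (if h : i ∈ α.1 then p.1 α ⟨⟨i, h⟩, k⟩ else 0) +
          if h : i ∈ α.1 then q.1 α ⟨⟨i, h⟩, k⟩ else 0 := by
      intro α; split_ifs <;> simp
    simp only [h, Finset.sum_add_distrib, Prod.snd_add, Pi.add_apply]
    ring
  map_smul' c p := by
    funext i k
    have h : ∀ α : H.Edge, (if h : i ∈ α.1 then (c • p).1 α ⟨⟨i, h⟩, k⟩ else 0) =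
        c * if h : i ∈ α.1 then p.1 α ⟨⟨i, h⟩, k⟩ else 0 := by
      intro α; split_ifs <;> simp
    simp only [h, ← Finset.mul_sum, Prod.smul_snd, Pi.smul_apply, smul_eq_mul, RingHom.id_apply]
    ring

theorem sum_gather_dotProduct
    (p : (∀ α : H.Edge, (Σ i : {i : V // i ∈ α.1}, κ i.1) → ℝ) × (∀ i, κ i → ℝ))
    (u : ∀ i, κ i → ℝ) : ∑ i, H.gather p i ⬝ᵥ u i =
      (∑ α, p.1 α ⬝ᵥ H.restrictEdge α u) + ∑ i, (1 - (H.degree i : ℝ)) * (p.2 i ⬝ᵥ u i) := by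
  simp only [dotProduct_restrictEdge]
  rw [Finset.sum_comm, ← Finset.sum_add_distrib]
  refine Finset.sum_congr rfl fun i _ => ?_
  simp only [gather, LinearMap.coe_mk, AddHom.coe_mk, dotProduct, add_mul, Finset.sum_add_distrib,
    Finset.sum_mul, Finset.mul_sum]
  rw [Finset.sum_comm]
  simp only [mul_assoc]

theorem eq_zero_of_sum_dotProduct_eq_zero {z : ∀ i, κ i → ℝ}
    (h : ∀ u : ∀ i, κ i → ℝ, ∑ i, z i ⬝ᵥ u i = 0) : z = 0 := by
  have h0 := h z
  rw [Finset.sum_eq_zero_iff_of_nonneg] at h0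
  · funext i
    have h1 := h0 i (Finset.mem_univ _)
    rwa [dotProduct_self_eq_zero] at h1
  · exact fun i _ => Finset.sum_nonneg fun k _ => mul_self_nonneg _

/-- The operator of the Bethe Hessian. -/
noncomputable def betheOp
    (C : ∀ α : H.Edge, Matrix (Σ i : {i : V // i ∈ α.1}, κ i.1) (Σ i : {i : V // i ∈ α.1}, κ i.1) ℝ)
    (Q : ∀ i, Matrix (κ i) (κ i) ℝ) (v : ∀ i, κ i → ℝ) : ∀ i, κ i → ℝ :=
  H.gather (fun α => (C α)⁻¹ *ᵥ H.restrictEdge α v, fun i => (Q i)⁻¹ *ᵥ v i)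

theorem betheForm_eq_sum
    (C : ∀ α : H.Edge, Matrix (Σ i : {i : V // i ∈ α.1}, κ i.1) (Σ i : {i : V // i ∈ α.1}, κ i.1) ℝ)
    (Q : ∀ i, Matrix (κ i) (κ i) ℝ) (v u : ∀ i, κ i → ℝ) :
    H.betheForm C Q v u = ∑ i, betheOp C Q v i ⬝ᵥ u i := by
  simp only [betheOp, sum_gather_dotProduct, betheForm]

theorem stationary_of_betheForm_eq_zero
    (C : ∀ α : H.Edge, Matrix (Σ i : {i : V // i ∈ α.1}, κ i.1) (Σ i : {i : V // i ∈ α.1}, κ i.1) ℝ)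
    (Q : ∀ i, Matrix (κ i) (κ i) ℝ) (v : ∀ i, κ i → ℝ) (hv : ∀ u, H.betheForm C Q v u = 0)
    (i : V) (k : κ i) :
    (∑ α : H.Edge, if h : i ∈ α.1 then ((C α)⁻¹ *ᵥ H.restrictEdge α v) ⟨⟨i, h⟩, k⟩ else 0) +
      (1 - (H.degree i : ℝ)) * ((Q i)⁻¹ *ᵥ v i) k = 0 := by
  have h := eq_zero_of_sum_dotProduct_eq_zero (z := betheOp C Q v) fun u => by
    rw [← betheForm_eq_sum]; exact hv u
  exact congrFun (congrFun h i) k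

/-- With U_i = Q_i⁻¹ v_i and W_α = C_α⁻¹ v|_α, the differences g_{α,i} = U_i - W_{α,i} behave like
messages: stationarity makes W_{α,j} the sum of g_{β,j} over β ≠ α, and comparing C_α W_α = v|_α
with Q_i U_i = v_i expresses Q_i g_{α,i} through the off-diagonal blocks. The correlation bounds
then give n ≤ M(w) n for the Q-norms n of g. Of C_α only invertibility matters here. -/
theorem betheForm_nondegenerate
    (C : ∀ α : H.Edge, Matrix (Σ i : {i : V // i ∈ α.1}, κ i.1) (Σ i : {i : V // i ∈ α.1}, κ i.1) ℝ)
    (Q : ∀ i, Matrix (κ i) (κ i) ℝ)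
    (w : ∀ α : H.Edge, {i : V // i ∈ α.1} → {i : V // i ∈ α.1} → ℝ)
    (hw : ∀ α i j, 0 ≤ w α i j)
    (hρ : spectralRadius ℂ ((H.dirEdgeMatrix w).map (algebraMap ℝ ℂ)) < 1)
    (hQ : ∀ i, (Q i).PosDef) (hC : ∀ α, IsUnit (C α).det)
    (hdiag : ∀ (α : H.Edge) (i : {i : V // i ∈ α.1}) k l, C α ⟨i, k⟩ ⟨i, l⟩ = Q i.1 k l)
    (hoff : ∀ (α : H.Edge) (i j : {i : V // i ∈ α.1}), i ≠ j → ∀ x y,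
      |∑ k, ∑ l, x k * C α ⟨i, k⟩ ⟨j, l⟩ * y l| ≤
        w α i j * √(x ⬝ᵥ Q i.1 *ᵥ x) * √(y ⬝ᵥ Q j.1 *ᵥ y))
    (v : ∀ i, κ i → ℝ) (hv : ∀ u, H.betheForm C Q v u = 0) : v = 0 := by
  have hst := stationary_of_betheForm_eq_zero C Q v hv
  set W : ∀ α : H.Edge, (Σ i : {i : V // i ∈ α.1}, κ i.1) → ℝ :=
    fun α => (C α)⁻¹ *ᵥ H.restrictEdge α v with hWdef
  set U : ∀ i, κ i → ℝ := fun i => (Q i)⁻¹ *ᵥ v i with hUdef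
  set g : H.Edge → ∀ i, κ i → ℝ := fun α i k =>
    if h : i ∈ α.1 then U i k - W α ⟨⟨i, h⟩, k⟩ else 0 with hg
  -- The sum is d_i U_i - Σ_α W_{α,i}, which stationarity identifies with U_i.
  have hgsum : ∀ i k, ∑ α, g α i k = U i k := by
    intro i k
    have h1 : ∑ α, g α i k = (H.degree i : ℝ) * U i k -
        ∑ α : H.Edge, if h : i ∈ α.1 then W α ⟨⟨i, h⟩, k⟩ else 0 := by
      rw [degree_eq_sum, Finset.sum_mul, ← Finset.sum_sub_distrib]
      refine Finset.sum_congr rfl fun α _ => ?_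
      simp only [hg]
      split_ifs <;> simp
    have h2 := hst i k
    rw [h1]
    linarith
  -- Leaving out α subtracts g_{α,j} from U_j, and what remains is W_{α,j}. This produces the
  -- condition β ≠ α of the directed edge matrix.
  have hWg : ∀ (α : H.Edge) (j : {i : V // i ∈ α.1}) l,
      W α ⟨j, l⟩ = ∑ β, if β ≠ α then g β j.1 l else 0 := by
    intro α j l
    have h1 : ∀ β, (if β ≠ α then g β j.1 l else 0) =
        g β j.1 l - if β = α then g β j.1 l else 0 := by
      intro β; by_cases h : β = α <;> simp [h]
    simp only [h1, Finset.sum_sub_distrib, hgsum, Finset.sum_ite_eq', Finset.mem_univ, if_true]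
    simp only [hg, j.2, dif_pos]
    ring
  -- Row i of C_α W_α = v|_α is compared with Q_i U_i = v_i. The diagonal block is Q_i, so only the
  -- terms with j ≠ i are left.
  have hrow : ∀ (α : H.Edge) (i : {i : V // i ∈ α.1}) k,
      (Q i.1 *ᵥ g α i.1) k =
        ∑ j : {i : V // i ∈ α.1}, if j ≠ i then ∑ l, C α ⟨i, k⟩ ⟨j, l⟩ * W α ⟨j, l⟩ else 0 := by
    intro α i k
    have h1 : C α *ᵥ W α = H.restrictEdge α v := by
      rw [hWdef, Matrix.mulVec_mulVec, Matrix.mul_nonsing_inv _ (hC α), Matrix.one_mulVec]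
    have h2 : Q i.1 *ᵥ U i.1 = v i.1 := by
      rw [hUdef, Matrix.mulVec_mulVec,
        Matrix.mul_nonsing_inv _ ((Matrix.isUnit_iff_isUnit_det _).1 (hQ i.1).isUnit),
        Matrix.one_mulVec]
    have h3 := congrFun h1 ⟨i, k⟩
    have h4 := congrFun h2 k
    simp only [Matrix.mulVec, dotProduct, restrictEdge, Fintype.sum_sigma] at h3 h4 ⊢
    have h5 : ∀ j : {i : V // i ∈ α.1},
        (if j ≠ i then ∑ l, C α ⟨i, k⟩ ⟨j, l⟩ * W α ⟨j, l⟩ else 0) =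
        (∑ l, C α ⟨i, k⟩ ⟨j, l⟩ * W α ⟨j, l⟩) -
          if j = i then ∑ l, C α ⟨i, k⟩ ⟨j, l⟩ * W α ⟨j, l⟩ else 0 := by
      intro j; by_cases h : j = i <;> simp [h]
    simp only [h5, Finset.sum_sub_distrib, Finset.sum_ite_eq', Finset.mem_univ, if_true, h3, hdiag,
      ← h4]
    simp only [hg, i.2, dif_pos, mul_sub, Finset.sum_sub_distrib]
  set n : H.Edge → V → ℝ := fun α i => √(g α i ⬝ᵥ Q i *ᵥ g α i) with hn
  have hn0 : ∀ α i, 0 ≤ n α i := fun α i => Real.sqrt_nonneg _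
  -- The bound on n sums over all β, the matrix only over directed edges β → j with j ∈ β; the extra
  -- terms vanish.
  have hnout : ∀ (α : H.Edge) i, i ∉ α.1 → n α i = 0 := by
    intro α i hi
    have : g α i = 0 := by funext k; simp [hg, hi]
    simp [hn, this]
  have hnsq : ∀ α i, n α i * n α i = g α i ⬝ᵥ Q i *ᵥ g α i := fun α i =>
    Real.mul_self_sqrt (by simpa using (hQ i).posSemidef.dotProduct_mulVec_nonneg (g α i))
  have hmain : ∀ (α : H.Edge) (i : {i : V // i ∈ α.1}), n α i.1 ≤
      ∑ j : {i : V // i ∈ α.1}, if j ≠ i then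
        ∑ β, if β ≠ α then w α i j * n β j.1 else 0 else 0 := by
    intro α i
    have hR : 0 ≤ ∑ j : {i : V // i ∈ α.1}, if j ≠ i then
        ∑ β, if β ≠ α then w α i j * n β j.1 else 0 else 0 := by
      refine Finset.sum_nonneg fun j _ => ?_
      split_ifs
      · refine Finset.sum_nonneg fun β _ => ?_
        split_ifs
        · exact mul_nonneg (hw _ _ _) (hn0 _ _)
        · exact le_rfl
      · exact le_rfl
    rcases (hn0 α i.1).eq_or_lt with h0 | hpos
    · rw [← h0]; exact hR
    -- After multiplication by n_{α,i} the left side is g_{α,i}ᵀ Q_i g_{α,i}, which is bilinear in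
    -- the messages and open to `hoff`.
    refine le_of_mul_le_mul_left ?_ hpos
    rw [hnsq]
    simp only [dotProduct, hrow, Finset.mul_sum]
    rw [Finset.sum_comm]
    refine Finset.sum_le_sum fun j _ => ?_
    split_ifs with hj
    · simp only [hWg, Finset.mul_sum]
      have e1 : (∑ k, ∑ l, ∑ β, g α i.1 k * (C α ⟨i, k⟩ ⟨j, l⟩ * if β ≠ α then g β j.1 l else 0)) =
          ∑ β, if β ≠ α then ∑ k, ∑ l, g α i.1 k * C α ⟨i, k⟩ ⟨j, l⟩ * g β j.1 l else 0 := by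
        simp only [Finset.sum_comm (s := (Finset.univ : Finset (κ j.1)))
          (t := (Finset.univ : Finset H.Edge))]
        rw [Finset.sum_comm]
        refine Finset.sum_congr rfl fun β _ => ?_
        split_ifs
        · simp only [mul_assoc]
        · simp
      rw [e1]
      refine Finset.sum_le_sum fun β _ => ?_
      split_ifs with hβ
      · refine (le_abs_self _).trans ((hoff α i j (Ne.symm hj) _ _).trans (le_of_eq ?_))
        simp only [hn]; ring
      · simp
    · simp
  have hzero := eq_zero_of_le_mulVec (H.dirEdgeMatrix w) (fun e e' => by
      simp only [dirEdgeMatrix, Matrix.of_apply]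
      split_ifs
      · exact hw _ _ _
      · exact le_rfl
      · exact le_rfl) hρ (fun e => n e.1 e.2.1) (fun e => hn0 _ _) (by
      rintro ⟨α, i⟩
      refine (hmain α i).trans (le_of_eq ?_)
      simp only [Matrix.mulVec, dotProduct, dirEdgeMatrix, Matrix.of_apply]
      rw [Fintype.sum_sigma]
      simp only [Finset.sum_coe_eq_sum_dite α.1,
        fun β : H.Edge => Finset.sum_coe_eq_sum_dite (M := ℝ) β.1]
      rw [Finset.sum_comm]
      refine Finset.sum_congr rfl fun j _ => ?_
      by_cases hj : j ∈ α.1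
      · by_cases hji : j = i.1
        · simp [hji]
        · have : (⟨j, hj⟩ : {i : V // i ∈ α.1}) ≠ i := fun h => hji (congrArg Subtype.val h)
          simp only [hj, dif_pos, this, ne_eq, not_false_eq_true, if_true, hji, true_and]
          refine Finset.sum_congr rfl fun β _ => ?_
          by_cases hjβ : j ∈ β.1
          · simp [hjβ]
          · simp [hjβ, hnout β j hjβ]
      · simp [hj])
  have hgz : ∀ α i, g α i = 0 := by
    intro α i
    by_cases hi : i ∈ α.1
    · have h1 : n α i = 0 := congrFun hzero ⟨α, ⟨i, hi⟩⟩
      by_contra hne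
      have h2 := (hQ i).dotProduct_mulVec_pos hne
      have h3 := hnsq α i
      simp only [star_trivial] at h2
      rw [h1] at h3
      linarith
    · funext k; simp [hg, hi]
  have hU0 : ∀ i, U i = 0 := fun i => by
    funext k
    rw [← hgsum i k]
    simp [hgz]
  funext i
  have h2 : Q i *ᵥ U i = v i := by
    rw [hUdef, Matrix.mulVec_mulVec,
      Matrix.mul_nonsing_inv _ ((Matrix.isUnit_iff_isUnit_det _).1 (hQ i).isUnit),
      Matrix.one_mulVec]
  rw [← h2, hU0]
  simp

end FactorGraph

/-! ### Block diagonal matrices -/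

namespace Matrix

variable {ι : Type*} [Fintype ι] [DecidableEq ι] {κ : ι → Type*} [∀ i, Fintype (κ i)]
  [∀ i, DecidableEq (κ i)]

theorem blockDiagonal'_mulVec (Q : ∀ i, Matrix (κ i) (κ i) ℝ) (x : (Σ i, κ i) → ℝ) (i : ι)
    (k : κ i) : (blockDiagonal' Q *ᵥ x) ⟨i, k⟩ = (Q i *ᵥ fun l => x ⟨i, l⟩) k := by
  simp only [mulVec, dotProduct, Fintype.sum_sigma]
  rw [Finset.sum_eq_single i]
  · simp
  · intro j _ hj
    refine Finset.sum_eq_zero fun l _ => ?_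
    rw [blockDiagonal'_apply_ne _ _ _ (Ne.symm hj), zero_mul]
  · simp

theorem PosDef.blockDiagonal' {Q : ∀ i, Matrix (κ i) (κ i) ℝ} (hQ : ∀ i, (Q i).PosDef) :
    (blockDiagonal' Q).PosDef := by
  have hform : ∀ x : (Σ i, κ i) → ℝ, x ⬝ᵥ Matrix.blockDiagonal' Q *ᵥ x =
      ∑ i, (fun l => x ⟨i, l⟩) ⬝ᵥ Q i *ᵥ (fun l => x ⟨i, l⟩) := by
    intro x
    rw [dotProduct, Fintype.sum_sigma]
    simp only [blockDiagonal'_mulVec]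
    rfl
  refine PosDef.of_dotProduct_mulVec_pos ?_ fun {x} hx => ?_
  · rw [IsHermitian, blockDiagonal'_conjTranspose]
    congr 1
    funext i
    exact (hQ i).1
  · rw [star_trivial, hform]
    obtain ⟨⟨i, k⟩, hik⟩ := Function.ne_iff.1 hx
    refine Finset.sum_pos' (fun j _ => ?_) ⟨i, Finset.mem_univ _, ?_⟩
    · simpa using (hQ j).posSemidef.dotProduct_mulVec_nonneg (fun l => x ⟨j, l⟩)
    · have : (fun l => x ⟨i, l⟩) ≠ 0 := fun h => hik (congrFun h k)
      simpa using (hQ i).dotProduct_mulVec_pos this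

theorem inv_blockDiagonal' {Q : ∀ i, Matrix (κ i) (κ i) ℝ} (hQ : ∀ i, IsUnit (Q i).det) :
    (Matrix.blockDiagonal' Q)⁻¹ = Matrix.blockDiagonal' fun i => (Q i)⁻¹ := by
  refine inv_eq_right_inv ?_
  rw [← blockDiagonal'_mul]
  have : (fun i => Q i * (Q i)⁻¹) = fun i => (1 : Matrix (κ i) (κ i) ℝ) :=
    funext fun i => mul_nonsing_inv _ (hQ i)
  rw [this]
  exact blockDiagonal'_one

theorem dotProduct_inv_mulVec_comm {n : Type*} [Fintype n] [DecidableEq n] {M : Matrix n n ℝ}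
    (hM : M.IsHermitian) (x y : n → ℝ) : (M⁻¹ *ᵥ x) ⬝ᵥ y = (M⁻¹ *ᵥ y) ⬝ᵥ x := by
  have h : (M⁻¹)ᵀ = M⁻¹ := by
    rw [transpose_nonsing_inv]
    congr 1
  rw [dotProduct_comm, dotProduct_mulVec, ← mulVec_transpose, h]

end Matrix

/-! ### Positivity of the Bethe form by deformation to block diagonal covariances -/

namespace FactorGraph

variable {V : Type*} [Fintype V] [DecidableEq V] {H : FactorGraph V}
  {κ : V → Type*} [∀ i, Fintype (κ i)] [∀ i, DecidableEq (κ i)]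

theorem betheForm_add_smul
    {C : ∀ α : H.Edge, Matrix (Σ i : {i : V // i ∈ α.1}, κ i.1) (Σ i : {i : V // i ∈ α.1}, κ i.1) ℝ}
    {Q : ∀ i, Matrix (κ i) (κ i) ℝ} (hC : ∀ α, (C α).IsHermitian) (hQ : ∀ i, (Q i).IsHermitian)
    (v u : ∀ i, κ i → ℝ) (s : ℝ) :
    H.betheForm C Q (v + s • u) (v + s • u) =
      H.betheForm C Q v v + 2 * s * H.betheForm C Q v u + s ^ 2 * H.betheForm C Q u u := by
  have h1 : ∀ α, H.restrictEdge α (v + s • u) = H.restrictEdge α v + s • H.restrictEdge α u :=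
    fun α => rfl
  simp only [betheForm, h1, Finset.mul_sum, mul_add]
  rw [show ∀ a b c d e f : ℝ, a + b + (c + d) + (e + f) = (a + c + e) + (b + d + f) by
    intros; ring]
  simp only [← Finset.sum_add_distrib]
  congr 1
  · refine Finset.sum_congr rfl fun α _ => ?_
    simp only [Matrix.mulVec_add, Matrix.mulVec_smul, add_dotProduct, dotProduct_add,
      smul_dotProduct, dotProduct_smul, smul_eq_mul]
    rw [Matrix.dotProduct_inv_mulVec_comm (hC α) (H.restrictEdge α u) (H.restrictEdge α v)]
    ring
  · refine Finset.sum_congr rfl fun i _ => ?_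
    simp only [Pi.add_apply, Pi.smul_apply, Matrix.mulVec_add, Matrix.mulVec_smul, add_dotProduct,
      dotProduct_add, smul_dotProduct, dotProduct_smul, smul_eq_mul]
    rw [Matrix.dotProduct_inv_mulVec_comm (hQ i) (u i) (v i)]
    ring

/-- The Bethe Hessian is positive definite if the directed edge matrix of correlation bounds has
spectral radius `< 1`. -/
theorem betheForm_pos
    (C : ∀ α : H.Edge, Matrix (Σ i : {i : V // i ∈ α.1}, κ i.1) (Σ i : {i : V // i ∈ α.1}, κ i.1) ℝ)
    (Q : ∀ i, Matrix (κ i) (κ i) ℝ)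
    (w : ∀ α : H.Edge, {i : V // i ∈ α.1} → {i : V // i ∈ α.1} → ℝ)
    (hw : ∀ α i j, 0 ≤ w α i j)
    (hρ : spectralRadius ℂ ((H.dirEdgeMatrix w).map (algebraMap ℝ ℂ)) < 1)
    (hQ : ∀ i, (Q i).PosDef) (hC : ∀ α, (C α).PosDef)
    (hdiag : ∀ (α : H.Edge) (i : {i : V // i ∈ α.1}) k l, C α ⟨i, k⟩ ⟨i, l⟩ = Q i.1 k l)
    (hoff : ∀ (α : H.Edge) (i j : {i : V // i ∈ α.1}), i ≠ j → ∀ x y,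
      |∑ k, ∑ l, x k * C α ⟨i, k⟩ ⟨j, l⟩ * y l| ≤
        w α i j * √(x ⬝ᵥ Q i.1 *ᵥ x) * √(y ⬝ᵥ Q j.1 *ᵥ y))
    (v : ∀ i, κ i → ℝ) (hv : v ≠ 0) : 0 < H.betheForm C Q v v := by
  set B : ∀ α : H.Edge,
      Matrix (Σ i : {i : V // i ∈ α.1}, κ i.1) (Σ i : {i : V // i ∈ α.1}, κ i.1) ℝ :=
    fun α => Matrix.blockDiagonal' fun i : {i : V // i ∈ α.1} => Q i.1 with hB
  have hBpos : ∀ α, (B α).PosDef := fun α => Matrix.PosDef.blockDiagonal' fun i => hQ i.1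
  -- Only the off-diagonal blocks change, by the factor t, so the bound `hoff` persists for t ≤ 1,
  -- and so does positive definiteness.
  set D : ℝ → ∀ α : H.Edge,
      Matrix (Σ i : {i : V // i ∈ α.1}, κ i.1) (Σ i : {i : V // i ∈ α.1}, κ i.1) ℝ :=
    fun t α => (1 - t) • B α + t • C α with hD
  have hDpos : ∀ t ∈ Set.Icc (0 : ℝ) 1, ∀ α, (D t α).PosDef := by
    intro t ht α
    rcases ht.1.eq_or_lt with h | h
    · simpa [hD, ← h] using hBpos α
    · exact Matrix.PosDef.posSemidef_add ((hBpos α).posSemidef.smul (by linarith [ht.2]))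
        ((hC α).smul h)
  have hD1 : D 1 = C := by funext α; simp [hD]
  rw [← hD1]
  refine form_pos_of_path (fun t v => H.betheForm (D t) Q v v) ?_ ?_ ?_ ?_ v hv
  -- The inverse is written as the adjugate over the determinant, which does not vanish on the path.
  · simp only [betheForm, Matrix.mulVec, dotProduct, restrictEdge, Matrix.inv_def, Matrix.smul_apply,
      Ring.inverse_eq_inv', smul_eq_mul]
    have hdet : ∀ α, Continuous fun p : ℝ × (∀ i, κ i → ℝ) => (D p.1 α).det := by
      intro α
      refine Continuous.matrix_det ?_
      simp only [hD]
      fun_prop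
    have hadj : ∀ α a b, Continuous fun p : ℝ × (∀ i, κ i → ℝ) => (D p.1 α).adjugate a b := by
      intro α a b
      refine Continuous.matrix_elem (Continuous.matrix_adjugate ?_) a b
      simp only [hD]
      fun_prop
    refine ContinuousOn.add (continuousOn_finsetSum _ fun α _ => continuousOn_finsetSum _ fun a _ =>
      ContinuousOn.mul (continuousOn_finsetSum _ fun b _ => ContinuousOn.mul (ContinuousOn.mul
        ((hdet α).continuousOn.inv₀ fun p hp => ((hDpos p.1 hp.1 α).det_pos).ne')
        (hadj α a b).continuousOn) ?_) ?_) ?_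
    · exact Continuous.continuousOn (by fun_prop)
    · exact Continuous.continuousOn (by fun_prop)
    · exact Continuous.continuousOn (by fun_prop)
  · intro t s v
    have h1 : ∀ α, H.restrictEdge α (s • v) = s • H.restrictEdge α v := fun α => rfl
    simp only [betheForm, h1, Pi.smul_apply, Matrix.mulVec_smul, smul_dotProduct, dotProduct_smul,
      smul_eq_mul, mul_add, Finset.mul_sum]
    congr 1
    · exact Finset.sum_congr rfl fun _ _ => by ring
    · exact Finset.sum_congr rfl fun _ _ => by ring
  · intro v hv
    have hD0 : ∀ α, (D 0 α)⁻¹ = Matrix.blockDiagonal' fun i : {i : V // i ∈ α.1} => (Q i.1)⁻¹ := by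
      intro α
      simp only [hD, sub_zero, one_smul, zero_smul, add_zero, hB]
      exact Matrix.inv_blockDiagonal' fun i => (Matrix.isUnit_iff_isUnit_det _).1 (hQ i.1).isUnit
    -- Each of the d_i hyperedges at i contributes one copy of v_iᵀ Q_i⁻¹ v_i; with the weight 1 -
    -- d_i exactly one copy survives.
    have h1 : H.betheForm (D 0) Q v v = ∑ i, v i ⬝ᵥ (Q i)⁻¹ *ᵥ v i := by
      simp only [betheForm, dotProduct_restrictEdge]
      rw [Finset.sum_comm, ← Finset.sum_add_distrib]
      refine Finset.sum_congr rfl fun i _ => ?_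
      have h2 : ∀ α : H.Edge, (fun k => if h : i ∈ α.1 then
          ((D 0 α)⁻¹ *ᵥ H.restrictEdge α v) ⟨⟨i, h⟩, k⟩ else 0) ⬝ᵥ v i =
          (if i ∈ α.1 then 1 else 0) * (((Q i)⁻¹ *ᵥ v i) ⬝ᵥ v i) := by
        intro α
        by_cases h : i ∈ α.1
        · simp only [h, dif_pos, if_true, one_mul, hD0, Matrix.blockDiagonal'_mulVec]
          rfl
        · simp [h, dotProduct]
      simp only [h2, ← Finset.sum_mul, ← degree_eq_sum]
      rw [dotProduct_comm (v i)]
      ring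
    rw [h1]
    obtain ⟨i, hi⟩ := Function.ne_iff.1 hv
    refine Finset.sum_pos' (fun j _ => ?_) ⟨i, Finset.mem_univ _, ?_⟩
    · simpa using (hQ j).inv.posSemidef.dotProduct_mulVec_nonneg (v j)
    · simpa using (hQ i).inv.dotProduct_mulVec_pos hi
  · intro t ht hpsd v hv
    refine betheForm_nondegenerate (D t) Q w hw hρ hQ
      (fun α => (Matrix.isUnit_iff_isUnit_det _).1 (hDpos t ht α).isUnit) ?_ ?_ v ?_
    · intro α i k l
      simp only [hD, hB, Matrix.add_apply, Matrix.smul_apply, Matrix.blockDiagonal'_apply_eq, hdiag,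
        smul_eq_mul]
      ring
    · intro α i j hij x y
      have h1 : ∀ k l, D t α ⟨i, k⟩ ⟨j, l⟩ = t * C α ⟨i, k⟩ ⟨j, l⟩ := by
        intro k l
        simp only [hD, hB, Matrix.add_apply, Matrix.smul_apply,
          Matrix.blockDiagonal'_apply_ne _ _ _ hij, smul_eq_mul]
        ring
      have h2 : ∑ k, ∑ l, x k * D t α ⟨i, k⟩ ⟨j, l⟩ * y l =
          t * ∑ k, ∑ l, x k * C α ⟨i, k⟩ ⟨j, l⟩ * y l := by
        simp only [h1, Finset.mul_sum]
        exact Finset.sum_congr rfl fun _ _ => Finset.sum_congr rfl fun _ _ => by ring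
      rw [h2, abs_mul, abs_of_nonneg ht.1]
      exact (mul_le_of_le_one_left (abs_nonneg _) ht.2).trans (hoff α i j hij x y)
    · intro u
      exact mulVec_eq_zero_of_form_nonneg (fun v u => H.betheForm (D t) Q v u)
        (fun v => H.betheForm (D t) Q v v)
        (betheForm_add_smul (fun α => (hDpos t ht α).1) fun i => (hQ i).1) hpsd v hv u

end FactorGraph

/-! ### Normalized laws -/

section NormalizedLaw

variable {Ω : Type*} [MeasurableSpace Ω] {ν : Measure Ω} {g : Ω → ℝ}

theorem integral_pos_of_pos (hν : ν ≠ 0) (hg : ∀ x, 0 < g x) (hi : Integrable g ν) :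
    0 < ∫ x, g x ∂ν := by
  rw [integral_pos_iff_support_of_nonneg (fun x => (hg x).le) hi]
  have : Function.support g = Set.univ := by
    ext x; simp [(hg x).ne']
  rw [this]
  exact Measure.measure_univ_pos.2 hν

theorem integral_normalizedLaw (hm : Measurable g) (hg : ∀ x, 0 ≤ g x) (f : Ω → ℝ) :
    ∫ x, f x ∂(normalizedLaw ν g) = (∫ x, g x * f x ∂ν) / ∫ x, g x ∂ν := by
  have hZ : 0 ≤ ∫ x, g x ∂ν := integral_nonneg hg
  rw [normalizedLaw, integral_withDensity_eq_integral_toReal_smul₀ (by fun_prop) (by simp),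
    ← integral_div]
  refine integral_congr_ae (Filter.Eventually.of_forall fun x => ?_)
  simp only [smul_eq_mul]
  rw [ENNReal.toReal_ofReal (div_nonneg (hg x) hZ)]
  ring

theorem integrable_normalizedLaw_iff (hm : Measurable g) (hg : ∀ x, 0 ≤ g x)
    (hZ : 0 < ∫ x, g x ∂ν) (f : Ω → ℝ) :
    Integrable f (normalizedLaw ν g) ↔ Integrable (fun x => g x * f x) ν := by
  rw [normalizedLaw, integrable_withDensity_iff_integrable_smul' (by fun_prop) (by simp)]
  have : (fun x => (ENNReal.ofReal (g x / ∫ y, g y ∂ν)).toReal • f x) =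
      fun x => (∫ y, g y ∂ν)⁻¹ * (g x * f x) := by
    funext x
    rw [ENNReal.toReal_ofReal (div_nonneg (hg x) hZ.le), smul_eq_mul]
    ring
  rw [this, integrable_const_mul_iff (isUnit_iff_ne_zero.2 (inv_ne_zero hZ.ne'))]

theorem isProbabilityMeasure_normalizedLaw (hg : ∀ x, 0 ≤ g x) (hi : Integrable g ν)
    (hZ : 0 < ∫ x, g x ∂ν) : IsProbabilityMeasure (normalizedLaw ν g) := by
  refine ⟨?_⟩
  rw [normalizedLaw, withDensity_apply _ MeasurableSet.univ, setLIntegral_univ, ← ofReal_integral_eq_lintegral_ofReal (hi.div_const _)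
    (Filter.Eventually.of_forall fun x => div_nonneg (hg x) hZ.le), integral_div,
    div_self hZ.ne', ENNReal.ofReal_one]

theorem ae_normalizedLaw_iff (hm : Measurable g) (hg : ∀ x, 0 < g x)
    (hZ : 0 < ∫ x, g x ∂ν) {p : Ω → Prop} :
    (∀ᵐ x ∂(normalizedLaw ν g), p x) ↔ ∀ᵐ x ∂ν, p x := by
  rw [normalizedLaw, ae_withDensity_iff (by fun_prop)]
  refine ⟨fun h => h.mono fun x hx => hx ?_, fun h => h.mono fun x hx _ => hx⟩
  simpa using div_pos (hg x) hZ

end NormalizedLaw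

/-! ### Differentiation of exponential integrals -/

namespace ExpFamily

open Filter Topology

variable {Ω n : Type*} [MeasurableSpace Ω] [Fintype n] {ν : Measure Ω} {φ : Ω → n → ℝ}

/-- The linear functional `v ↦ ⟨y, v⟩`. -/
noncomputable def dotCLM (y : n → ℝ) : (n → ℝ) →L[ℝ] ℝ :=
  ∑ k, y k • ContinuousLinearMap.proj (R := ℝ) k

theorem dotCLM_apply (y v : n → ℝ) : dotCLM y v = y ⬝ᵥ v := by
  simp [dotCLM, dotProduct]

theorem norm_dotCLM_le (y : n → ℝ) : ‖dotCLM y‖ ≤ ∑ k, |y k| := by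
  refine ContinuousLinearMap.opNorm_le_bound _ (Finset.sum_nonneg fun _ _ => abs_nonneg _)
    fun v => ?_
  rw [dotCLM_apply, dotProduct, Finset.sum_mul]
  refine (norm_sum_le _ _).trans (Finset.sum_le_sum fun k _ => ?_)
  rw [norm_mul]
  exact mul_le_mul_of_nonneg_left (norm_le_pi_norm v k) (abs_nonneg _)

theorem continuous_dotCLM : Continuous (dotCLM : (n → ℝ) → _) := by
  unfold dotCLM
  fun_prop

theorem measurable_dotProduct (hφ : Measurable φ) (θ : n → ℝ) :
    Measurable fun x => θ ⬝ᵥ φ x := by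
  simp only [dotProduct]
  exact Finset.measurable_sum _ fun k _ => ((measurable_pi_apply k).comp hφ).const_mul _

theorem measurable_exp (hφ : Measurable φ) (θ : n → ℝ) :
    Measurable fun x => Real.exp (θ ⬝ᵥ φ x) :=
  Real.measurable_exp.comp (measurable_dotProduct hφ θ)

/-- One has exp (δ Σ |y_k|) ≤ ∏ (exp (δ y_k) + exp (-δ y_k)). Expanding the product gives one term
for each corner `τ t` of the cube of radius δ about θ. The cube is a closed sup-norm ball inside U,
so every term is integrable. -/
theorem exists_integrable_exp_mul_exp_abs (hφ : Measurable φ) {h : Ω → ℝ} (hh : Measurable h)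
    {U : Set (n → ℝ)} (hU : IsOpen U)
    (hinteg : ∀ θ ∈ U, Integrable (fun x => Real.exp (θ ⬝ᵥ φ x) * h x) ν) {θ : n → ℝ} (hθ : θ ∈ U) :
    ∃ δ > 0, Integrable
      (fun x => Real.exp (θ ⬝ᵥ φ x) * Real.exp (δ * ∑ k, |φ x k|) * |h x|) ν := by
  classical
  obtain ⟨δ, hδ, hball⟩ := Metric.nhds_basis_closedBall.mem_iff.1 (hU.mem_nhds hθ)
  refine ⟨δ, hδ, ?_⟩
  set τ : Finset n → n → ℝ := fun t k => θ k + if k ∈ t then δ else -δ with hτ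
  have hτU : ∀ t, τ t ∈ U := by
    intro t
    refine hball ?_
    rw [mem_closedBall_iff_norm, pi_norm_le_iff_of_nonneg hδ.le]
    intro k
    simp only [hτ, Pi.sub_apply, add_sub_cancel_left]
    split_ifs <;> simp [abs_of_pos hδ]
  have hdom : Integrable (fun x => ∑ t ∈ (Finset.univ : Finset n).powerset,
      |Real.exp (τ t ⬝ᵥ φ x) * h x|) ν :=
    integrable_finsetSum _ fun t _ => (hinteg _ (hτU t)).abs
  have hm1 : Measurable fun x => ∑ k, |φ x k| :=
    Finset.measurable_sum _ fun k _ => ((measurable_pi_apply k).comp hφ).abs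
  refine hdom.mono' (((measurable_exp hφ θ).mul
    (Real.measurable_exp.comp (hm1.const_mul δ))).mul hh.abs).aestronglyMeasurable
    (Filter.Eventually.of_forall fun x => ?_)
  rw [Real.norm_of_nonneg (by positivity)]
  have h1 : Real.exp (δ * ∑ k, |φ x k|) ≤
      ∏ k, (Real.exp (δ * φ x k) + Real.exp (-δ * φ x k)) := by
    rw [Finset.mul_sum, Real.exp_sum]
    refine Finset.prod_le_prod (fun _ _ => (Real.exp_pos _).le) fun k _ => ?_
    rcases abs_cases (φ x k) with ⟨h, _⟩ | ⟨h, _⟩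
    · rw [h]; linarith [Real.exp_pos (-δ * φ x k)]
    · rw [h, mul_neg, neg_mul]; linarith [Real.exp_pos (δ * φ x k)]
  rw [Finset.prod_add] at h1
  have h2 : ∀ t, |Real.exp (τ t ⬝ᵥ φ x) * h x| = Real.exp (θ ⬝ᵥ φ x) *
      ((∏ i ∈ t, Real.exp (δ * φ x i)) * ∏ i ∈ Finset.univ \ t, Real.exp (-δ * φ x i)) * |h x| := by
    intro t
    rw [abs_mul, abs_of_pos (Real.exp_pos _), ← Real.exp_sum, ← Real.exp_sum, ← Real.exp_add,
      ← Real.exp_add]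
    congr 2
    simp only [hτ, dotProduct, add_mul, Finset.sum_add_distrib]
    congr 1
    rw [← Finset.sum_sdiff (Finset.subset_univ t), add_comm]
    congr 1
    · exact Finset.sum_congr rfl fun k hk => by simp [hk]
    · exact Finset.sum_congr rfl fun k hk => by simp [(Finset.mem_sdiff.1 hk).2]
  simp only [h2]
  rw [← Finset.sum_mul, ← Finset.mul_sum]
  gcongr

theorem exp_le_of_norm_le (y θ θ' : n → ℝ) {δ : ℝ} (hδ : ‖θ' - θ‖ ≤ δ) :
    Real.exp (θ' ⬝ᵥ y) ≤ Real.exp (θ ⬝ᵥ y) * Real.exp (δ * ∑ k, |y k|) := by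
  rw [← Real.exp_add, Real.exp_le_exp]
  have h1 : (θ' - θ) ⬝ᵥ y ≤ δ * ∑ k, |y k| := by
    rw [dotProduct, Finset.mul_sum]
    refine Finset.sum_le_sum fun k _ => ?_
    refine (le_abs_self _).trans ?_
    rw [abs_mul]
    exact mul_le_mul_of_nonneg_right ((norm_le_pi_norm (θ' - θ) k).trans hδ) (abs_nonneg _)
  rw [sub_dotProduct] at h1
  linarith

/-- The dominating function for differentiation under the integral. Half of δ pays for replacing θ
by θ', the other half for the linear factor, through s ≤ (2 / δ) exp (δ s / 2). -/
theorem integrable_exp_mul_abs (hφ : Measurable φ) {h : Ω → ℝ} (hh : Measurable h)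
    {U : Set (n → ℝ)} (hU : IsOpen U)
    (hinteg : ∀ θ ∈ U, Integrable (fun x => Real.exp (θ ⬝ᵥ φ x) * h x) ν) {θ : n → ℝ} (hθ : θ ∈ U) :
    ∃ ε > 0, ∃ b : Ω → ℝ, Integrable b ν ∧ ∀ x, ∀ θ' ∈ Metric.ball θ ε,
      |Real.exp (θ' ⬝ᵥ φ x) * h x| * ∑ k, |φ x k| ≤ b x := by
  obtain ⟨δ, hδ, hi⟩ := exists_integrable_exp_mul_exp_abs hφ hh hU hinteg hθ
  refine ⟨δ / 2, by positivity, _, hi.const_mul (2 / δ), fun x θ' hθ' => ?_⟩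
  have h1 := exp_le_of_norm_le (φ x) θ θ' (mem_ball_iff_norm.1 hθ').le
  set s := ∑ k, |φ x k| with hs
  have hs0 : 0 ≤ s := Finset.sum_nonneg fun _ _ => abs_nonneg _
  have h2 : s ≤ 2 / δ * Real.exp (δ / 2 * s) := by
    have := Real.add_one_le_exp (δ / 2 * s)
    have h3 : s = 2 / δ * (δ / 2 * s) := by field_simp
    calc s = 2 / δ * (δ / 2 * s) := h3
      _ ≤ _ := by gcongr; linarith
  rw [abs_mul, abs_of_pos (Real.exp_pos _)]
  have h4 : Real.exp (δ * s) = Real.exp (δ / 2 * s) * Real.exp (δ / 2 * s) := by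
    rw [← Real.exp_add]; congr 1; ring
  calc Real.exp (θ' ⬝ᵥ φ x) * |h x| * s
      ≤ (Real.exp (θ ⬝ᵥ φ x) * Real.exp (δ / 2 * s)) * |h x| * (2 / δ * Real.exp (δ / 2 * s)) := by
        gcongr
    _ = _ := by rw [h4]; ring

theorem integrable_exp_mul_stat (hφ : Measurable φ) {h : Ω → ℝ} (hh : Measurable h)
    {U : Set (n → ℝ)} (hU : IsOpen U)
    (hinteg : ∀ θ ∈ U, Integrable (fun x => Real.exp (θ ⬝ᵥ φ x) * h x) ν) {θ : n → ℝ} (hθ : θ ∈ U)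
    (k : n) : Integrable (fun x => Real.exp (θ ⬝ᵥ φ x) * (h x * φ x k)) ν := by
  obtain ⟨ε, hε, b, hb, hle⟩ := integrable_exp_mul_abs hφ hh hU hinteg hθ
  refine hb.mono' ((measurable_exp hφ θ).mul
    (hh.mul ((measurable_pi_apply k).comp hφ))).aestronglyMeasurable
    (Filter.Eventually.of_forall fun x => ?_)
  refine le_trans ?_ (hle x θ (Metric.mem_ball_self hε))
  rw [← mul_assoc, norm_mul]
  exact mul_le_mul_of_nonneg_left
    (Finset.single_le_sum (f := fun k => |φ x k|) (fun _ _ => abs_nonneg _) (Finset.mem_univ k))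
    (norm_nonneg _)

/-- The factor `h` allows iteration: h = 1, φ_k and φ_k φ_l give the derivatives of the partition
function and of the first moments, and the continuity of the second moments. -/
theorem hasFDerivAt_integral_exp_mul (hφ : Measurable φ) {h : Ω → ℝ} (hh : Measurable h)
    {U : Set (n → ℝ)} (hU : IsOpen U)
    (hinteg : ∀ θ ∈ U, Integrable (fun x => Real.exp (θ ⬝ᵥ φ x) * h x) ν) {θ : n → ℝ} (hθ : θ ∈ U) :
    HasFDerivAt (fun θ => ∫ x, Real.exp (θ ⬝ᵥ φ x) * h x ∂ν)
      (dotCLM fun k => ∫ x, Real.exp (θ ⬝ᵥ φ x) * (h x * φ x k) ∂ν) θ := by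
  obtain ⟨ε, hε, b, hb, hle⟩ := integrable_exp_mul_abs hφ hh hU hinteg hθ
  have hmeasF : ∀ θ, Measurable fun x => Real.exp (θ ⬝ᵥ φ x) * h x :=
    fun θ => (measurable_exp hφ θ).mul hh
  have hI := integrable_exp_mul_stat hφ hh hU hinteg hθ
  have hF'int : ∀ k ∈ (Finset.univ : Finset n), Integrable (fun x =>
      (Real.exp (θ ⬝ᵥ φ x) * (h x * φ x k)) • ContinuousLinearMap.proj (R := ℝ)
        (φ := fun _ : n => ℝ) k) ν := fun k _ => (hI k).smul_const _
  have heq : ∀ θ x, (Real.exp (θ ⬝ᵥ φ x) * h x) • dotCLM (φ x) =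
      ∑ k, (Real.exp (θ ⬝ᵥ φ x) * (h x * φ x k)) • ContinuousLinearMap.proj (R := ℝ)
        (φ := fun _ : n => ℝ) k := by
    intro θ x
    simp only [dotCLM, Finset.smul_sum, smul_smul, mul_assoc]
  have hkey := hasFDerivAt_integral_of_dominated_of_fderiv_le (𝕜 := ℝ) (μ := ν)
    (F := fun θ x => Real.exp (θ ⬝ᵥ φ x) * h x)
    (F' := fun θ x => (Real.exp (θ ⬝ᵥ φ x) * h x) • dotCLM (φ x)) (x₀ := θ) (bound := b)
    (s := Metric.ball θ ε) (Metric.ball_mem_nhds θ hε)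
    (Eventually.of_forall fun θ => (hmeasF θ).aestronglyMeasurable) (hinteg θ hθ) ?_
    (Eventually.of_forall fun x θ' hθ' => ?_) hb (Eventually.of_forall fun x θ' _ => ?_)
  · have hder : ∫ x, (Real.exp (θ ⬝ᵥ φ x) * h x) • dotCLM (φ x) ∂ν =
        dotCLM fun k => ∫ x, Real.exp (θ ⬝ᵥ φ x) * (h x * φ x k) ∂ν := by
      rw [integral_congr_ae (Eventually.of_forall (heq θ)), integral_finsetSum _ hF'int, dotCLM]
      exact Finset.sum_congr rfl fun k _ => integral_smul_const _ _
    rwa [hder] at hkey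
  · exact (hmeasF θ).aestronglyMeasurable.smul
      (continuous_dotCLM.comp_aestronglyMeasurable hφ.aestronglyMeasurable)
  · have h1 : ‖(Real.exp (θ' ⬝ᵥ φ x) * h x) • dotCLM (φ x)‖ =
        ‖Real.exp (θ' ⬝ᵥ φ x) * h x‖ * ‖dotCLM (φ x)‖ := norm_smul _ _
    exact h1.le.trans
      ((mul_le_mul_of_nonneg_left (norm_dotCLM_le _) (norm_nonneg _)).trans (hle x θ' hθ'))
  · have h1 : HasFDerivAt (fun θ : n → ℝ => θ ⬝ᵥ φ x) (dotCLM (φ x)) θ' := by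
      have := (dotCLM (φ x)).hasFDerivAt (x := θ')
      exact this.congr_of_eventuallyEq
        (Eventually.of_forall fun v => by rw [dotCLM_apply, dotProduct_comm])
    have h2 := (h1.exp).mul_const (h x)
    convert! h2 using 1
    rw [smul_smul, mul_comm]

end ExpFamily

/-! ### Covariance matrices -/

section CovMatrix

theorem isHermitian_covMatrix {Ω m : Type*} [MeasurableSpace Ω] {P : Measure Ω} {f : Ω → m → ℝ} :
    (covMatrix P f f).IsHermitian := by
  ext i j
  simp only [covMatrix, Matrix.conjTranspose_apply, Matrix.of_apply, star_trivial]
  exact covariance_comm _ _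

variable {Ω m n : Type*} [MeasurableSpace Ω] [Fintype m] [Fintype n] {P : Measure Ω}
  {f : Ω → m → ℝ} {g : Ω → n → ℝ}

theorem dotProduct_covMatrix_mulVec [IsFiniteMeasure P] (hf : ∀ k, MemLp (fun x => f x k) 2 P)
    (hg : ∀ k, MemLp (fun x => g x k) 2 P) (u : m → ℝ) (v : n → ℝ) :
    u ⬝ᵥ covMatrix P f g *ᵥ v = covariance (fun x => u ⬝ᵥ f x) (fun x => v ⬝ᵥ g x) P := by
  simp only [dotProduct]
  rw [covariance_fun_sum_fun_sum (fun k => (hf k).const_mul (u k))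
    (fun k => (hg k).const_mul (v k))]
  simp only [covariance_const_mul_left, covariance_const_mul_right, Matrix.mulVec, dotProduct,
    covMatrix, Matrix.of_apply, Finset.mul_sum]
  exact Finset.sum_congr rfl fun _ _ => Finset.sum_congr rfl fun _ _ => by ring

theorem memLp_dotProduct (hf : ∀ k, MemLp (fun x => f x k) 2 P) (u : m → ℝ) :
    MemLp (fun x => u ⬝ᵥ f x) 2 P := by
  simp only [dotProduct]
  exact memLp_finsetSum _ fun k _ => (hf k).const_mul (u k)

theorem dotProduct_covMatrix_self [IsFiniteMeasure P] (hf : ∀ k, MemLp (fun x => f x k) 2 P)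
    (u : m → ℝ) : u ⬝ᵥ covMatrix P f f *ᵥ u = variance (fun x => u ⬝ᵥ f x) P := by
  rw [dotProduct_covMatrix_mulVec hf hf,
    covariance_self (memLp_dotProduct hf u).aestronglyMeasurable.aemeasurable]

theorem posSemidef_covMatrix [IsFiniteMeasure P] (hf : ∀ k, MemLp (fun x => f x k) 2 P) :
    (covMatrix P f f).PosSemidef := by
  refine Matrix.PosSemidef.of_dotProduct_mulVec_nonneg isHermitian_covMatrix fun u => ?_
  rw [star_trivial, dotProduct_covMatrix_self hf]
  exact variance_nonneg _ _

theorem eq_zero_of_ae_eq_const [IsProbabilityMeasure P] (hf : ∀ k, MemLp (fun x => f x k) 2 P)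
    (hpos : (covMatrix P f f).PosDef) (u : m → ℝ) (c : ℝ) (hu : ∀ᵐ x ∂P, u ⬝ᵥ f x = c) :
    u = 0 := by
  by_contra hne
  have h := hpos.dotProduct_mulVec_pos hne
  rw [star_trivial, dotProduct_covMatrix_self hf, variance_congr hu] at h
  simp [variance_eq_integral aemeasurable_const] at h

end CovMatrix

/-! ### Moments and derivatives of regular minimal exponential families -/

namespace ExpFamily

open Filter Topology

variable {Ω n : Type*} [MeasurableSpace Ω] [Fintype n] {ν : Measure Ω} {φ : Ω → n → ℝ}

/-- Regular exponential families with positive definite covariance matrices. -/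
structure IsRegularMinimal (ν : Measure Ω) (φ : Ω → n → ℝ) : Prop where
  measurable_stat : Measurable φ
  base_ne_zero : ν ≠ 0
  isOpen_fullDomain : IsOpen (fullDomain ν φ)
  posDef_cov : ∀ θ ∈ fullDomain ν φ, (covMatrix (law ν φ θ) φ φ).PosDef

theorem integral_exp_pos (hν : ν ≠ 0) {θ : n → ℝ} (hθ : θ ∈ fullDomain ν φ) :
    0 < ∫ x, Real.exp (θ ⬝ᵥ φ x) ∂ν :=
  integral_pos_of_pos hν (fun _ => Real.exp_pos _) hθ

theorem isProbabilityMeasure_law (hν : ν ≠ 0) {θ : n → ℝ} (hθ : θ ∈ fullDomain ν φ) :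
    IsProbabilityMeasure (law ν φ θ) :=
  isProbabilityMeasure_normalizedLaw (fun _ => (Real.exp_pos _).le) hθ (integral_exp_pos hν hθ)

theorem integral_law (hφ : Measurable φ) (θ : n → ℝ) (f : Ω → ℝ) :
    ∫ x, f x ∂(law ν φ θ) =
      (∫ x, Real.exp (θ ⬝ᵥ φ x) * f x ∂ν) / ∫ x, Real.exp (θ ⬝ᵥ φ x) ∂ν :=
  integral_normalizedLaw (measurable_exp hφ θ) (fun _ => (Real.exp_pos _).le) f

theorem integrable_law_iff (hφ : Measurable φ) (hν : ν ≠ 0) {θ : n → ℝ}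
    (hθ : θ ∈ fullDomain ν φ) (f : Ω → ℝ) :
    Integrable f (law ν φ θ) ↔ Integrable (fun x => Real.exp (θ ⬝ᵥ φ x) * f x) ν :=
  integrable_normalizedLaw_iff (measurable_exp hφ θ) (fun _ => (Real.exp_pos _).le)
    (integral_exp_pos hν hθ) f

theorem integrable_exp_stat (hφ : Measurable φ) (hopen : IsOpen (fullDomain ν φ)) {θ : n → ℝ}
    (hθ : θ ∈ fullDomain ν φ) (k : n) :
    Integrable (fun x => Real.exp (θ ⬝ᵥ φ x) * φ x k) ν := by
  simpa using integrable_exp_mul_stat hφ (h := fun _ => 1) measurable_const hopen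
    (fun θ hθ => by simpa using! hθ) hθ k

theorem integrable_exp_stat_mul (hφ : Measurable φ) (hopen : IsOpen (fullDomain ν φ)) {θ : n → ℝ}
    (hθ : θ ∈ fullDomain ν φ) (k l : n) :
    Integrable (fun x => Real.exp (θ ⬝ᵥ φ x) * (φ x k * φ x l)) ν :=
  integrable_exp_mul_stat hφ ((measurable_pi_apply k).comp hφ) hopen
    (fun _ hθ => integrable_exp_stat hφ hopen hθ k) hθ l

theorem memLp_stat (hφ : Measurable φ) (hν : ν ≠ 0) (hopen : IsOpen (fullDomain ν φ)) {θ : n → ℝ}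
    (hθ : θ ∈ fullDomain ν φ) (k : n) : MemLp (fun x => φ x k) 2 (law ν φ θ) := by
  have hm : Measurable fun x => φ x k := (measurable_pi_apply k).comp hφ
  rw [memLp_two_iff_integrable_sq hm.aestronglyMeasurable,
    integrable_law_iff hφ hν hθ]
  simpa only [sq] using integrable_exp_stat_mul hφ hopen hθ k k

theorem hasFDerivAt_partition (hφ : Measurable φ) (hopen : IsOpen (fullDomain ν φ)) {θ : n → ℝ}
    (hθ : θ ∈ fullDomain ν φ) :
    HasFDerivAt (fun θ => ∫ x, Real.exp (θ ⬝ᵥ φ x) ∂ν)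
      (dotCLM fun k => ∫ x, Real.exp (θ ⬝ᵥ φ x) * φ x k ∂ν) θ := by
  simpa using hasFDerivAt_integral_exp_mul hφ (h := fun _ => 1) measurable_const hopen
    (fun θ hθ => by simpa using! hθ) hθ

theorem hasFDerivAt_moment (hφ : Measurable φ) (hopen : IsOpen (fullDomain ν φ)) {θ : n → ℝ}
    (hθ : θ ∈ fullDomain ν φ) (k : n) :
    HasFDerivAt (fun θ => ∫ x, Real.exp (θ ⬝ᵥ φ x) * φ x k ∂ν)
      (dotCLM fun l => ∫ x, Real.exp (θ ⬝ᵥ φ x) * (φ x k * φ x l) ∂ν) θ :=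
  hasFDerivAt_integral_exp_mul hφ ((measurable_pi_apply k).comp hφ) hopen
    (fun _ hθ => integrable_exp_stat hφ hopen hθ k) hθ

theorem continuousAt_second_moment (hφ : Measurable φ) (hopen : IsOpen (fullDomain ν φ))
    {θ : n → ℝ} (hθ : θ ∈ fullDomain ν φ) (k l : n) :
    ContinuousAt (fun θ => ∫ x, Real.exp (θ ⬝ᵥ φ x) * (φ x k * φ x l) ∂ν) θ :=
  (hasFDerivAt_integral_exp_mul hφ (((measurable_pi_apply k).comp hφ).mul
    ((measurable_pi_apply l).comp hφ)) hopen
    (fun _ hθ => integrable_exp_stat_mul hφ hopen hθ k l) hθ).continuousAt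

theorem meanMap_apply (hφ : Measurable φ) (θ : n → ℝ) (k : n) :
    meanMap ν φ θ k =
      (∫ x, Real.exp (θ ⬝ᵥ φ x) * φ x k ∂ν) / ∫ x, Real.exp (θ ⬝ᵥ φ x) ∂ν :=
  integral_law hφ θ _

theorem covMatrix_law_apply (hφ : Measurable φ) (hν : ν ≠ 0) (hopen : IsOpen (fullDomain ν φ))
    {θ : n → ℝ} (hθ : θ ∈ fullDomain ν φ) (k l : n) :
    covMatrix (law ν φ θ) φ φ k l =
      (∫ x, Real.exp (θ ⬝ᵥ φ x) * (φ x k * φ x l) ∂ν) / (∫ x, Real.exp (θ ⬝ᵥ φ x) ∂ν) -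
        meanMap ν φ θ k * meanMap ν φ θ l := by
  have := isProbabilityMeasure_law hν hθ
  rw [covMatrix, Matrix.of_apply,
    covariance_eq_sub (memLp_stat hφ hν hopen hθ k) (memLp_stat hφ hν hopen hθ l)]
  simp only [Pi.mul_apply]
  rw [integral_law hφ]
  rfl

/-- Multiplication by a real matrix as a continuous linear map. -/
noncomputable def mulVecCLM {m : Type*} [Fintype m] (A : Matrix m n ℝ) : (n → ℝ) →L[ℝ] (m → ℝ) :=
  LinearMap.toContinuousLinearMap (Matrix.mulVecLin A)

theorem mulVecCLM_apply {m : Type*} [Fintype m] (A : Matrix m n ℝ) (v : n → ℝ) :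
    mulVecCLM A v = A *ᵥ v := rfl

theorem mulVecCLM_eq_pi {m : Type*} [Fintype m] (A : Matrix m n ℝ) :
    mulVecCLM A = ContinuousLinearMap.pi fun k => dotCLM (A k) := by
  ext1 v
  funext k
  simp [mulVecCLM_apply, dotCLM_apply, Matrix.mulVec]

theorem hasFDerivAt_logPartition (hE : IsRegularMinimal ν φ) {θ : n → ℝ}
    (hθ : θ ∈ fullDomain ν φ) :
    HasFDerivAt (logPartition ν φ) (dotCLM (meanMap ν φ θ)) θ := by
  have hZ := integral_exp_pos hE.base_ne_zero hθ
  have h := (hasFDerivAt_partition hE.measurable_stat hE.isOpen_fullDomain hθ).log hZ.ne'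
  convert! h using 1
  ext v
  simp only [dotCLM_apply, smul_apply, smul_eq_mul, dotProduct, Finset.mul_sum,
    meanMap_apply hE.measurable_stat]
  exact Finset.sum_congr rfl fun _ _ => by ring

theorem hasFDerivAt_meanMap (hE : IsRegularMinimal ν φ) {θ : n → ℝ} (hθ : θ ∈ fullDomain ν φ) :
    HasFDerivAt (meanMap ν φ) (mulVecCLM (covMatrix (law ν φ θ) φ φ)) θ := by
  have hZ := integral_exp_pos hE.base_ne_zero hθ
  rw [mulVecCLM_eq_pi, show meanMap ν φ = fun θ k => meanMap ν φ θ k from rfl, hasFDerivAt_pi]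
  intro k
  have h1 := hasFDerivAt_partition hE.measurable_stat hE.isOpen_fullDomain hθ
  have h2 := hasFDerivAt_moment hE.measurable_stat hE.isOpen_fullDomain hθ k
  have h3 := (hasDerivAt_inv hZ.ne').comp_hasFDerivAt θ h1
  have h4 := h2.mul h3
  refine (h4.congr_fderiv ?_).congr_of_eventuallyEq (Eventually.of_forall fun θ => ?_)
  · ext v
    have hrow : covMatrix (law ν φ θ) φ φ k =
        (∫ x, Real.exp (θ ⬝ᵥ φ x) ∂ν)⁻¹ • (fun l => ∫ x, Real.exp (θ ⬝ᵥ φ x) * (φ x k * φ x l) ∂ν) +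
        (-(∫ x, Real.exp (θ ⬝ᵥ φ x) * φ x k ∂ν) * ((∫ x, Real.exp (θ ⬝ᵥ φ x) ∂ν) ^ 2)⁻¹) •
          fun l => ∫ x, Real.exp (θ ⬝ᵥ φ x) * φ x l ∂ν := by
      funext l
      rw [covMatrix_law_apply hE.measurable_stat hE.base_ne_zero hE.isOpen_fullDomain hθ,
        meanMap_apply hE.measurable_stat, meanMap_apply hE.measurable_stat]
      simp only [Pi.add_apply, Pi.smul_apply, smul_eq_mul]
      field_simp
      ring
    simp only [dotCLM_apply, smul_apply, add_apply, smul_eq_mul, Function.comp_apply, hrow,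
      add_dotProduct, smul_dotProduct]
    ring
  · simp only [meanMap_apply hE.measurable_stat, Pi.mul_apply, Function.comp_apply, div_eq_mul_inv]

theorem continuousAt_meanMap (hE : IsRegularMinimal ν φ) {θ : n → ℝ} (hθ : θ ∈ fullDomain ν φ) :
    ContinuousAt (meanMap ν φ) θ :=
  (hasFDerivAt_meanMap hE hθ).continuousAt

theorem continuousAt_covMatrix_law (hE : IsRegularMinimal ν φ) {θ : n → ℝ}
    (hθ : θ ∈ fullDomain ν φ) (k l : n) :
    ContinuousAt (fun θ => covMatrix (law ν φ θ) φ φ k l) θ := by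
  have hZ := integral_exp_pos hE.base_ne_zero hθ
  have h : ContinuousAt (fun θ => (∫ x, Real.exp (θ ⬝ᵥ φ x) * (φ x k * φ x l) ∂ν) /
      (∫ x, Real.exp (θ ⬝ᵥ φ x) ∂ν) - meanMap ν φ θ k * meanMap ν φ θ l) θ := by
    have hc : ∀ k, ContinuousAt (fun θ => meanMap ν φ θ k) θ := fun k =>
      (continuous_apply k).continuousAt.comp (continuousAt_meanMap hE hθ)
    exact ((continuousAt_second_moment hE.measurable_stat hE.isOpen_fullDomain hθ k l).div
      (hasFDerivAt_partition hE.measurable_stat hE.isOpen_fullDomain hθ).continuousAt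
      hZ.ne').sub ((hc k).mul (hc l))
  refine h.congr ?_
  filter_upwards [hE.isOpen_fullDomain.mem_nhds hθ] with θ' hθ'
  exact (covMatrix_law_apply hE.measurable_stat hE.base_ne_zero hE.isOpen_fullDomain hθ' k l).symm

/-- Strictness comes from the continuity of the covariance in θ; the inverse mapping arguments below
rely on it. -/
theorem hasStrictFDerivAt_meanMap (hE : IsRegularMinimal ν φ) {θ : n → ℝ}
    (hθ : θ ∈ fullDomain ν φ) :
    HasStrictFDerivAt (meanMap ν φ) (mulVecCLM (covMatrix (law ν φ θ) φ φ)) θ := by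
  refine hasStrictFDerivAt_of_hasFDerivAt_of_continuousAt
    (f' := fun θ => mulVecCLM (covMatrix (law ν φ θ) φ φ)) ?_ ?_
  · filter_upwards [hE.isOpen_fullDomain.mem_nhds hθ] with θ' hθ' using hasFDerivAt_meanMap hE hθ'
  · have h1 : Continuous fun A : Matrix n n ℝ => mulVecCLM A := by
      simp only [mulVecCLM_eq_pi]
      refine (ContinuousLinearMap.piEquivL ℝ (n → ℝ) (fun _ : n => ℝ)).continuous.comp
        (continuous_pi fun k => continuous_dotCLM.comp ?_)
      exact continuous_pi fun l => continuous_id.matrix_elem k l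
    refine h1.continuousAt.comp ?_
    exact continuousAt_pi.2 fun k => continuousAt_pi.2 fun l =>
      continuousAt_covMatrix_law hE hθ k l

end ExpFamily

/-! ### Inversion of the mean map and the Legendre transform -/

namespace ExpFamily

open Filter Topology

variable {Ω n : Type*} [MeasurableSpace Ω] [Fintype n] {ν : Measure Ω} {φ : Ω → n → ℝ}

theorem IsRegularMinimal.natParams_eq (hE : IsRegularMinimal ν φ) :
    natParams ν φ = fullDomain ν φ :=
  hE.isOpen_fullDomain.interior_eq

theorem measurableSet_dotProduct_pos (hφ : Measurable φ) (u : n → ℝ) (c : ℝ) :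
    MeasurableSet {x | c < u ⬝ᵥ φ x} :=
  measurableSet_lt measurable_const (measurable_dotProduct hφ u)

theorem integrable_stat_law (hE : IsRegularMinimal ν φ) {θ : n → ℝ} (hθ : θ ∈ fullDomain ν φ)
    (k : n) : Integrable (fun x => φ x k) (law ν φ θ) :=
  (integrable_law_iff hE.measurable_stat hE.base_ne_zero hθ _).2
    (integrable_exp_stat hE.measurable_stat hE.isOpen_fullDomain hθ k)

theorem integral_dotProduct_law (hE : IsRegularMinimal ν φ) {θ : n → ℝ}
    (hθ : θ ∈ fullDomain ν φ) (u : n → ℝ) :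
    ∫ x, u ⬝ᵥ φ x ∂(law ν φ θ) = u ⬝ᵥ meanMap ν φ θ := by
  simp only [dotProduct]
  rw [integral_finsetSum _ fun k _ => (integrable_stat_law hE hθ k).const_mul _]
  simp only [integral_const_mul]
  rfl

theorem integrable_dotProduct_law (hE : IsRegularMinimal ν φ) {θ : n → ℝ}
    (hθ : θ ∈ fullDomain ν φ) (u : n → ℝ) : Integrable (fun x => u ⬝ᵥ φ x) (law ν φ θ) := by
  simp only [dotProduct]
  exact integrable_finsetSum _ fun k _ => (integrable_stat_law hE hθ k).const_mul _

/-- Strict convexity as a tangent inequality, without passing along a segment. With y = ⟨θ' - θ, φ -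
E_θ φ⟩ the integrand exp y - 1 - y is nonnegative and vanishes only at y = 0, and y = 0 almost
everywhere is excluded by the positive definite covariance. Hence E_θ[exp y] > 1, and this
expectation is exp (-c) Z' / Z. -/
theorem logPartition_gt (hE : IsRegularMinimal ν φ) {θ θ' : n → ℝ} (hθ : θ ∈ fullDomain ν φ)
    (hθ' : θ' ∈ fullDomain ν φ) (hne : θ' ≠ θ) :
    logPartition ν φ θ + (θ' - θ) ⬝ᵥ meanMap ν φ θ < logPartition ν φ θ' := by
  have := isProbabilityMeasure_law hE.base_ne_zero hθ
  set c := (θ' - θ) ⬝ᵥ meanMap ν φ θ with hc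
  set Z := ∫ x, Real.exp (θ ⬝ᵥ φ x) ∂ν with hZ
  set Z' := ∫ x, Real.exp (θ' ⬝ᵥ φ x) ∂ν with hZ'
  have hZpos : 0 < Z := integral_exp_pos hE.base_ne_zero hθ
  have hZpos' : 0 < Z' := integral_exp_pos hE.base_ne_zero hθ'
  set y : Ω → ℝ := fun x => (θ' - θ) ⬝ᵥ φ x - c with hy
  have hexp : ∀ x, Real.exp (θ ⬝ᵥ φ x) * Real.exp (y x) = Real.exp (-c) * Real.exp (θ' ⬝ᵥ φ x) := by
    intro x
    rw [← Real.exp_add, ← Real.exp_add]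
    congr 1
    simp only [hy, sub_dotProduct]
    ring
  have hint1 : Integrable (fun x => Real.exp (y x)) (law ν φ θ) := by
    rw [integrable_law_iff hE.measurable_stat hE.base_ne_zero hθ]
    simp only [hexp]
    exact Integrable.const_mul hθ' _
  have hint2 : Integrable y (law ν φ θ) :=
    (integrable_dotProduct_law hE hθ _).sub (integrable_const _)
  have hI1 : ∫ x, Real.exp (y x) ∂(law ν φ θ) = Real.exp (-c) * Z' / Z := by
    rw [integral_law hE.measurable_stat]
    simp only [hexp, integral_const_mul]
    rfl
  have hI2 : ∫ x, y x ∂(law ν φ θ) = 0 := by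
    simp only [hy]
    rw [integral_sub (integrable_dotProduct_law hE hθ _) (integrable_const _),
      integral_dotProduct_law hE hθ]
    simp [hc]
  have hI3 : ∫ x, (Real.exp (y x) - 1 - y x) ∂(law ν φ θ) = Real.exp (-c) * Z' / Z - 1 := by
    have hint3 : Integrable (fun x => Real.exp (y x) - 1) (law ν φ θ) :=
      hint1.sub (integrable_const _)
    rw [integral_sub hint3 hint2, integral_sub hint1 (integrable_const _), hI1, hI2]
    simp
  have hnn : ∀ x, 0 ≤ Real.exp (y x) - 1 - y x := fun x => by
    linarith [Real.add_one_le_exp (y x)]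
  have hpos : 0 < ∫ x, (Real.exp (y x) - 1 - y x) ∂(law ν φ θ) := by
    refine (integral_nonneg hnn).lt_of_ne fun h0 => ?_
    have h1 := (integral_eq_zero_iff_of_nonneg hnn
      ((hint1.sub (integrable_const _)).sub hint2)).1 h0.symm
    have h2 : ∀ᵐ x ∂(law ν φ θ), (θ' - θ) ⬝ᵥ φ x = c := by
      filter_upwards [h1] with x hx
      by_contra hxc
      have hx0 : y x ≠ 0 := sub_ne_zero.2 hxc
      have := Real.add_one_lt_exp hx0
      simp only [Pi.zero_apply] at hx
      linarith
    exact hne (sub_eq_zero.1 (eq_zero_of_ae_eq_const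
      (memLp_stat hE.measurable_stat hE.base_ne_zero hE.isOpen_fullDomain hθ)
      (hE.posDef_cov θ hθ) _ c h2))
  rw [hI3] at hpos
  have h3 : Real.exp c * Z < Z' := by
    have h4 : 1 < Real.exp (-c) * Z' / Z := by linarith
    rw [lt_div_iff₀ hZpos, one_mul] at h4
    calc Real.exp c * Z < Real.exp c * (Real.exp (-c) * Z') := by gcongr
      _ = Z' := by rw [← mul_assoc, ← Real.exp_add]; simp
  have h4 := Real.log_lt_log (by positivity) h3
  rw [Real.log_mul (Real.exp_pos _).ne' hZpos.ne', Real.log_exp] at h4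
  simp only [logPartition]
  linarith

/-- With equal means, the tangent inequalities at θ and at θ' add up to a contradiction. -/
theorem injOn_meanMap (hE : IsRegularMinimal ν φ) : Set.InjOn (meanMap ν φ) (fullDomain ν φ) := by
  intro θ hθ θ' hθ' h
  by_contra hne
  have h1 := logPartition_gt hE hθ hθ' (Ne.symm hne)
  have h2 := logPartition_gt hE hθ' hθ hne
  rw [← h] at h2
  simp only [sub_dotProduct] at h1 h2
  linarith

/-- The natural parameter with given expectation parameter. -/
noncomputable def natParam (ν : Measure Ω) (φ : Ω → n → ℝ) : (n → ℝ) → n → ℝ :=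
  Function.invFunOn (meanMap ν φ) (natParams ν φ)

theorem natParam_mem (hE : IsRegularMinimal ν φ) {η : n → ℝ} (hη : η ∈ meanParams ν φ) :
    natParam ν φ η ∈ fullDomain ν φ := by
  rw [← hE.natParams_eq]
  exact Function.invFunOn_mem hη

theorem meanMap_natParam {η : n → ℝ} (hη : η ∈ meanParams ν φ) :
    meanMap ν φ (natParam ν φ η) = η :=
  Function.invFunOn_eq hη

theorem meanMap_mem (hE : IsRegularMinimal ν φ) {θ : n → ℝ} (hθ : θ ∈ fullDomain ν φ) :
    meanMap ν φ θ ∈ meanParams ν φ :=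
  ⟨θ, hE.natParams_eq.symm ▸ hθ, rfl⟩

theorem natParam_meanMap (hE : IsRegularMinimal ν φ) {θ : n → ℝ} (hθ : θ ∈ fullDomain ν φ) :
    natParam ν φ (meanMap ν φ θ) = θ :=
  injOn_meanMap hE (natParam_mem hE (meanMap_mem hE hθ)) hθ (meanMap_natParam (meanMap_mem hE hθ))

/-- The tangent inequality at θ says that θ attains the supremum. -/
theorem legendre_meanMap (hE : IsRegularMinimal ν φ) {θ : n → ℝ} (hθ : θ ∈ fullDomain ν φ) :
    legendre ν φ (meanMap ν φ θ) = θ ⬝ᵥ meanMap ν φ θ - logPartition ν φ θ := by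
  have hgreat : IsGreatest ((fun θ' => θ' ⬝ᵥ meanMap ν φ θ - logPartition ν φ θ') ''
      natParams ν φ) (θ ⬝ᵥ meanMap ν φ θ - logPartition ν φ θ) := by
    refine ⟨⟨θ, hE.natParams_eq.symm ▸ hθ, rfl⟩, ?_⟩
    rintro _ ⟨θ', hθ', rfl⟩
    rw [hE.natParams_eq] at hθ'
    by_cases h : θ' = θ
    · rw [h]
    · have := logPartition_gt hE hθ hθ' h
      rw [sub_dotProduct] at this
      simp only
      linarith
  exact hgreat.csSup_eq

section Inverse

variable [DecidableEq n]

/-- Multiplication by an invertible real matrix as a continuous linear equivalence. -/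
noncomputable def mulVecEquiv (A : Matrix n n ℝ) (hA : IsUnit A.det) : (n → ℝ) ≃L[ℝ] (n → ℝ) :=
  ContinuousLinearEquiv.equivOfInverse (mulVecCLM A) (mulVecCLM A⁻¹)
    (fun v => by simp [mulVecCLM_apply, Matrix.mulVec_mulVec, Matrix.nonsing_inv_mul _ hA])
    (fun v => by simp [mulVecCLM_apply, Matrix.mulVec_mulVec, Matrix.mul_nonsing_inv _ hA])

theorem hasStrictFDerivAt_natParam (hE : IsRegularMinimal ν φ) {η : n → ℝ}
    (hη : η ∈ meanParams ν φ) :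
    HasStrictFDerivAt (natParam ν φ)
      (mulVecCLM (covMatrix (law ν φ (natParam ν φ η)) φ φ)⁻¹) η := by
  have hθ := natParam_mem hE hη
  have hdet := (Matrix.isUnit_iff_isUnit_det _).1 (hE.posDef_cov _ hθ).isUnit
  have h1 : HasStrictFDerivAt (meanMap ν φ) (mulVecEquiv _ hdet : (n → ℝ) →L[ℝ] (n → ℝ))
      (natParam ν φ η) := hasStrictFDerivAt_meanMap hE hθ
  -- Although `natParam` is defined by choice, injectivity of the mean map makes it a left inverse
  -- on the whole open parameter domain.
  have h2 := h1.to_local_left_inverse (g := natParam ν φ) (by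
    filter_upwards [hE.isOpen_fullDomain.mem_nhds hθ] with θ' hθ' using natParam_meanMap hE hθ')
  rw [meanMap_natParam hη] at h2
  exact h2

end Inverse

theorem isOpen_meanParams (hE : IsRegularMinimal ν φ) : IsOpen (meanParams ν φ) := by
  classical
  rw [isOpen_iff_mem_nhds]
  rintro _ ⟨θ, hθ, rfl⟩
  have hθ' : θ ∈ fullDomain ν φ := hE.natParams_eq ▸ hθ
  have hdet := (Matrix.isUnit_iff_isUnit_det _).1 (hE.posDef_cov _ hθ').isUnit
  have h1 : HasStrictFDerivAt (meanMap ν φ) (mulVecEquiv _ hdet : (n → ℝ) →L[ℝ] (n → ℝ)) θ :=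
    hasStrictFDerivAt_meanMap hE hθ'
  rw [← h1.map_nhds_eq_of_equiv]
  exact image_mem_map (isOpen_interior.mem_nhds hθ)

/-- Differentiating ⟨θ(η), η⟩ - ψ(θ(η)), the two terms containing the derivative of θ(η) cancel,
because the gradient of ψ at θ(η) is η. -/
theorem hasFDerivAt_legendre (hE : IsRegularMinimal ν φ) {η : n → ℝ} (hη : η ∈ meanParams ν φ) :
    HasFDerivAt (legendre ν φ) (dotCLM (natParam ν φ η)) η := by
  classical
  have hθ := natParam_mem hE hη
  have hT := (hasStrictFDerivAt_natParam hE hη).hasFDerivAt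
  have hψ := (hasFDerivAt_logPartition hE hθ).comp η hT
  have hTk : ∀ k, HasFDerivAt (fun η => natParam ν φ η k)
      (dotCLM ((covMatrix (law ν φ (natParam ν φ η)) φ φ)⁻¹ k)) η := by
    rw [mulVecCLM_eq_pi] at hT
    exact hasFDerivAt_pi.1 hT
  have hdot : HasFDerivAt (fun η => natParam ν φ η ⬝ᵥ η) _ η :=
    HasFDerivAt.fun_sum fun k (_ : k ∈ Finset.univ) => (hTk k).mul
      (hasFDerivAt_apply (𝕜 := ℝ) (F' := fun _ : n => ℝ) k η)
  refine ((hdot.sub hψ).congr_fderiv ?_).congr_of_eventuallyEq ?_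
  · ext v
    rw [meanMap_natParam hη]
    simp only [sub_apply, sum_apply, add_apply, smul_apply, dotCLM_apply, smul_eq_mul,
      ContinuousLinearMap.comp_apply, mulVecCLM_apply, ContinuousLinearMap.proj_apply,
      Finset.sum_add_distrib]
    simp only [dotProduct, Matrix.mulVec]
    ring
  · filter_upwards [(isOpen_meanParams hE).mem_nhds hη] with η' hη'
    have := legendre_meanMap hE (natParam_mem hE hη')
    rw [meanMap_natParam hη'] at this
    exact this

end ExpFamily

/-! ### The range of the mean map -/

namespace ExpFamily

open Filter Topology

variable {Ω n : Type*} [MeasurableSpace Ω] [Fintype n] {ν : Measure Ω} {φ : Ω → n → ℝ}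

/-- The interior of the convex support of the statistic: no closed half space with `η` on its
boundary contains almost all values of the statistic. -/
def supportInterior (ν : Measure Ω) (φ : Ω → n → ℝ) : Set (n → ℝ) :=
  {η | ∀ u, u ≠ 0 → ν {x | u ⬝ᵥ η < u ⬝ᵥ φ x} ≠ 0}

/-- At a convex combination ⟨u, ·⟩ is at most its larger end value, so the open half space there
contains the one belonging to that endpoint. -/
theorem convex_supportInterior : Convex ℝ (supportInterior ν φ) := by
  intro η₀ h₀ η₁ h₁ a b ha hb hab u hu h
  have hle : u ⬝ᵥ (a • η₀ + b • η₁) ≤ max (u ⬝ᵥ η₀) (u ⬝ᵥ η₁) := by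
    rw [dotProduct_add, dotProduct_smul, dotProduct_smul, smul_eq_mul, smul_eq_mul]
    calc a * (u ⬝ᵥ η₀) + b * (u ⬝ᵥ η₁)
        ≤ a * max (u ⬝ᵥ η₀) (u ⬝ᵥ η₁) + b * max (u ⬝ᵥ η₀) (u ⬝ᵥ η₁) := by
          gcongr
          · exact le_max_left _ _
          · exact le_max_right _ _
      _ = _ := by rw [← add_mul, hab, one_mul]
  rcases le_max_iff.1 hle with h2 | h2
  · exact h₀ u hu (measure_mono_null (fun x hx => lt_of_le_of_lt h2 hx) h)
  · exact h₁ u hu (measure_mono_null (fun x hx => lt_of_le_of_lt h2 hx) h)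

/-- If the half space were null, ⟨u, φ⟩ would be almost everywhere at most its own mean, hence equal
to it, which the positive definite covariance forbids. -/
theorem meanParams_subset_supportInterior (hE : IsRegularMinimal ν φ) :
    meanParams ν φ ⊆ supportInterior ν φ := by
  rintro _ ⟨θ, hθ, rfl⟩ u hu h0
  rw [hE.natParams_eq] at hθ
  have := isProbabilityMeasure_law hE.base_ne_zero hθ
  have hle : ∀ᵐ x ∂ν, u ⬝ᵥ φ x ≤ u ⬝ᵥ meanMap ν φ θ := by
    rw [ae_iff]
    simpa only [not_le] using h0
  have hle' : ∀ᵐ x ∂(law ν φ θ), u ⬝ᵥ φ x ≤ u ⬝ᵥ meanMap ν φ θ :=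
    (ae_normalizedLaw_iff (measurable_exp hE.measurable_stat θ) (fun _ => Real.exp_pos _)
      (integral_exp_pos hE.base_ne_zero hθ)).2 hle
  have hi := integrable_dotProduct_law hE hθ u
  have h1 : ∫ x, (u ⬝ᵥ meanMap ν φ θ - u ⬝ᵥ φ x) ∂(law ν φ θ) = 0 := by
    rw [integral_sub (integrable_const _) hi, integral_dotProduct_law hE hθ]
    simp
  have h2 := (integral_eq_zero_iff_of_nonneg_ae (hle'.mono fun x hx => sub_nonneg.2 hx)
    ((integrable_const _).sub hi)).1 h1
  exact hu (eq_zero_of_ae_eq_const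
    (memLp_stat hE.measurable_stat hE.base_ne_zero hE.isOpen_fullDomain hθ)
    (hE.posDef_cov θ hθ) u (u ⬝ᵥ meanMap ν φ θ) (h2.mono fun x hx => (sub_eq_zero.1 hx).symm))

/-- The Laplace transform of the statistic recentred at `η`, with values in `[0, ∞]`. -/
noncomputable def centredLaplace (ν : Measure Ω) (φ : Ω → n → ℝ) (η θ : n → ℝ) : ENNReal :=
  ∫⁻ x, ENNReal.ofReal (Real.exp (θ ⬝ᵥ φ x - θ ⬝ᵥ η)) ∂ν

theorem measurable_centred (hφ : Measurable φ) (η θ : n → ℝ) :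
    Measurable fun x => ENNReal.ofReal (Real.exp (θ ⬝ᵥ φ x - θ ⬝ᵥ η)) :=
  (Real.measurable_exp.comp ((measurable_dotProduct hφ θ).sub_const _)).ennreal_ofReal

theorem centredLaplace_eq (hφ : Measurable φ) (η θ : n → ℝ) :
    centredLaplace ν φ η θ = ENNReal.ofReal (Real.exp (-(θ ⬝ᵥ η))) *
      ∫⁻ x, ENNReal.ofReal (Real.exp (θ ⬝ᵥ φ x)) ∂ν := by
  rw [centredLaplace, ← lintegral_const_mul _ (measurable_exp hφ θ).ennreal_ofReal]
  refine lintegral_congr fun x => ?_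
  rw [← ENNReal.ofReal_mul (Real.exp_pos _).le, ← Real.exp_add]
  congr 2
  ring

theorem mem_fullDomain_iff_lintegral (hφ : Measurable φ) (θ : n → ℝ) :
    θ ∈ fullDomain ν φ ↔ ∫⁻ x, ENNReal.ofReal (Real.exp (θ ⬝ᵥ φ x)) ∂ν < ⊤ := by
  rw [fullDomain, Set.mem_ofPred_eq, Integrable, hasFiniteIntegral_iff_ofReal
    (Eventually.of_forall fun _ => (Real.exp_pos _).le)]
  exact and_iff_right (measurable_exp hφ θ).aestronglyMeasurable

theorem centredLaplace_lt_top_iff (hφ : Measurable φ) (η θ : n → ℝ) :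
    centredLaplace ν φ η θ < ⊤ ↔ θ ∈ fullDomain ν φ := by
  rw [mem_fullDomain_iff_lintegral hφ, centredLaplace_eq hφ]
  constructor
  · intro h
    exact ENNReal.lt_top_of_mul_ne_top_right h.ne
      (by simpa using Real.exp_pos _)
  · intro h
    exact ENNReal.mul_lt_top ENNReal.ofReal_lt_top h

theorem centredLaplace_of_mem (hν : ν ≠ 0) (hφ : Measurable φ) (η : n → ℝ) {θ : n → ℝ}
    (hθ : θ ∈ fullDomain ν φ) :
    centredLaplace ν φ η θ = ENNReal.ofReal (Real.exp (logPartition ν φ θ - θ ⬝ᵥ η)) := by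
  rw [centredLaplace_eq hφ, ← ofReal_integral_eq_lintegral_ofReal hθ
    (Eventually.of_forall fun _ => (Real.exp_pos _).le), ← ENNReal.ofReal_mul (Real.exp_pos _).le,
    sub_eq_neg_add, Real.exp_add, logPartition, Real.exp_log (integral_exp_pos hν hθ)]

/-- Fatou's lemma. Since the value ∞ is allowed, the boundary of the parameter domain needs no
separate treatment. -/
theorem lowerSemicontinuous_centredLaplace (hφ : Measurable φ) (η : n → ℝ) :
    LowerSemicontinuous (centredLaplace ν φ η) := by
  intro θ
  refine lowerSemicontinuousAt_iff_le_liminf.2 ?_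
  have h := lintegral_liminf_le (μ := ν) (u := 𝓝 θ) (fun θ => measurable_centred hφ η θ)
  refine le_trans (le_of_eq ?_) h
  refine lintegral_congr fun x => ?_
  have hc : Continuous fun θ : n → ℝ => ENNReal.ofReal (Real.exp (θ ⬝ᵥ φ x - θ ⬝ᵥ η)) := by
    refine ENNReal.continuous_ofReal.comp (Real.continuous_exp.comp ?_)
    simp only [dotProduct]
    fun_prop
  exact ((hc.tendsto θ).liminf_eq).symm

/-- Coercivity. Along an unbounded sequence in the sublevel set the directions subconverge to a unit
vector u, and the integrand tends to ∞ where ⟨u, φ⟩ > ⟨u, η⟩. This set has positive measure, so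
Fatou's lemma contradicts c < ∞. -/
theorem isBounded_sublevel_centredLaplace (hφ : Measurable φ) {η : n → ℝ}
    (hη : η ∈ supportInterior ν φ) {c : ENNReal} (hc : c < ⊤) :
    Bornology.IsBounded {θ | centredLaplace ν φ η θ ≤ c} := by
  by_contra hub
  have hseq : ∀ k : ℕ, ∃ θ, centredLaplace ν φ η θ ≤ c ∧ (k : ℝ) + 1 ≤ ‖θ‖ := by
    intro k
    by_contra! hcon
    exact hub (isBounded_iff_forall_norm_le.2 ⟨k + 1, fun θ hθ => (hcon θ hθ).le⟩)
  choose θ hθc hθn using hseq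
  have hpos : ∀ k, 0 < ‖θ k‖ := fun k => lt_of_lt_of_le (by positivity) (hθn k)
  have hsph : ∀ k, ‖θ k‖⁻¹ • θ k ∈ Metric.sphere (0 : n → ℝ) 1 := by
    intro k
    simp [norm_smul, (hpos k).ne']
  obtain ⟨u, hu, σ, hσ, hlim⟩ := (isCompact_sphere (0 : n → ℝ) 1).tendsto_subseq hsph
  have hu0 : u ≠ 0 := by rintro rfl; simp at hu
  have hfatou := lintegral_liminf_le (μ := ν) (u := atTop)
    (fun k => measurable_centred hφ η (θ (σ k)))
  have hle : liminf (fun k => ∫⁻ x, ENNReal.ofReal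
      (Real.exp (θ (σ k) ⬝ᵥ φ x - θ (σ k) ⬝ᵥ η)) ∂ν) atTop ≤ c :=
    liminf_le_of_le (by isBoundedDefault) fun b hb => by
      obtain ⟨k, hk⟩ := hb.exists
      exact hk.trans (hθc (σ k))
  have htop : ∀ x ∈ {x | u ⬝ᵥ η < u ⬝ᵥ φ x}, liminf (fun k => ENNReal.ofReal
      (Real.exp (θ (σ k) ⬝ᵥ φ x - θ (σ k) ⬝ᵥ η))) atTop = ⊤ := by
    intro x hx
    refine Tendsto.liminf_eq ?_
    refine ENNReal.tendsto_ofReal_atTop.comp (Real.tendsto_exp_atTop.comp ?_)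
    have hnorm : Tendsto (fun k => ‖θ (σ k)‖) atTop atTop := by
      refine tendsto_atTop_mono (fun k => hθn (σ k)) ?_
      exact tendsto_atTop_add_const_right _ _
        (tendsto_natCast_atTop_atTop.comp hσ.tendsto_atTop)
    have hdir : Tendsto (fun k => (‖θ (σ k)‖⁻¹ • θ (σ k)) ⬝ᵥ (φ x - η)) atTop
        (𝓝 (u ⬝ᵥ (φ x - η))) := by
      have hcont : Continuous fun v : n → ℝ => v ⬝ᵥ (φ x - η) := by
        simp only [dotProduct]; fun_prop
      exact (hcont.tendsto u).comp hlim
    have hup : 0 < u ⬝ᵥ (φ x - η) := by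
      rw [dotProduct_sub]; exact sub_pos.2 hx
    refine (hnorm.atTop_mul_pos hup hdir).congr fun k => ?_
    rw [smul_dotProduct, smul_eq_mul, ← mul_assoc, mul_inv_cancel₀ (hpos _).ne', one_mul,
      dotProduct_sub]
  have hmeas := measurableSet_dotProduct_pos (φ := φ) hφ u (u ⬝ᵥ η)
  have hinf : ∫⁻ x, liminf (fun k => ENNReal.ofReal
      (Real.exp (θ (σ k) ⬝ᵥ φ x - θ (σ k) ⬝ᵥ η))) atTop ∂ν = ⊤ := by
    rw [eq_top_iff]
    calc (⊤ : ENNReal) = ∫⁻ _ in {x | u ⬝ᵥ η < u ⬝ᵥ φ x}, ⊤ ∂ν := by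
          rw [setLIntegral_const, ENNReal.top_mul (hη u hu0)]
      _ = ∫⁻ x in {x | u ⬝ᵥ η < u ⬝ᵥ φ x}, liminf (fun k => ENNReal.ofReal
          (Real.exp (θ (σ k) ⬝ᵥ φ x - θ (σ k) ⬝ᵥ η))) atTop ∂ν :=
        setLIntegral_congr_fun hmeas fun x hx => (htop x hx).symm
      _ ≤ _ := setLIntegral_le_lintegral _ _
  rw [hinf] at hfatou
  exact absurd (hfatou.trans hle) (not_le.2 hc)

/-- The mean map of a regular minimal exponential family is onto the interior of the convex
support. -/
theorem meanParams_eq_supportInterior (hE : IsRegularMinimal ν φ)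
    (hne : (fullDomain ν φ).Nonempty) : meanParams ν φ = supportInterior ν φ := by
  refine (meanParams_subset_supportInterior hE).antisymm fun η hη => ?_
  obtain ⟨θ₀, hθ₀⟩ := hne
  have hφ := hE.measurable_stat
  set c := centredLaplace ν φ η θ₀ with hc
  have hcT : c < ⊤ := (centredLaplace_lt_top_iff hφ η θ₀).2 hθ₀
  have hlsc := lowerSemicontinuous_centredLaplace (ν := ν) hφ η
  have hcomp : IsCompact {θ | centredLaplace ν φ η θ ≤ c} :=
    Metric.isCompact_of_isClosed_isBounded (hlsc.isClosed_preimage c)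
      (isBounded_sublevel_centredLaplace hφ hη hcT)
  obtain ⟨θ, hθc, hmin⟩ := LowerSemicontinuousOn.exists_isMinOn ⟨θ₀, le_refl c⟩ hcomp
    (hlsc.lowerSemicontinuousOn _)
  have hθ : θ ∈ fullDomain ν φ := (centredLaplace_lt_top_iff hφ η θ).1 (lt_of_le_of_lt hθc hcT)
  have hglob : ∀ θ', centredLaplace ν φ η θ ≤ centredLaplace ν φ η θ' := by
    intro θ'
    rcases le_total (centredLaplace ν φ η θ') c with h | h
    · exact hmin h
    · exact le_trans hθc h
  -- The minimiser lies in the open domain by regularity, so the derivative of ψ(θ) - ⟨θ, η⟩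
  -- vanishes there, which says Λ(θ) = η.
  have hloc : IsLocalMin (fun θ => logPartition ν φ θ - θ ⬝ᵥ η) θ := by
    filter_upwards [hE.isOpen_fullDomain.mem_nhds hθ] with θ' hθ'
    have h := hglob θ'
    rw [centredLaplace_of_mem hE.base_ne_zero hφ η hθ,
      centredLaplace_of_mem hE.base_ne_zero hφ η hθ',
      ENNReal.ofReal_le_ofReal_iff (Real.exp_pos _).le, Real.exp_le_exp] at h
    exact h
  have hd : HasFDerivAt (fun θ : n → ℝ => θ ⬝ᵥ η) (dotCLM η) θ :=
    (dotCLM η).hasFDerivAt.congr_of_eventuallyEq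
      (Eventually.of_forall fun v => by rw [dotCLM_apply, dotProduct_comm])
  have h0 := hloc.hasFDerivAt_eq_zero ((hasFDerivAt_logPartition hE hθ).sub hd)
  refine ⟨θ, hE.natParams_eq.symm ▸ hθ, ?_⟩
  have h1 := congrArg (fun L => L (meanMap ν φ θ - η)) h0
  simp only [sub_apply, dotCLM_apply, zero_apply, ← sub_dotProduct] at h1
  exact sub_eq_zero.1 (dotProduct_self_eq_zero.1 h1)

theorem convex_meanParams (hE : IsRegularMinimal ν φ) : Convex ℝ (meanParams ν φ) := by
  rcases (fullDomain ν φ).eq_empty_or_nonempty with h | h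
  · have : meanParams ν φ = ∅ := by rw [meanParams, hE.natParams_eq, h, Set.image_empty]
    rw [this]
    exact convex_empty
  · rw [meanParams_eq_supportInterior hE h]
    exact convex_supportInterior

end ExpFamily

/-! ### Correlation bounds -/

section CorrBounds

theorem sqrt_mulVec_dotProduct {m : Type*} [Fintype m] [DecidableEq m] (Q : Matrix m m ℝ)
    (x y : m → ℝ) :
    (CFC.sqrt Q *ᵥ x) ⬝ᵥ y = x ⬝ᵥ CFC.sqrt Q *ᵥ y := by
  have h : (CFC.sqrt Q)ᵀ = CFC.sqrt Q := by
    have := (Matrix.nonneg_iff_posSemidef.1 (CFC.sqrt_nonneg Q)).1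
    simpa [Matrix.IsHermitian, Matrix.conjTranspose_eq_transpose_of_trivial] using this
  rw [Matrix.dotProduct_mulVec, ← Matrix.mulVec_transpose, h]

theorem sqrt_mul_sqrt {m : Type*} [Fintype m] [DecidableEq m] {Q : Matrix m m ℝ}
    (hQ : Q.PosSemidef) : CFC.sqrt Q * CFC.sqrt Q = Q :=
  CFC.sqrt_mul_sqrt_self Q (Matrix.nonneg_iff_posSemidef.2 hQ)

theorem isUnit_det_sqrt {m : Type*} [Fintype m] [DecidableEq m] {Q : Matrix m m ℝ}
    (hQ : Q.PosDef) : IsUnit (CFC.sqrt Q).det := by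
  have h := (Matrix.isUnit_iff_isUnit_det _).1 hQ.isUnit
  rw [← sqrt_mul_sqrt hQ.posSemidef, Matrix.det_mul] at h
  exact isUnit_of_mul_isUnit_left h

theorem norm_toLp_eq {m : Type*} [Fintype m] (x : m → ℝ) :
    ‖WithLp.toLp 2 x‖ = √(x ⬝ᵥ x) := by
  rw [EuclideanSpace.norm_eq]
  congr 1
  simp [dotProduct, sq]

theorem norm_sqrt_mulVec {m : Type*} [Fintype m] [DecidableEq m] {Q : Matrix m m ℝ}
    (hQ : Q.PosSemidef) (x : m → ℝ) :
    ‖WithLp.toLp 2 (CFC.sqrt Q *ᵥ x)‖ = √(x ⬝ᵥ Q *ᵥ x) := by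
  rw [norm_toLp_eq, sqrt_mulVec_dotProduct, Matrix.mulVec_mulVec, sqrt_mul_sqrt hQ]

theorem abs_dotProduct_le_norm {m : Type*} [Fintype m] (x y : m → ℝ) :
    |x ⬝ᵥ y| ≤ ‖WithLp.toLp 2 x‖ * ‖WithLp.toLp 2 y‖ := by
  have h := abs_real_inner_le_norm (WithLp.toLp 2 y) (WithLp.toLp 2 x)
  rw [EuclideanSpace.inner_toLp_toLp, star_trivial, mul_comm] at h
  exact h

theorem abs_covariance_le {Ω : Type*} [MeasurableSpace Ω] {P : Measure Ω} [IsFiniteMeasure P]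
    {X Y : Ω → ℝ} (hX : MemLp X 2 P) (hY : MemLp Y 2 P) :
    |covariance X Y P| ≤ √(variance X P) * √(variance Y P) := by
  have h : ∀ s : ℝ, 0 ≤ variance Y P * (s * s) + 2 * covariance X Y P * s + variance X P := by
    intro s
    have h1 := variance_nonneg (X + s • Y) P
    rw [variance_add hX (hY.const_smul s), covariance_smul_right, variance_smul] at h1
    linarith
  have hd := discrim_le_zero h
  rw [discrim] at hd
  rw [← Real.sqrt_mul (variance_nonneg _ _)]
  refine Real.abs_le_sqrt ?_
  linarith

variable {Ω m n : Type*} [MeasurableSpace Ω] [Fintype m] [DecidableEq m] [Fintype n]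
  [DecidableEq n] {P : Measure Ω} {f : Ω → m → ℝ} {g : Ω → n → ℝ}

/-- The covariance factors as S Corr T with S and T the square roots of the variances, and ‖S x‖² =
xᵀ S² x. -/
theorem abs_dotProduct_covMatrix_le (hf : (covMatrix P f f).PosDef)
    (hg : (covMatrix P g g).PosDef) (x : m → ℝ) (y : n → ℝ) :
    |x ⬝ᵥ covMatrix P f g *ᵥ y| ≤ ‖corrMatrix P f g‖ * √(x ⬝ᵥ covMatrix P f f *ᵥ x) *
      √(y ⬝ᵥ covMatrix P g g *ᵥ y) := by
  set S := CFC.sqrt (covMatrix P f f) with hS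
  set T := CFC.sqrt (covMatrix P g g) with hT
  have hSu : IsUnit S.det := isUnit_det_sqrt hf
  have hTu : IsUnit T.det := isUnit_det_sqrt hg
  have h1 : covMatrix P f g = S * (corrMatrix P f g * T) := by
    rw [corrMatrix, Matrix.mul_assoc, Matrix.mul_assoc, Matrix.nonsing_inv_mul _ hTu,
      Matrix.mul_one, ← Matrix.mul_assoc, Matrix.mul_nonsing_inv _ hSu, Matrix.one_mul]
  rw [h1, ← Matrix.mulVec_mulVec, ← sqrt_mulVec_dotProduct, ← Matrix.mulVec_mulVec,
    ← norm_sqrt_mulVec hf.posSemidef, ← norm_sqrt_mulVec hg.posSemidef]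
  refine (abs_dotProduct_le_norm _ _).trans ?_
  rw [mul_comm ‖corrMatrix P f g‖, mul_assoc]
  exact mul_le_mul_of_nonneg_left
    (Matrix.l2_opNorm_mulVec (corrMatrix P f g) (WithLp.toLp 2 (T *ᵥ y))) (norm_nonneg _)

/-- Cauchy–Schwarz for the covariance of ⟨S⁻¹ x, f⟩ and ⟨T⁻¹ y, g⟩, whose variances are ‖x‖² and
‖y‖². -/
theorem norm_corrMatrix_le_one [IsFiniteMeasure P] (hf : ∀ k, MemLp (fun x => f x k) 2 P)
    (hg : ∀ k, MemLp (fun x => g x k) 2 P) (hfp : (covMatrix P f f).PosDef)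
    (hgp : (covMatrix P g g).PosDef) : ‖corrMatrix P f g‖ ≤ 1 := by
  set S := CFC.sqrt (covMatrix P f f) with hS
  set T := CFC.sqrt (covMatrix P g g) with hT
  have hSu : IsUnit S.det := isUnit_det_sqrt hfp
  have hTu : IsUnit T.det := isUnit_det_sqrt hgp
  have hbil : ∀ (x : m → ℝ) (y : n → ℝ),
      |x ⬝ᵥ corrMatrix P f g *ᵥ y| ≤ ‖WithLp.toLp 2 x‖ * ‖WithLp.toLp 2 y‖ := by
    intro x y
    have hx : S *ᵥ (S⁻¹ *ᵥ x) = x := by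
      rw [Matrix.mulVec_mulVec, Matrix.mul_nonsing_inv _ hSu, Matrix.one_mulVec]
    have hy : T *ᵥ (T⁻¹ *ᵥ y) = y := by
      rw [Matrix.mulVec_mulVec, Matrix.mul_nonsing_inv _ hTu, Matrix.one_mulVec]
    have h1 : x ⬝ᵥ corrMatrix P f g *ᵥ y = (S⁻¹ *ᵥ x) ⬝ᵥ covMatrix P f g *ᵥ (T⁻¹ *ᵥ y) := by
      conv_lhs => rw [← hx]
      rw [sqrt_mulVec_dotProduct, corrMatrix, Matrix.mulVec_mulVec,
        ← Matrix.mul_assoc, ← Matrix.mul_assoc, Matrix.mul_nonsing_inv _ hSu, Matrix.one_mul,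
        ← Matrix.mulVec_mulVec]
    rw [h1, dotProduct_covMatrix_mulVec hf hg]
    refine (abs_covariance_le (memLp_dotProduct hf _) (memLp_dotProduct hg _)).trans (le_of_eq ?_)
    rw [← dotProduct_covMatrix_self hf, ← dotProduct_covMatrix_self hg,
      ← norm_sqrt_mulVec hfp.posSemidef, ← norm_sqrt_mulVec hgp.posSemidef, hx, hy]
  rw [Matrix.l2_opNorm_def]
  refine ContinuousLinearMap.opNorm_le_bound _ zero_le_one fun y => ?_
  rw [one_mul]
  change ‖WithLp.toLp 2 (corrMatrix P f g *ᵥ y.ofLp)‖ ≤ ‖y‖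
  set z := corrMatrix P f g *ᵥ y.ofLp with hz
  -- Testing with z = Corr y itself gives ‖z‖² ≤ ‖z‖ ‖y‖.
  have h1 := hbil z y.ofLp
  have h2 : z ⬝ᵥ z = ‖WithLp.toLp 2 z‖ * ‖WithLp.toLp 2 z‖ := by
    rw [norm_toLp_eq, Real.mul_self_sqrt]
    exact Finset.sum_nonneg fun _ _ => mul_self_nonneg _
  rw [← hz, h2, abs_of_nonneg (by positivity)] at h1
  rcases (norm_nonneg (WithLp.toLp 2 z)).eq_or_lt with h0 | h0
  · rw [← h0]; exact norm_nonneg _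
  · exact le_of_mul_le_mul_left h1 h0

end CorrBounds

/-! ### Slices of exponential families -/

namespace ExpFamily

variable {Ω m n : Type*} [MeasurableSpace Ω] [Fintype m] [Fintype n] {ν : Measure Ω}
  {φ : Ω → m ⊕ n → ℝ}

/-- The base measure of the subfamily in which the parameters with index in `m` are fixed. -/
noncomputable def sliceBase (ν : Measure Ω) (φ : Ω → m ⊕ n → ℝ) (a : m → ℝ) : Measure Ω :=
  ν.withDensity fun x => ENNReal.ofReal (Real.exp (a ⬝ᵥ fun k => φ x (Sum.inl k)))

/-- The statistic of the subfamily in which the parameters with index in `m` are fixed. -/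
def sliceStat (φ : Ω → m ⊕ n → ℝ) (x : Ω) (k : n) : ℝ := φ x (Sum.inr k)

theorem measurable_left (hφ : Measurable φ) (a : m → ℝ) :
    Measurable fun x => Real.exp (a ⬝ᵥ fun k => φ x (Sum.inl k)) := by
  refine measurable_exp (φ := fun x k => φ x (Sum.inl k)) ?_ a
  exact measurable_pi_lambda _ fun k => (measurable_pi_apply _).comp hφ

theorem measurable_sliceStat (hφ : Measurable φ) : Measurable (sliceStat φ) :=
  measurable_pi_lambda _ fun _ => (measurable_pi_apply _).comp hφ

theorem exp_sumElim (a : m → ℝ) (θ : n → ℝ) (x : Ω) :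
    Real.exp (Sum.elim a θ ⬝ᵥ φ x) =
      Real.exp (a ⬝ᵥ fun k => φ x (Sum.inl k)) * Real.exp (θ ⬝ᵥ sliceStat φ x) := by
  rw [← Real.exp_add]
  congr 1
  simp [dotProduct, sliceStat, Fintype.sum_sum_type]

theorem integral_sliceBase (hφ : Measurable φ) (a : m → ℝ) (f : Ω → ℝ) :
    ∫ x, f x ∂(sliceBase ν φ a) =
      ∫ x, Real.exp (a ⬝ᵥ fun k => φ x (Sum.inl k)) * f x ∂ν := by
  rw [sliceBase, integral_withDensity_eq_integral_toReal_smul₀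
    (measurable_left hφ a).ennreal_ofReal.aemeasurable (by simp)]
  refine integral_congr_ae (Filter.Eventually.of_forall fun x => ?_)
  simp only [smul_eq_mul]
  rw [ENNReal.toReal_ofReal (Real.exp_pos _).le]

theorem mem_fullDomain_slice (hφ : Measurable φ) (a : m → ℝ) (θ : n → ℝ) :
    θ ∈ fullDomain (sliceBase ν φ a) (sliceStat φ) ↔ Sum.elim a θ ∈ fullDomain ν φ := by
  simp only [fullDomain, Set.mem_ofPred_eq, exp_sumElim]
  rw [sliceBase, integrable_withDensity_iff_integrable_smul' (measurable_left hφ a).ennreal_ofReal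
    (by simp)]
  refine integrable_congr (Filter.Eventually.of_forall fun x => ?_)
  simp only [smul_eq_mul]
  rw [ENNReal.toReal_ofReal (Real.exp_pos _).le]

theorem partition_slice (hφ : Measurable φ) (a : m → ℝ) (θ : n → ℝ) :
    ∫ x, Real.exp (θ ⬝ᵥ sliceStat φ x) ∂(sliceBase ν φ a) =
      ∫ x, Real.exp (Sum.elim a θ ⬝ᵥ φ x) ∂ν := by
  rw [integral_sliceBase hφ]
  simp only [exp_sumElim]

theorem logPartition_slice (hφ : Measurable φ) (a : m → ℝ) (θ : n → ℝ) :
    logPartition (sliceBase ν φ a) (sliceStat φ) θ = logPartition ν φ (Sum.elim a θ) := by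
  rw [logPartition, logPartition, partition_slice hφ]

theorem law_slice (hφ : Measurable φ) (a : m → ℝ) (θ : n → ℝ) :
    law (sliceBase ν φ a) (sliceStat φ) θ = law ν φ (Sum.elim a θ) := by
  rw [law, law, normalizedLaw, normalizedLaw, partition_slice hφ, sliceBase, ← withDensity_mul _
    (measurable_left hφ a).ennreal_ofReal
    ((measurable_exp (measurable_sliceStat hφ) θ).div_const _).ennreal_ofReal]
  congr 1
  funext x
  rw [Pi.mul_apply, ← ENNReal.ofReal_mul (Real.exp_pos _).le, exp_sumElim, mul_div_assoc]

theorem meanMap_slice (hφ : Measurable φ) (a : m → ℝ) (θ : n → ℝ) (k : n) :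
    meanMap (sliceBase ν φ a) (sliceStat φ) θ k = meanMap ν φ (Sum.elim a θ) (Sum.inr k) := by
  rw [meanMap, law_slice hφ]
  rfl

theorem covMatrix_slice (hφ : Measurable φ) (a : m → ℝ) (θ : n → ℝ) :
    covMatrix (law (sliceBase ν φ a) (sliceStat φ) θ) (sliceStat φ) (sliceStat φ) =
      (covMatrix (law ν φ (Sum.elim a θ)) φ φ).submatrix Sum.inr Sum.inr := by
  rw [law_slice hφ]
  rfl

theorem sliceBase_absolutelyContinuous (hφ : Measurable φ) (a : m → ℝ) :
    ν ≪ sliceBase ν φ a :=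
  withDensity_absolutelyContinuous' (measurable_left hφ a).ennreal_ofReal.aemeasurable
    (Filter.Eventually.of_forall fun x => by simpa using Real.exp_pos _)

/-- The domain of the slice is the preimage of an open set under an affine embedding, and its
covariance is a principal submatrix. -/
theorem IsRegularMinimal.slice (hE : IsRegularMinimal ν φ) (a : m → ℝ) :
    IsRegularMinimal (sliceBase ν φ a) (sliceStat φ) where
  measurable_stat := measurable_sliceStat hE.measurable_stat
  base_ne_zero := by
    intro h
    have h1 := sliceBase_absolutelyContinuous (ν := ν) hE.measurable_stat a
    rw [h] at h1
    exact hE.base_ne_zero (Measure.absolutelyContinuous_zero_iff.1 h1)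
  isOpen_fullDomain := by
    have h : fullDomain (sliceBase ν φ a) (sliceStat φ) = (fun θ => Sum.elim a θ) ⁻¹'
        fullDomain ν φ := Set.ext fun θ => mem_fullDomain_slice hE.measurable_stat a θ
    rw [h]
    refine hE.isOpen_fullDomain.preimage (continuous_pi fun k => ?_)
    rcases k with k | k
    · exact continuous_const
    · exact continuous_apply k
  posDef_cov θ hθ := by
    rw [covMatrix_slice hE.measurable_stat]
    exact (hE.posDef_cov _ ((mem_fullDomain_slice hE.measurable_stat a θ).1 hθ)).submatrix
      Sum.inr_injective

end ExpFamily

/-! ### The families of an inference family -/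

namespace ExpFamily

theorem IsRegularMinimal.of_isUnit_det {Ω n : Type*} [MeasurableSpace Ω] [Fintype n]
    [DecidableEq n] {ν : Measure Ω} {φ : Ω → n → ℝ} (hφ : Measurable φ) (hν : ν ≠ 0)
    (hopen : IsOpen (fullDomain ν φ))
    (hdet : ∀ θ ∈ natParams ν φ, IsUnit (covMatrix (law ν φ θ) φ φ).det) :
    IsRegularMinimal ν φ where
  measurable_stat := hφ
  base_ne_zero := hν
  isOpen_fullDomain := hopen
  posDef_cov θ hθ := by
    have := isProbabilityMeasure_law hν hθ
    refine (posSemidef_covMatrix (memLp_stat hφ hν hopen hθ)).posDef_iff_isUnit.2 ?_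
    rw [Matrix.isUnit_iff_isUnit_det]
    exact hdet θ (by rwa [natParams, hopen.interior_eq])

end ExpFamily

namespace InferenceData

open ExpFamily

variable {V : Type*} {H : FactorGraph V} {X : V → Type*} [∀ i, MeasurableSpace (X i)]
  {I : InferenceData H X}

instance instSigmaFinite (i : V) : SigmaFinite (I.ν i) := I.sigmaFinite_ν i

theorem νF_ne_zero (α : H.Edge) : I.νF α ≠ 0 := by
  rw [← Measure.measure_univ_ne_zero, νF, Measure.pi_univ]
  exact Finset.prod_ne_zero_iff.2 fun i _ => Measure.measure_univ_ne_zero.2 (I.ν_ne_zero i.1)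

theorem measurable_stat (α : H.Edge) : Measurable (I.stat α) := by
  refine measurable_pi_lambda _ fun k => ?_
  rcases k with k | k
  · exact (measurable_pi_apply k).comp (I.measurable_φF α)
  · exact (measurable_pi_apply k.2).comp ((I.measurable_φV k.1.1).comp (measurable_pi_apply k.1))

theorem isRegularMinimal_vertex (hI : I.IsInferenceFamily) (hreg : I.IsRegular) (i : V) :
    IsRegularMinimal (I.ν i) (I.φV i) :=
  .of_isUnit_det (I.measurable_φV i) (I.ν_ne_zero i) (hreg.isOpen_V i) (hI.isUnit_covV i)

open Classical in
theorem isRegularMinimal_edge (hI : I.IsInferenceFamily) (hreg : I.IsRegular) (α : H.Edge) :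
    IsRegularMinimal (I.νF α) (I.stat α) :=
  .of_isUnit_det (measurable_stat α) (νF_ne_zero α) (hreg.isOpen_F α)
    (fun θ hθ => by convert hI.isUnit_covF α θ hθ)

/-- The base measure of the subfamily of `α` whose parameter belonging to `α` itself is that of the
compatibility function. -/
noncomputable abbrev edgeBase (θbar : I.ModelParams) (α : H.Edge) : Measure (I.Config α) :=
  sliceBase (I.νF α) (I.stat α) fun k => θbar α (Sum.inl k)

/-- The statistic of the vertices of `α`. -/
abbrev edgeStat (I : InferenceData H X) (α : H.Edge) :
    I.Config α → (Σ i : {i : V // i ∈ α.1}, Fin (I.dimV i.1)) → ℝ :=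
  sliceStat (I.stat α)

/-- The full natural parameter with components `θ` at the vertices of `α`. -/
abbrev fullParam (θbar : I.ModelParams) (α : H.Edge)
    (θ : (Σ i : {i : V // i ∈ α.1}, Fin (I.dimV i.1)) → ℝ) : I.StatIdx α → ℝ :=
  Sum.elim (fun k => θbar α (Sum.inl k)) θ

theorem isRegularMinimal_slice (hI : I.IsInferenceFamily) (hreg : I.IsRegular)
    (θbar : I.ModelParams) (α : H.Edge) :
    IsRegularMinimal (I.edgeBase θbar α) (I.edgeStat α) :=
  (isRegularMinimal_edge hI hreg α).slice _

theorem fullParam_of_eq {θbar : I.ModelParams} {α : H.Edge} {θ : I.StatIdx α → ℝ}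
    (h : ∀ k, θ (Sum.inl k) = θbar α (Sum.inl k)) :
    (Sum.elim (fun k => θbar α (Sum.inl k)) fun p => θ (Sum.inr p)) = θ := by
  funext k
  rcases k with k | k
  · exact (h k).symm
  · rfl

/-- For each α the frozen components leave a parameter of the slice, whose mean is the restriction
of η to α. The domain thus is an intersection of preimages of mean parameter sets under linear maps,
and inherits openness and convexity from them. -/
theorem mem_restrictedDomain_iff (hI : I.IsInferenceFamily) (hreg : I.IsRegular)
    (θbar : I.ModelParams) (η : ∀ i, Fin (I.dimV i) → ℝ) :
    η ∈ I.restrictedDomain θbar ↔ (∀ i, η i ∈ meanParams (I.ν i) (I.φV i)) ∧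
      ∀ α, H.restrictEdge α η ∈ meanParams (I.edgeBase θbar α) (I.edgeStat α) := by
  constructor
  · rintro ⟨p, ⟨⟨_, h2, h3⟩, h4⟩, rfl⟩
    refine ⟨h2, fun α => ?_⟩
    obtain ⟨θ, hθ, hmean, hθbar⟩ := h4 α
    refine ⟨fun p => θ (Sum.inr p), ?_, ?_⟩
    · rw [(isRegularMinimal_slice hI hreg θbar α).natParams_eq,
        mem_fullDomain_slice (measurable_stat α), fullParam_of_eq hθbar]
      rwa [← (isRegularMinimal_edge hI hreg α).natParams_eq]
    · funext q
      rw [meanMap_slice (measurable_stat α), fullParam_of_eq hθbar, hmean]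
      exact h3 α q.1 q.2
  · rintro ⟨h1, h2⟩
    choose θ hθ hmean using h2
    have hmem : ∀ α, fullParam θbar α (θ α) ∈ natParams (I.νF α) (I.stat α) := by
      intro α
      have := hθ α
      rwa [(isRegularMinimal_slice hI hreg θbar α).natParams_eq,
        mem_fullDomain_slice (measurable_stat α),
        ← (isRegularMinimal_edge hI hreg α).natParams_eq] at this
    refine ⟨(fun α => meanMap (I.νF α) (I.stat α) (fullParam θbar α (θ α)), η),
      ⟨⟨fun α => ⟨_, hmem α, rfl⟩, h1, fun α i k => ?_⟩,
        fun α => ⟨_, hmem α, rfl, fun k => rfl⟩⟩, rfl⟩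
    have := congrFun (hmean α) ⟨i, k⟩
    rw [meanMap_slice (measurable_stat α)] at this
    exact this

/-- The Bethe free energy on `S(Ψ)` in terms of the subfamilies of the hyperedges. -/
noncomputable def reducedBethe [Fintype V] [DecidableEq V] (θbar : I.ModelParams)
    (η : ∀ i, Fin (I.dimV i) → ℝ) : ℝ :=
  (∑ α, (legendre (I.edgeBase θbar α) (I.edgeStat α) (H.restrictEdge α η) -
    (fun q => θbar α (Sum.inr q)) ⬝ᵥ H.restrictEdge α η)) +
    ∑ i, (1 - (H.degree i : ℝ)) * legendre (I.ν i) (I.φV i) (η i)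

/-- The Legendre transforms of the full family and of the slice differ by ⟨θbar_⟨α⟩, η_⟨α⟩⟩, which
cancels this part of the energy term. Since the value depends on the vertex coordinates only, the
choice made by `Function.invFunOn` in `restrictedBethe` is harmless. -/
theorem bethe_eq_reducedBethe [Fintype V] [DecidableEq V] (hI : I.IsInferenceFamily)
    (hreg : I.IsRegular) (θbar : I.ModelParams) {p : I.ParamSpace}
    (hp : p ∈ I.restrictedSet θbar) : I.bethe θbar p = I.reducedBethe θbar p.2 := by
  obtain ⟨⟨_, _, h3⟩, h4⟩ := hp
  rw [bethe, reducedBethe, ← Finset.sum_neg_distrib, ← Finset.sum_add_distrib]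
  congr 1
  refine Finset.sum_congr rfl fun α _ => ?_
  obtain ⟨θ, hθ, hmean, hθbar⟩ := h4 α
  rw [(isRegularMinimal_edge hI hreg α).natParams_eq] at hθ
  have hslice : (fun p => θ (Sum.inr p)) ∈ fullDomain (I.edgeBase θbar α) (I.edgeStat α) := by
    rwa [mem_fullDomain_slice (measurable_stat α), fullParam_of_eq hθbar]
  have hres : H.restrictEdge α p.2 =
      meanMap (I.edgeBase θbar α) (I.edgeStat α) (fun p => θ (Sum.inr p)) := by
    funext q
    rw [meanMap_slice (measurable_stat α), fullParam_of_eq hθbar, hmean]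
    exact (h3 α q.1 q.2).symm
  have hresq : ∀ q, H.restrictEdge α p.2 q = p.1 α (Sum.inr q) := fun q => (h3 α q.1 q.2).symm
  rw [← hmean, legendre_meanMap (isRegularMinimal_edge hI hreg α) hθ, hmean]
  rw [hres, legendre_meanMap (isRegularMinimal_slice hI hreg θbar α) hslice, ← hres,
    logPartition_slice (measurable_stat α), fullParam_of_eq hθbar]
  simp only [dotProduct, Fintype.sum_sum_type, hθbar, hresq]
  ring

theorem restrictedBethe_eq [Fintype V] [DecidableEq V] (hI : I.IsInferenceFamily)
    (hreg : I.IsRegular) (θbar : I.ModelParams) {η : ∀ i, Fin (I.dimV i) → ℝ}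
    (hη : η ∈ I.restrictedDomain θbar) : I.restrictedBethe θbar η = I.reducedBethe θbar η := by
  rw [restrictedBethe, bethe_eq_reducedBethe hI hreg θbar (Function.invFunOn_mem hη),
    Function.invFunOn_eq hη]

theorem isOpen_restrictedDomain [Finite V] (hI : I.IsInferenceFamily) (hreg : I.IsRegular)
    (θbar : I.ModelParams) : IsOpen (I.restrictedDomain θbar) := by
  have h : I.restrictedDomain θbar = (⋂ i, (fun η => η i) ⁻¹' meanParams (I.ν i) (I.φV i)) ∩
      ⋂ α, (H.restrictEdge α) ⁻¹' meanParams (I.edgeBase θbar α) (I.edgeStat α) := by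
    ext η
    simp [mem_restrictedDomain_iff hI hreg]
  rw [h]
  refine (isOpen_iInter_of_finite fun i =>
    (isOpen_meanParams (isRegularMinimal_vertex hI hreg i)).preimage (continuous_apply i)).inter
    (isOpen_iInter_of_finite fun α =>
    (isOpen_meanParams (isRegularMinimal_slice hI hreg θbar α)).preimage ?_)
  unfold FactorGraph.restrictEdge
  fun_prop

theorem convex_restrictedDomain (hI : I.IsInferenceFamily) (hreg : I.IsRegular)
    (θbar : I.ModelParams) : Convex ℝ (I.restrictedDomain θbar) := by
  intro η hη η' hη' a b ha hb hab
  rw [mem_restrictedDomain_iff hI hreg] at hη hη' ⊢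
  exact ⟨fun i => convex_meanParams (isRegularMinimal_vertex hI hreg i) (hη.1 i) (hη'.1 i)
    ha hb hab, fun α => convex_meanParams (isRegularMinimal_slice hI hreg θbar α) (hη.2 α)
    (hη'.2 α) ha hb hab⟩

/-- The vertex marginals of the members of the family of a hyperedge. -/
theorem map_law_edge (hI : I.IsInferenceFamily) (hreg : I.IsRegular) {α : H.Edge}
    {θ : I.StatIdx α → ℝ} (hθ : θ ∈ fullDomain (I.νF α) (I.stat α)) (i : {i : V // i ∈ α.1}) :
    (fun k => meanMap (I.νF α) (I.stat α) θ (Sum.inr ⟨i, k⟩)) ∈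
        meanParams (I.ν i.1) (I.φV i.1) ∧
      (law (I.νF α) (I.stat α) θ).map (fun x => x i) = law (I.ν i.1) (I.φV i.1)
        (natParam (I.ν i.1) (I.φV i.1)
          fun k => meanMap (I.νF α) (I.stat α) θ (Sum.inr ⟨i, k⟩)) := by
  have hE := isRegularMinimal_vertex hI hreg i.1
  obtain ⟨θ', hθ', hmap⟩ := hI.marginal_mem α i θ
    (by rwa [(isRegularMinimal_edge hI hreg α).natParams_eq])
  have hmean : (fun k => meanMap (I.νF α) (I.stat α) θ (Sum.inr ⟨i, k⟩)) =
      meanMap (I.ν i.1) (I.φV i.1) θ' := by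
    funext k
    rw [meanMap, meanMap, ← hmap, integral_map (measurable_pi_apply i).aemeasurable
      ((measurable_pi_apply k).comp hE.measurable_stat).aestronglyMeasurable]
    rfl
  rw [hmean]
  refine ⟨⟨θ', hθ', rfl⟩, ?_⟩
  rw [hE.natParams_eq] at hθ'
  rw [natParam_meanMap hE hθ', hmap]

/-- The covariance matrix of the vertex `i` at the expectation parameter `η`. -/
noncomputable abbrev vertexCov (I : InferenceData H X) (i : V) (η : Fin (I.dimV i) → ℝ) :
    Matrix (Fin (I.dimV i)) (Fin (I.dimV i)) ℝ :=
  covMatrix (law (I.ν i) (I.φV i) (natParam (I.ν i) (I.φV i) η)) (I.φV i) (I.φV i)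

/-- The covariance matrix of the vertex statistics of `α` under the member of the subfamily with
expectation parameter `η`. -/
noncomputable abbrev edgeCov (θbar : I.ModelParams) (α : H.Edge)
    (η : (Σ i : {i : V // i ∈ α.1}, Fin (I.dimV i.1)) → ℝ) :
    Matrix (Σ i : {i : V // i ∈ α.1}, Fin (I.dimV i.1))
      (Σ i : {i : V // i ∈ α.1}, Fin (I.dimV i.1)) ℝ :=
  covMatrix (law (I.edgeBase θbar α) (I.edgeStat α)
    (natParam (I.edgeBase θbar α) (I.edgeStat α) η)) (I.edgeStat α) (I.edgeStat α)

theorem map_law_slice (hI : I.IsInferenceFamily) (hreg : I.IsRegular) {θbar : I.ModelParams}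
    {α : H.Edge} {η : (Σ i : {i : V // i ∈ α.1}, Fin (I.dimV i.1)) → ℝ}
    (hη : η ∈ meanParams (I.edgeBase θbar α) (I.edgeStat α)) (i : {i : V // i ∈ α.1}) :
    (law (I.edgeBase θbar α) (I.edgeStat α)
      (natParam (I.edgeBase θbar α) (I.edgeStat α) η)).map (fun x => x i) =
      law (I.ν i.1) (I.φV i.1) (natParam (I.ν i.1) (I.φV i.1) fun k => η ⟨i, k⟩) := by
  have hS := isRegularMinimal_slice hI hreg θbar α
  have hθ := natParam_mem hS hη
  have hη' := meanMap_natParam hη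
  set θ := natParam (I.edgeBase θbar α) (I.edgeStat α) η
  have h := (map_law_edge hI hreg ((mem_fullDomain_slice (measurable_stat α) _ _).1 hθ) i).2
  simp only [← meanMap_slice (measurable_stat α)] at h
  rw [law_slice (measurable_stat α), h, hη']

/-- Here the marginalisation hypothesis enters the Hessian: the i-marginal of the hyperedge law is
the vertex law with the same mean, so the diagonal block is the same for all hyperedges at i. -/
theorem edgeCov_diag (hI : I.IsInferenceFamily) (hreg : I.IsRegular) {θbar : I.ModelParams}
    {α : H.Edge} {η : (Σ i : {i : V // i ∈ α.1}, Fin (I.dimV i.1)) → ℝ}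
    (hη : η ∈ meanParams (I.edgeBase θbar α) (I.edgeStat α)) (i : {i : V // i ∈ α.1}) :
    covMatrix (law (I.edgeBase θbar α) (I.edgeStat α)
      (natParam (I.edgeBase θbar α) (I.edgeStat α) η))
      (fun x => I.φV i.1 (x i)) (fun x => I.φV i.1 (x i)) =
      I.vertexCov i.1 fun k => η ⟨i, k⟩ := by
  ext k l
  have hm : ∀ k, Measurable fun x => I.φV i.1 x k := fun k =>
    (measurable_pi_apply k).comp (I.measurable_φV i.1)
  rw [vertexCov, ← map_law_slice hI hreg hη i]
  simp only [covMatrix, Matrix.of_apply]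
  rw [covariance_map_fun (hm k).aestronglyMeasurable (hm l).aestronglyMeasurable
    (measurable_pi_apply i).aemeasurable]

/-! ### The weights bound the correlations of the members of the subfamilies -/

/-- Boundedness is essential: the real `sSup` of an unbounded set is 0 and would bound nothing. -/
theorem bddAbove_corrNorms (θbar : I.ModelParams) (α : H.Edge) (i j : {i : V // i ∈ α.1}) :
    BddAbove (I.corrNorms θbar α i j) := by
  refine ⟨1, ?_⟩
  rintro r ⟨f, hfm, hfp, hinteg, b, rfl, h1, h2, h3, h4, rfl⟩
  have hpos : ∀ x : I.Config α, 0 < I.compat θbar α x * ∏ k, f k (x k) := fun x =>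
    mul_pos (Real.exp_pos _) (Finset.prod_pos fun k _ => hfp k _)
  have := isProbabilityMeasure_normalizedLaw (fun x => (hpos x).le) hinteg
    (integral_pos_of_pos (νF_ne_zero α) hpos hinteg)
  exact norm_corrMatrix_le_one (memLp_pi_iff.1 h1) (memLp_pi_iff.1 h2) h3 h4

theorem weight_nonneg (θbar : I.ModelParams) (α : H.Edge) (i j : {i : V // i ∈ α.1}) :
    0 ≤ I.weight θbar α i j := by
  refine Real.sSup_nonneg ?_
  rintro r ⟨f, hfm, hfp, hinteg, b, hb, h1, h2, h3, h4, rfl⟩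
  exact norm_nonneg _

theorem exp_fullParam_eq (θbar : I.ModelParams) (α : H.Edge)
    (θ : (Σ i : {i : V // i ∈ α.1}, Fin (I.dimV i.1)) → ℝ) (x : I.Config α) :
    Real.exp (fullParam θbar α θ ⬝ᵥ I.stat α x) = I.compat θbar α x *
      ∏ i, Real.exp ((fun k => θ ⟨i, k⟩ - θbar α (Sum.inr ⟨i, k⟩)) ⬝ᵥ I.φV i.1 (x i)) := by
  rw [compat, ← Real.exp_sum, ← Real.exp_add]
  congr 1
  simp only [dotProduct, Fintype.sum_sum_type, Fintype.sum_sigma, sub_mul, Finset.sum_sub_distrib,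
    stat, Sum.elim_inl, Sum.elim_inr]
  ring

theorem memLp_edgeStat (hI : I.IsInferenceFamily) (hreg : I.IsRegular) {θbar : I.ModelParams}
    {α : H.Edge} {θ : (Σ i : {i : V // i ∈ α.1}, Fin (I.dimV i.1)) → ℝ}
    (hθ : θ ∈ fullDomain (I.edgeBase θbar α) (I.edgeStat α)) (i : {i : V // i ∈ α.1})
    (k : Fin (I.dimV i.1)) : MemLp (fun x : I.Config α => I.φV i.1 (x i) k) 2
      (law (I.edgeBase θbar α) (I.edgeStat α) θ) := by
  have hS := isRegularMinimal_slice hI hreg θbar α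
  exact memLp_stat hS.measurable_stat hS.base_ne_zero hS.isOpen_fullDomain hθ ⟨i, k⟩

/-- The members of the slice compete in the supremum, with f_i = exp ⟨θ_i - θbar_{α,i}, φ_i⟩. -/
theorem norm_corrMatrix_le_weight (hI : I.IsInferenceFamily) (hreg : I.IsRegular)
    {θbar : I.ModelParams} {α : H.Edge}
    {η : (Σ i : {i : V // i ∈ α.1}, Fin (I.dimV i.1)) → ℝ}
    (hη : η ∈ meanParams (I.edgeBase θbar α) (I.edgeStat α)) (i j : {i : V // i ∈ α.1}) :
    ‖corrMatrix (law (I.edgeBase θbar α) (I.edgeStat α)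
      (natParam (I.edgeBase θbar α) (I.edgeStat α) η))
      (fun x => I.φV i.1 (x i)) (fun x => I.φV j.1 (x j))‖ ≤ I.weight θbar α i j := by
  have hS := isRegularMinimal_slice hI hreg θbar α
  have hθ := natParam_mem hS hη
  have hpos : ∀ i : {i : V // i ∈ α.1}, (covMatrix (law (I.edgeBase θbar α) (I.edgeStat α)
      (natParam (I.edgeBase θbar α) (I.edgeStat α) η))
      (fun x => I.φV i.1 (x i)) (fun x => I.φV i.1 (x i))).PosDef := fun i =>
    (hS.posDef_cov _ hθ).submatrix (e := fun k => (⟨i, k⟩ : Σ i : {i : V // i ∈ α.1},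
      Fin (I.dimV i.1))) fun k l h => by simpa using h
  refine le_csSup (bddAbove_corrNorms θbar α i j) ⟨fun i x => Real.exp ((fun k =>
    natParam (I.edgeBase θbar α) (I.edgeStat α) η ⟨i, k⟩ - θbar α (Sum.inr ⟨i, k⟩)) ⬝ᵥ
      I.φV i.1 x), fun i => measurable_exp (I.measurable_φV i.1) _, fun i x => Real.exp_pos _, ?_,
    law (I.edgeBase θbar α) (I.edgeStat α) (natParam (I.edgeBase θbar α) (I.edgeStat α) η), ?_,
    memLp_pi_iff.2 (memLp_edgeStat hI hreg hθ i), memLp_pi_iff.2 (memLp_edgeStat hI hreg hθ j),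
    hpos i, hpos j, rfl⟩
  · simp only [← exp_fullParam_eq]
    exact (mem_fullDomain_slice (measurable_stat α) _ _).1 hθ
  · simp only [← exp_fullParam_eq]
    exact law_slice (measurable_stat α) _ _

theorem abs_edgeCov_le (hI : I.IsInferenceFamily) (hreg : I.IsRegular)
    {θbar : I.ModelParams} {α : H.Edge}
    {η : (Σ i : {i : V // i ∈ α.1}, Fin (I.dimV i.1)) → ℝ}
    (hη : η ∈ meanParams (I.edgeBase θbar α) (I.edgeStat α)) (i j : {i : V // i ∈ α.1})
    (x : Fin (I.dimV i.1) → ℝ) (y : Fin (I.dimV j.1) → ℝ) :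
    |∑ k, ∑ l, x k * I.edgeCov θbar α η ⟨i, k⟩ ⟨j, l⟩ * y l| ≤ I.weight θbar α i j *
      √(x ⬝ᵥ I.vertexCov i.1 (fun k => η ⟨i, k⟩) *ᵥ x) *
      √(y ⬝ᵥ I.vertexCov j.1 (fun k => η ⟨j, k⟩) *ᵥ y) := by
  have hQ : ∀ i : {i : V // i ∈ α.1}, (I.vertexCov i.1 fun k => η ⟨i, k⟩).PosDef := by
    intro i
    have hS := isRegularMinimal_slice hI hreg θbar α
    have hθ := natParam_mem hS hη
    rw [← edgeCov_diag hI hreg hη i]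
    exact (hS.posDef_cov _ hθ).submatrix (e := fun k => (⟨i, k⟩ : Σ i : {i : V // i ∈ α.1},
      Fin (I.dimV i.1))) fun k l h => by simpa using h
  have h := abs_dotProduct_covMatrix_le (P := law (I.edgeBase θbar α) (I.edgeStat α)
      (natParam (I.edgeBase θbar α) (I.edgeStat α) η))
      (f := fun x => I.φV i.1 (x i)) (g := fun x => I.φV j.1 (x j))
      (by rw [edgeCov_diag hI hreg hη i]; exact hQ i)
      (by rw [edgeCov_diag hI hreg hη j]; exact hQ j) x y
  rw [edgeCov_diag hI hreg hη i, edgeCov_diag hI hreg hη j] at h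
  refine le_trans (le_of_eq ?_) (h.trans ?_)
  · congr 1
    simp only [dotProduct, Matrix.mulVec, Finset.mul_sum, mul_assoc]
    rfl
  · gcongr
    exact norm_corrMatrix_le_weight hI hreg hη i j

end InferenceData

/-! ### Strict convexity from a positive definite Hessian -/

section StrictConvexity

variable {E : Type*} [NormedAddCommGroup E] [NormedSpace ℝ E] {s : Set E} {f : E → ℝ}
  {f' : E → E →L[ℝ] ℝ} {f'' : E → E →L[ℝ] E →L[ℝ] ℝ}

theorem hasDerivAt_line (hf' : ∀ x ∈ s, HasFDerivAt f (f' x) x) (x v : E) {t : ℝ}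
    (ht : x + t • v ∈ s) : HasDerivAt (fun t : ℝ => f (x + t • v)) (f' (x + t • v) v) t := by
  have h1 : HasDerivAt (fun t : ℝ => x + t • v) v t := by
    simpa using ((hasDerivAt_id t).smul_const v).const_add x
  exact (hf' _ ht).comp_hasDerivAt t h1

theorem hasDerivAt_line_fderiv (hf'' : ∀ x ∈ s, HasFDerivAt f' (f'' x) x) (x v : E) {t : ℝ}
    (ht : x + t • v ∈ s) :
    HasDerivAt (fun t : ℝ => f' (x + t • v) v) (f'' (x + t • v) v v) t := by
  have h1 : HasDerivAt (fun t : ℝ => x + t • v) v t := by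
    simpa using ((hasDerivAt_id t).smul_const v).const_add x
  have h2 := (hf'' _ ht).comp_hasDerivAt t h1
  exact (ContinuousLinearMap.apply ℝ ℝ v).hasFDerivAt.comp_hasDerivAt t h2

/-- Both strict convexity and the uniqueness of critical points are read off from the directional
derivative along a segment. -/
theorem strictMonoOn_fderiv_line (hs : Convex ℝ s)
    (hf'' : ∀ x ∈ s, HasFDerivAt f' (f'' x) x)
    (hpos : ∀ x ∈ s, ∀ v, v ≠ 0 → 0 < f'' x v v) {x y : E} (hx : x ∈ s) (hy : y ∈ s)
    (hxy : x ≠ y) :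
    StrictMonoOn (fun t : ℝ => f' (x + t • (y - x)) (y - x)) (Set.Icc 0 1) := by
  have hmem : ∀ t ∈ Set.Icc (0 : ℝ) 1, x + t • (y - x) ∈ s := fun t ht =>
    hs.add_smul_sub_mem hx hy ht
  refine strictMonoOn_of_deriv_pos (convex_Icc 0 1) (fun t ht =>
    (hasDerivAt_line_fderiv hf'' x (y - x) (hmem t ht)).continuousAt.continuousWithinAt)
    fun t ht => ?_
  have ht' := interior_subset ht
  rw [(hasDerivAt_line_fderiv hf'' x (y - x) (hmem t ht')).deriv]
  exact hpos _ (hmem t ht') _ (sub_ne_zero.2 hxy.symm)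

theorem strictConvexOn_of_hessian_pos (hs : Convex ℝ s)
    (hf' : ∀ x ∈ s, HasFDerivAt f (f' x) x) (hf'' : ∀ x ∈ s, HasFDerivAt f' (f'' x) x)
    (hpos : ∀ x ∈ s, ∀ v, v ≠ 0 → 0 < f'' x v v) : StrictConvexOn ℝ s f := by
  refine ⟨hs, fun x hx y hy hxy a b ha hb hab => ?_⟩
  have hmem : ∀ t ∈ Set.Icc (0 : ℝ) 1, x + t • (y - x) ∈ s := fun t ht =>
    hs.add_smul_sub_mem hx hy ht
  have hcv : StrictConvexOn ℝ (Set.Icc (0 : ℝ) 1) (fun t : ℝ => f (x + t • (y - x))) := by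
    refine StrictMonoOn.strictConvexOn_of_deriv (convex_Icc 0 1) (fun t ht =>
      (hasDerivAt_line hf' x (y - x) (hmem t ht)).continuousAt.continuousWithinAt) ?_
    refine ((strictMonoOn_fderiv_line hs hf'' hpos hx hy hxy).mono interior_subset).congr
      fun t ht => ?_
    exact (hasDerivAt_line hf' x (y - x) (hmem t (interior_subset ht))).deriv.symm
  have h := hcv.2 (Set.left_mem_Icc.2 zero_le_one) (Set.right_mem_Icc.2 zero_le_one) zero_ne_one
    ha hb hab
  simp only [smul_eq_mul, mul_zero, mul_one, zero_add, zero_smul, add_zero, one_smul,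
    add_sub_cancel] at h
  have hpt : x + b • (y - x) = a • x + b • y := by
    rw [← eq_sub_iff_add_eq] at hab
    rw [hab, smul_sub, sub_smul, one_smul]
    abel
  rw [hpt] at h
  exact h

theorem eq_of_fderiv_eq_zero (hs : Convex ℝ s)
    (hf'' : ∀ x ∈ s, HasFDerivAt f' (f'' x) x)
    (hpos : ∀ x ∈ s, ∀ v, v ≠ 0 → 0 < f'' x v v) {x y : E} (hx : x ∈ s) (hy : y ∈ s)
    (hx0 : f' x = 0) (hy0 : f' y = 0) : x = y := by
  by_contra hxy
  have h := strictMonoOn_fderiv_line hs hf'' hpos hx hy hxy (Set.left_mem_Icc.2 zero_le_one)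
    (Set.right_mem_Icc.2 zero_le_one) zero_lt_one
  simp [hx0, hy0] at h

end StrictConvexity

/-! ### Gradient and Hessian of the restricted Bethe free energy -/

namespace FactorGraph

variable {V : Type*} [Fintype V] {κ : V → Type*} [∀ i, Fintype (κ i)]

/-- The standard inner product of vertex vectors. -/
noncomputable def pairing (κ : V → Type*) [∀ i, Fintype (κ i)] :
    (∀ i, κ i → ℝ) →L[ℝ] (∀ i, κ i → ℝ) →L[ℝ] ℝ :=
  LinearMap.toContinuousLinearMap ((LinearMap.toContinuousLinearMap
    (𝕜 := ℝ) (E := ∀ i, κ i → ℝ) (F' := ℝ)).toLinearMap ∘ₗ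
    LinearMap.mk₂ ℝ (fun z u : ∀ i, κ i → ℝ => ∑ i, z i ⬝ᵥ u i)
      (fun _ _ _ => by simp [add_dotProduct, Finset.sum_add_distrib])
      (fun _ _ _ => by simp [smul_dotProduct, Finset.mul_sum])
      (fun _ _ _ => by simp [dotProduct_add, Finset.sum_add_distrib])
      (fun _ _ _ => by simp [dotProduct_smul, Finset.mul_sum]))

theorem pairing_apply (z u : ∀ i, κ i → ℝ) : pairing κ z u = ∑ i, z i ⬝ᵥ u i := rfl

/-- Restriction of vertex vectors to a hyperedge as a continuous linear map. -/
def restrictEdgeCLM (H : FactorGraph V) (κ : V → Type*) (α : H.Edge) :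
    (∀ i, κ i → ℝ) →L[ℝ] ((Σ i : {i : V // i ∈ α.1}, κ i.1) → ℝ) where
  toFun := H.restrictEdge α
  map_add' _ _ := rfl
  map_smul' _ _ := rfl
  cont := by unfold restrictEdge; fun_prop

theorem restrictEdgeCLM_apply {H : FactorGraph V} (α : H.Edge) (v : ∀ i, κ i → ℝ) :
    restrictEdgeCLM H κ α v = H.restrictEdge α v := rfl

end FactorGraph

namespace InferenceData

open ExpFamily FactorGraph

variable {V : Type*} [Fintype V] [DecidableEq V] {H : FactorGraph V} {X : V → Type*}
  [∀ i, MeasurableSpace (X i)] {I : InferenceData H X}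

/-- The natural parameters at the vertices of `α` of the member of the subfamily of `α` with
expectation parameters `η`. -/
noncomputable abbrev edgeParam (θbar : I.ModelParams) (α : H.Edge)
    (η : ∀ i, Fin (I.dimV i) → ℝ) : (Σ i : {i : V // i ∈ α.1}, Fin (I.dimV i.1)) → ℝ :=
  natParam (I.edgeBase θbar α) (I.edgeStat α) (H.restrictEdge α η)

/-- The gradient of the restricted Bethe free energy. -/
noncomputable def gradBethe (θbar : I.ModelParams) (η : ∀ i, Fin (I.dimV i) → ℝ) :
    ∀ i, Fin (I.dimV i) → ℝ :=
  H.gather (fun α => edgeParam θbar α η - fun q => θbar α (Sum.inr q),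
    fun i => natParam (I.ν i) (I.φV i) (η i))

/-- The Hessian of the restricted Bethe free energy. -/
noncomputable def hessBethe (θbar : I.ModelParams) (η : ∀ i, Fin (I.dimV i) → ℝ) :
    (∀ i, Fin (I.dimV i) → ℝ) →L[ℝ] (∀ i, Fin (I.dimV i) → ℝ) :=
  (LinearMap.toContinuousLinearMap H.gather).comp
    ((ContinuousLinearMap.pi fun α => (mulVecCLM
      (I.edgeCov θbar α (H.restrictEdge α η))⁻¹).comp (restrictEdgeCLM H (fun i => Fin (I.dimV i)) α)).prod
    (ContinuousLinearMap.pi fun i => (mulVecCLM (I.vertexCov i (η i))⁻¹).comp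
      (ContinuousLinearMap.proj i)))

theorem hessBethe_apply (θbar : I.ModelParams) (η v : ∀ i, Fin (I.dimV i) → ℝ) :
    hessBethe θbar η v = betheOp (H := H) (fun α => I.edgeCov θbar α (H.restrictEdge α η))
      (fun i => I.vertexCov i (η i)) v := rfl

theorem hasFDerivAt_reducedBethe (hI : I.IsInferenceFamily) (hreg : I.IsRegular)
    {θbar : I.ModelParams} {η : ∀ i, Fin (I.dimV i) → ℝ} (hη : η ∈ I.restrictedDomain θbar) :
    HasFDerivAt (I.reducedBethe θbar) (pairing _ (gradBethe θbar η)) η := by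
  rw [mem_restrictedDomain_iff hI hreg] at hη
  have h1 : ∀ α : H.Edge, HasFDerivAt (fun η : ∀ i, Fin (I.dimV i) → ℝ =>
      legendre (I.edgeBase θbar α) (I.edgeStat α) (H.restrictEdge α η) -
        (fun q => θbar α (Sum.inr q)) ⬝ᵥ H.restrictEdge α η)
      ((dotCLM (edgeParam θbar α η)).comp (restrictEdgeCLM H (fun i => Fin (I.dimV i)) α) -
        (dotCLM fun q => θbar α (Sum.inr q)).comp (restrictEdgeCLM H (fun i => Fin (I.dimV i)) α)) η := by
    intro α
    refine ((hasFDerivAt_legendre (isRegularMinimal_slice hI hreg θbar α) (hη.2 α)).comp η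
      (restrictEdgeCLM H (fun i => Fin (I.dimV i)) α).hasFDerivAt).sub ?_
    refine (((dotCLM fun q => θbar α (Sum.inr q)).comp
      (restrictEdgeCLM H (fun i => Fin (I.dimV i)) α)).hasFDerivAt).congr_of_eventuallyEq
      (Filter.Eventually.of_forall fun v => ?_)
    simp only [ContinuousLinearMap.comp_apply, dotCLM_apply, restrictEdgeCLM_apply]
  have h2 : ∀ i, HasFDerivAt (fun η : ∀ i, Fin (I.dimV i) → ℝ =>
      (1 - (H.degree i : ℝ)) * legendre (I.ν i) (I.φV i) (η i))
      ((1 - (H.degree i : ℝ)) • (dotCLM (natParam (I.ν i) (I.φV i) (η i))).comp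
        (ContinuousLinearMap.proj i)) η := fun i =>
    ((hasFDerivAt_legendre (isRegularMinimal_vertex hI hreg i) (hη.1 i)).comp η
      (ContinuousLinearMap.proj (R := ℝ) (φ := fun i => Fin (I.dimV i) → ℝ) i).hasFDerivAt).const_mul _
  have h3 := (HasFDerivAt.fun_sum fun α (_ : α ∈ Finset.univ) => h1 α).add
    (HasFDerivAt.fun_sum fun i (_ : i ∈ Finset.univ) => h2 i)
  refine h3.congr_fderiv ?_
  ext v
  rw [pairing_apply, gradBethe, sum_gather_dotProduct]
  simp only [add_apply, sum_apply, sub_apply, smul_apply, ContinuousLinearMap.comp_apply,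
    dotCLM_apply, smul_eq_mul, restrictEdgeCLM_apply, ContinuousLinearMap.proj_apply,
    sub_dotProduct]

theorem hasStrictFDerivAt_gradBethe (hI : I.IsInferenceFamily) (hreg : I.IsRegular)
    {θbar : I.ModelParams} {η : ∀ i, Fin (I.dimV i) → ℝ} (hη : η ∈ I.restrictedDomain θbar) :
    HasStrictFDerivAt (I.gradBethe θbar) (hessBethe θbar η) η := by
  rw [mem_restrictedDomain_iff hI hreg] at hη
  have h1 : ∀ α : H.Edge, HasStrictFDerivAt
      (fun η => edgeParam θbar α η - fun q => θbar α (Sum.inr q))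
      ((mulVecCLM (I.edgeCov θbar α (H.restrictEdge α η))⁻¹).comp
        (restrictEdgeCLM H (fun i => Fin (I.dimV i)) α)) η := fun α =>
    ((hasStrictFDerivAt_natParam (isRegularMinimal_slice hI hreg θbar α) (hη.2 α)).comp η
      (restrictEdgeCLM H (fun i => Fin (I.dimV i)) α).hasStrictFDerivAt).sub_const _
  have h2 : ∀ i, HasStrictFDerivAt
      (fun η : ∀ i, Fin (I.dimV i) → ℝ => natParam (I.ν i) (I.φV i) (η i))
      ((mulVecCLM (I.vertexCov i (η i))⁻¹).comp (ContinuousLinearMap.proj i)) η := fun i =>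
    (hasStrictFDerivAt_natParam (isRegularMinimal_vertex hI hreg i) (hη.1 i)).comp η
      (ContinuousLinearMap.proj (R := ℝ) (φ := fun i => Fin (I.dimV i) → ℝ) i).hasStrictFDerivAt
  have h3 := (hasStrictFDerivAt_pi.2 h1).prodMk (hasStrictFDerivAt_pi.2 h2)
  exact (LinearMap.toContinuousLinearMap H.gather).hasStrictFDerivAt.comp η h3

theorem pairing_hessBethe_pos (hI : I.IsInferenceFamily) (hreg : I.IsRegular)
    {θbar : I.ModelParams}
    (hW : spectralRadius ℂ ((H.dirEdgeMatrix (I.weight θbar)).map (algebraMap ℝ ℂ)) < 1)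
    {η : ∀ i, Fin (I.dimV i) → ℝ} (hη : η ∈ I.restrictedDomain θbar)
    (v : ∀ i, Fin (I.dimV i) → ℝ) (hv : v ≠ 0) :
    0 < pairing _ (hessBethe θbar η v) v := by
  rw [mem_restrictedDomain_iff hI hreg] at hη
  rw [pairing_apply, hessBethe_apply, ← betheForm_eq_sum]
  refine betheForm_pos _ _ (I.weight θbar) (weight_nonneg θbar) hW (fun i => ?_) (fun α => ?_)
    (fun α i k l => ?_) (fun α i j _ x y => ?_) v hv
  · have hE := isRegularMinimal_vertex hI hreg i
    exact hE.posDef_cov _ (natParam_mem hE (hη.1 i))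
  · have hE := isRegularMinimal_slice hI hreg θbar α
    exact hE.posDef_cov _ (natParam_mem hE (hη.2 α))
  · exact congrFun (congrFun (edgeCov_diag hI hreg (hη.2 α) i) k) l
  · exact abs_edgeCov_le hI hreg (hη.2 α) i j x y

theorem strictConvexOn_restrictedBethe (hI : I.IsInferenceFamily) (hreg : I.IsRegular)
    {θbar : I.ModelParams}
    (hW : spectralRadius ℂ ((H.dirEdgeMatrix (I.weight θbar)).map (algebraMap ℝ ℂ)) < 1) :
    StrictConvexOn ℝ (I.restrictedDomain θbar) (I.restrictedBethe θbar) := by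
  have h : StrictConvexOn ℝ (I.restrictedDomain θbar) (I.reducedBethe θbar) :=
    strictConvexOn_of_hessian_pos (convex_restrictedDomain hI hreg θbar)
      (f'' := fun η => (pairing _).comp (hessBethe θbar η))
      (fun η hη => hasFDerivAt_reducedBethe hI hreg hη)
      (fun η hη => (pairing _).hasFDerivAt.comp η
        (hasStrictFDerivAt_gradBethe hI hreg hη).hasFDerivAt)
      (fun η hη v hv => pairing_hessBethe_pos hI hreg hW hη v hv)
  exact h.congr fun η hη => (restrictedBethe_eq hI hreg θbar hη).symm

theorem eq_of_gradBethe_eq_zero (hI : I.IsInferenceFamily) (hreg : I.IsRegular)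
    {θbar : I.ModelParams}
    (hW : spectralRadius ℂ ((H.dirEdgeMatrix (I.weight θbar)).map (algebraMap ℝ ℂ)) < 1)
    {η η' : ∀ i, Fin (I.dimV i) → ℝ} (hη : η ∈ I.restrictedDomain θbar)
    (hη' : η' ∈ I.restrictedDomain θbar) (h0 : gradBethe θbar η = 0)
    (h0' : gradBethe θbar η' = 0) : η = η' :=
  eq_of_fderiv_eq_zero (convex_restrictedDomain hI hreg θbar)
    (f' := fun η => pairing _ (gradBethe θbar η))
    (f'' := fun η => (pairing _).comp (hessBethe θbar η))
    (fun η hη => (pairing _).hasFDerivAt.comp η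
      (hasStrictFDerivAt_gradBethe hI hreg hη).hasFDerivAt)
    (fun η hη v hv => pairing_hessBethe_pos hI hreg hW hη v hv) hη hη'
    (by rw [h0, map_zero]) (by rw [h0', map_zero])

end InferenceData

/-! ### One-coordinate marginals of densities on product spaces -/

section PiSplit

variable {ι : Type*} [DecidableEq ι] {X : ι → Type*} (i : ι)

theorem piSplitAt_symm_self (p : X i × ∀ j : {j // j ≠ i}, X j) :
    (Equiv.piSplitAt i X).symm p i = p.1 := by
  simp [Equiv.piSplitAt]

theorem piSplitAt_symm_ne (p : X i × ∀ j : {j // j ≠ i}, X j) (j : {j // j ≠ i}) :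
    (Equiv.piSplitAt i X).symm p j = p.2 j := by
  simp [Equiv.piSplitAt, j.2]

theorem prod_piSplitAt_symm [Fintype ι] [Fintype {j // j ≠ i}] (h : ∀ j, X j → ℝ)
    (p : X i × ∀ j : {j // j ≠ i}, X j) :
    ∏ j, h j ((Equiv.piSplitAt i X).symm p j) = h i p.1 * ∏ j : {j // j ≠ i}, h j (p.2 j) := by
  rw [Fintype.prod_eq_mul_prod_subtype_ne _ i, piSplitAt_symm_self]
  congr 1
  simp only [piSplitAt_symm_ne]
  exact Finset.prod_congr (by ext; simp) fun _ _ => rfl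

variable [∀ j, MeasurableSpace (X j)]

theorem measurable_piSplitAt_symm : Measurable (Equiv.piSplitAt i X).symm := by
  refine measurable_pi_lambda _ fun j => ?_
  by_cases h : j = i
  · subst h
    simpa only [piSplitAt_symm_self] using measurable_fst
  · have := fun p => piSplitAt_symm_ne (X := X) i p ⟨j, h⟩
    simp only at this
    simp only [this]
    exact (measurable_pi_apply _).comp measurable_snd

variable [Fintype ι] [Fintype {j // j ≠ i}] (ν : ∀ j, Measure (X j)) [∀ j, SigmaFinite (ν j)]

theorem measurePreserving_piSplitAt_symm :
    MeasurePreserving (Equiv.piSplitAt i X).symm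
      ((ν i).prod (Measure.pi fun j : {j // j ≠ i} => ν j)) (Measure.pi ν) := by
  refine ⟨measurable_piSplitAt_symm i, (Measure.pi_eq fun s hs => ?_).symm⟩
  have h : (Equiv.piSplitAt i X).symm ⁻¹' Set.univ.pi s =
      s i ×ˢ Set.univ.pi fun j : {j // j ≠ i} => s j := by
    ext p
    simp only [Set.mem_preimage, Set.mem_pi, Set.mem_univ, true_implies, Set.mem_prod]
    constructor
    · intro hp
      refine ⟨by simpa only [piSplitAt_symm_self] using hp i, fun j => ?_⟩
      simpa only [piSplitAt_symm_ne] using hp j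
    · rintro ⟨h1, h2⟩ j
      by_cases hj : j = i
      · subst hj
        rwa [piSplitAt_symm_self]
      · have := h2 ⟨j, hj⟩
        rwa [← piSplitAt_symm_ne] at this
  rw [Measure.map_apply (measurable_piSplitAt_symm i) (MeasurableSet.univ_pi hs), h,
    Measure.prod_prod, Measure.pi_pi, Fintype.prod_eq_mul_prod_subtype_ne _ i]
  congr 1
  exact Finset.prod_congr (by ext; simp) fun _ _ => rfl

theorem map_eval_withDensity_pi {g : (∀ j, X j) → ENNReal} (hg : Measurable g) :
    ((Measure.pi ν).withDensity g).map (fun x => x i) = (ν i).withDensity fun x =>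
      ∫⁻ y, g ((Equiv.piSplitAt i X).symm (x, y)) ∂(Measure.pi fun j : {j // j ≠ i} => ν j) := by
  ext s hs
  have hs' : MeasurableSet ((fun x : ∀ j, X j => x i) ⁻¹' s) := measurable_pi_apply i hs
  rw [Measure.map_apply (measurable_pi_apply i) hs, withDensity_apply _ hs',
    withDensity_apply _ hs, ← (measurePreserving_piSplitAt_symm i ν).setLIntegral_comp_preimage hs' hg]
  have h : (Equiv.piSplitAt i X).symm ⁻¹' ((fun x : ∀ j, X j => x i) ⁻¹' s) =
      s ×ˢ (Set.univ : Set (∀ j : {j // j ≠ i}, X j)) := by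
    ext p
    simp only [Set.mem_preimage, piSplitAt_symm_self, Set.mem_prod, Set.mem_univ, and_true]
  have h1 := setLIntegral_prod (μ := ν i) (ν := Measure.pi fun j : {j // j ≠ i} => ν j) (s := s)
    (t := Set.univ) (fun p => g ((Equiv.piSplitAt i X).symm p))
    (hg.comp (measurable_piSplitAt_symm i)).aemeasurable
  rw [h, h1]
  simp only [Measure.restrict_univ]

/-- A one-coordinate marginal of a law on a product space with unnormalized density `g` has the
unnormalized density `h` if and only if `h` is proportional to the partial integrals of `g`. -/
theorem map_eval_normalizedLaw_eq_iff {g : (∀ j, X j) → ℝ} {h : X i → ℝ}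
    (hν : ∀ j, ν j ≠ 0) (hgm : Measurable g) (hg : ∀ x, 0 < g x) (hgi : Integrable g (Measure.pi ν))
    (hhm : Measurable h) (hh : ∀ x, 0 < h x) (hhi : Integrable h (ν i)) :
    (normalizedLaw (Measure.pi ν) g).map (fun x => x i) = normalizedLaw (ν i) h ↔
      ∃ ω : ℝ, 0 < ω ∧ ∀ᵐ x ∂(ν i), h x = ω * ∫ y, g ((Equiv.piSplitAt i X).symm (x, y))
        ∂(Measure.pi fun j : {j // j ≠ i} => ν j) := by
  have hpi : Measure.pi ν ≠ 0 := by
    rw [← Measure.measure_univ_ne_zero, Measure.pi_univ]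
    exact Finset.prod_ne_zero_iff.2 fun j _ => Measure.measure_univ_ne_zero.2 (hν j)
  have hZ := integral_pos_of_pos hpi hg hgi
  have hZh := integral_pos_of_pos (hν i) hh hhi
  have hP := isProbabilityMeasure_normalizedLaw (fun x => (hg x).le) hgi hZ
  have hPh := isProbabilityMeasure_normalizedLaw (fun x => (hh x).le) hhi hZh
  set Z := ∫ x, g x ∂(Measure.pi ν) with hZdef
  set Zh := ∫ x, h x ∂(ν i) with hZhdef
  have hsm : Measurable fun p : X i × (∀ j : {j // j ≠ i}, X j) =>
      g ((Equiv.piSplitAt i X).symm p) := hgm.comp (measurable_piSplitAt_symm i)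
  set G : X i → ENNReal := fun x => ∫⁻ y, ENNReal.ofReal (g ((Equiv.piSplitAt i X).symm (x, y)))
    ∂(Measure.pi fun j : {j // j ≠ i} => ν j) with hG
  have hGm : Measurable G := hsm.ennreal_ofReal.lintegral_prod_right'
  have hmap : (normalizedLaw (Measure.pi ν) g).map (fun x => x i) =
      (ν i).withDensity fun x => ENNReal.ofReal Z⁻¹ * G x := by
    rw [normalizedLaw, map_eval_withDensity_pi i ν (hgm.div_const _).ennreal_ofReal]
    congr 1
    funext x
    rw [hG, ← lintegral_const_mul' _ _ ENNReal.ofReal_ne_top]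
    refine lintegral_congr fun y => ?_
    rw [← ENNReal.ofReal_mul (inv_nonneg.2 hZ.le), div_eq_inv_mul]
  have hinteg : ∀ x, ∫ y, g ((Equiv.piSplitAt i X).symm (x, y))
      ∂(Measure.pi fun j : {j // j ≠ i} => ν j) = (G x).toReal := fun x =>
    integral_eq_lintegral_of_nonneg_ae (Filter.Eventually.of_forall fun y => (hg _).le)
      (hsm.comp measurable_prodMk_left).aestronglyMeasurable
  simp only [hinteg]
  constructor
  · intro heq
    rw [hmap, normalizedLaw, withDensity_eq_iff_of_sigmaFinite
      (hGm.const_mul _).aemeasurable (hhm.div_const _).ennreal_ofReal.aemeasurable] at heq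
    -- The constant is the ratio of the two normalizing constants.
    refine ⟨Zh / Z, div_pos hZh hZ, ?_⟩
    filter_upwards [heq] with x hx
    have := congrArg ENNReal.toReal hx
    rw [ENNReal.toReal_mul, ENNReal.toReal_ofReal (inv_nonneg.2 hZ.le),
      ENNReal.toReal_ofReal (div_nonneg (hh x).le hZh.le)] at this
    rw [div_mul_eq_mul_div, mul_div_assoc, div_eq_inv_mul _ Z, this]
    field_simp
  · rintro ⟨ω, hω, hae⟩
    have hmap' : (normalizedLaw (Measure.pi ν) g).map (fun x => x i) =
        (ν i).withDensity fun x => ENNReal.ofReal (Z⁻¹ * ω⁻¹ * h x) := by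
      rw [hmap]
      refine withDensity_congr_ae ?_
      filter_upwards [hae] with x hx
      -- A divergent partial integral has `toReal` equal to 0, which would contradict h x > 0.
      have hne : G x ≠ ⊤ := by
        intro h0
        have := hh x
        simp [hx, h0] at this
      rw [hx, mul_assoc, inv_mul_cancel_left₀ hω.ne', ENNReal.ofReal_mul (inv_nonneg.2 hZ.le),
        ENNReal.ofReal_toReal hne]
    -- The marginal has total mass 1, which forces ω = Zh / Z.
    have h1 : Z⁻¹ * ω⁻¹ * Zh = 1 := by
      have hprob : IsProbabilityMeasure ((normalizedLaw (Measure.pi ν) g).map (fun x => x i)) :=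
        Measure.isProbabilityMeasure_map (measurable_pi_apply i).aemeasurable
      have h2 := hprob.measure_univ
      have hc : 0 ≤ Z⁻¹ * ω⁻¹ := by positivity
      rw [hmap', withDensity_apply _ MeasurableSet.univ, Measure.restrict_univ,
        ← ofReal_integral_eq_lintegral_ofReal (hhi.const_mul _)
          (Filter.Eventually.of_forall fun x => mul_nonneg hc (hh x).le), integral_const_mul,
        ENNReal.ofReal_eq_one] at h2
      exact h2
    rw [hmap', normalizedLaw]
    congr 1
    funext x
    congr 1
    rw [← hZhdef, eq_div_iff hZh.ne', mul_right_comm, h1, one_mul]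

end PiSplit

/-! ### Fixed points of loopy belief propagation in terms of natural parameters -/

theorem Fintype.sum_subtype_eq_sum_dite {ι M : Type*} [Fintype ι] [AddCommMonoid M] {p : ι → Prop}
    [DecidablePred p] [Fintype {x // p x}] (f : {x // p x} → M) :
    ∑ x, f x = ∑ x, if h : p x then f ⟨x, h⟩ else 0 := by
  rw [← Finset.sum_subset (Finset.subset_univ (Finset.univ.filter p)) fun x _ hx => by
    simpa using fun h => (hx (by simpa using h)).elim]
  rw [Finset.sum_subtype (p := p) _ (by simp)]
  exact Finset.sum_congr rfl fun x _ => by rw [dif_pos x.2]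

theorem Finset.prod_exp_dotProduct {ι κ : Type*} [Fintype κ] (s : Finset ι) (m : ι → κ → ℝ)
    (y : κ → ℝ) : ∏ β ∈ s, Real.exp (m β ⬝ᵥ y) = Real.exp ((∑ β ∈ s, m β) ⬝ᵥ y) := by
  rw [← Real.exp_sum, sum_dotProduct]

namespace InferenceData

open ExpFamily

variable {V : Type*} {H : FactorGraph V} {X : V → Type*} [∀ i, MeasurableSpace (X i)]
  {I : InferenceData H X}

open Classical in
/-- The natural parameter of the product of the messages to `j` from hyperedges other than `α`. -/
noncomputable def cavParam (μ : I.Messages) (α : H.Edge) (j : V) : Fin (I.dimV j) → ℝ :=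
  ∑ β : H.Edge, if h : j ∈ β.1 ∧ β ≠ α then μ ⟨β, ⟨j, h.1⟩⟩ else 0

open Classical in
/-- The natural parameter of the belief of the vertex `i`. -/
noncomputable def vertexParam (μ : I.Messages) (i : V) : Fin (I.dimV i) → ℝ :=
  ∑ β : H.Edge, if h : i ∈ β.1 then μ ⟨β, ⟨i, h⟩⟩ else 0

/-- The natural parameters at the vertices of `α` of the belief of `α`. -/
noncomputable def beliefParam (θbar : I.ModelParams) (μ : I.Messages) (α : H.Edge) :
    (Σ i : {i : V // i ∈ α.1}, Fin (I.dimV i.1)) → ℝ :=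
  fun q => θbar α (Sum.inr q) + cavParam μ α q.1.1 q.2

theorem cavity_eq_exp (μ : I.Messages) (α : H.Edge) (j : V) (x : X j) :
    I.cavity μ α j x = Real.exp (cavParam μ α j ⬝ᵥ I.φV j x) := by
  classical
  refine (Finset.prod_exp_dotProduct Finset.univ (fun β : {β : H.Edge // j ∈ β.1 ∧ β ≠ α} =>
    (μ ⟨β.1, ⟨j, β.2.1⟩⟩ : Fin (I.dimV j) → ℝ)) (I.φV j x)).trans ?_
  rw [cavParam, Fintype.sum_subtype_eq_sum_dite]

theorem beliefV_eq_exp (μ : I.Messages) (i : V) (x : X i) :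
    I.beliefV μ i x = Real.exp (vertexParam μ i ⬝ᵥ I.φV i x) := by
  classical
  refine (Finset.prod_exp_dotProduct Finset.univ (fun β : {β : H.Edge // i ∈ β.1} =>
    (μ ⟨β.1, ⟨i, β.2⟩⟩ : Fin (I.dimV i) → ℝ)) (I.φV i x)).trans ?_
  rw [vertexParam, Fintype.sum_subtype_eq_sum_dite]

theorem beliefF_eq_exp (θbar : I.ModelParams) (μ : I.Messages) (α : H.Edge) (x : I.Config α) :
    I.beliefF θbar μ α x =
      Real.exp (fullParam θbar α (beliefParam θbar μ α) ⬝ᵥ I.stat α x) := by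
  rw [exp_fullParam_eq, beliefF]
  simp only [cavity_eq_exp, beliefParam, add_sub_cancel_left]

theorem vertexParam_eq_add (μ : I.Messages) (α : H.Edge) (i : {i : V // i ∈ α.1}) :
    vertexParam μ i.1 = μ ⟨α, i⟩ + cavParam μ α i.1 := by
  classical
  rw [vertexParam, cavParam, ← Finset.add_sum_erase _ _ (Finset.mem_univ α), dif_pos i.2]
  congr 1
  refine Eq.trans ?_ (Finset.sum_erase (a := α) Finset.univ (dif_neg fun h => h.2 rfl))
  refine Finset.sum_congr rfl fun β hβ => ?_
  have hne := Finset.ne_of_mem_erase hβ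
  by_cases h : i.1 ∈ β.1
  · rw [dif_pos h, dif_pos ⟨h, hne⟩]
  · rw [dif_neg h, dif_neg fun h' => h h'.1]

theorem cavity_pos (μ : I.Messages) (α : H.Edge) (j : V) (x : X j) : 0 < I.cavity μ α j x := by
  rw [cavity_eq_exp]
  exact Real.exp_pos _

theorem beliefV_eq_mul (μ : I.Messages) (α : H.Edge) (i : {i : V // i ∈ α.1}) (x : X i.1) :
    I.beliefV μ i.1 x = I.msg μ ⟨α, i⟩ x * I.cavity μ α i.1 x := by
  rw [beliefV_eq_exp, cavity_eq_exp, msg, ← Real.exp_add, vertexParam_eq_add μ α i, add_dotProduct]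

open Classical in
-- Both sides of the message equation are multiplied by the cavity product at i. It is positive and
-- independent of the integration variable, and it completes the message to the vertex belief and
-- the integrand to the hyperedge belief.
theorem isUpdate_iff (θbar : I.ModelParams) (μ : I.Messages) :
    I.IsUpdate θbar μ μ ↔ ∀ (α : H.Edge) (i : {i : V // i ∈ α.1}), ∃ ω : ℝ, 0 < ω ∧
      ∀ᵐ x ∂(I.ν i.1), I.beliefV μ i.1 x =
        ω * ∫ y : (∀ j : {j : {i : V // i ∈ α.1} // j ≠ i}, X j.1.1), I.beliefF θbar μ α
          ((Equiv.piSplitAt i fun k : {i : V // i ∈ α.1} => X k.1).symm (x, y))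
          ∂(Measure.pi fun j => I.ν j.1.1) := by
  refine forall_congr' fun α => forall_congr' fun i => exists_congr fun ω =>
    and_congr_right fun _ => ?_
  refine Filter.eventually_congr (Filter.Eventually.of_forall fun x => ?_)
  rw [beliefV_eq_mul μ α i]
  have h : ∀ y : (∀ j : {j : {i : V // i ∈ α.1} // j ≠ i}, X j.1.1), I.beliefF θbar μ α
      ((Equiv.piSplitAt i fun k : {i : V // i ∈ α.1} => X k.1).symm (x, y)) =
      (I.compat θbar α ((Equiv.piSplitAt i fun k : {i : V // i ∈ α.1} => X k.1).symm (x, y)) *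
          ∏ j, I.cavity μ α j.1.1 (y j)) * I.cavity μ α i.1 x := by
    intro y
    rw [beliefF, prod_piSplitAt_symm i (X := fun k : {i : V // i ∈ α.1} => X k.1)
      (fun j => I.cavity μ α j.1)]
    ring
  simp only [h]
  rw [integral_mul_const, ← mul_assoc, mul_left_inj' (cavity_pos μ α i.1 x).ne']

/-- All beliefs are unnormalized exponential family densities, so proportionality to the partial
integrals becomes an equality of marginal laws. -/
theorem isFixedPoint_iff (θbar : I.ModelParams) (μ : I.Messages) :
    I.IsFixedPoint θbar μ ↔ (∀ i, vertexParam μ i ∈ fullDomain (I.ν i) (I.φV i)) ∧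
      (∀ α, fullParam θbar α (beliefParam θbar μ α) ∈ fullDomain (I.νF α) (I.stat α)) ∧
      ∀ (α : H.Edge) (i : {i : V // i ∈ α.1}),
        (law (I.νF α) (I.stat α) (fullParam θbar α (beliefParam θbar μ α))).map (fun x => x i) =
          law (I.ν i.1) (I.φV i.1) (vertexParam μ i.1) := by
  classical
  rw [IsFixedPoint, isUpdate_iff, and_comm, and_assoc]
  simp only [funext (beliefV_eq_exp μ _), funext (beliefF_eq_exp θbar μ _)]
  refine and_congr_right fun h1 => and_congr_right fun h2 =>
    forall_congr' fun α => forall_congr' fun i => ?_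
  exact (map_eval_normalizedLaw_eq_iff i (fun j : {i : V // i ∈ α.1} => I.ν j.1)
    (fun j => I.ν_ne_zero j.1) (measurable_exp (measurable_stat α) _) (fun _ => Real.exp_pos _)
    (h2 α) (measurable_exp (I.measurable_φV i.1) _) (fun _ => Real.exp_pos _) (h1 i.1)).symm

end InferenceData

/-! ### Fixed points of loopy belief propagation and stationary points -/

namespace InferenceData

open ExpFamily FactorGraph

variable {V : Type*} [Fintype V] [DecidableEq V] {H : FactorGraph V} {X : V → Type*}
  [∀ i, MeasurableSpace (X i)] {I : InferenceData H X}

/-- The messages attached to a point of the domain of the restricted Bethe free energy. -/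
noncomputable def pointMessages (θbar : I.ModelParams) (η : ∀ i, Fin (I.dimV i) → ℝ) :
    I.Messages :=
  fun e k => natParam (I.ν e.2.1) (I.φV e.2.1) (η e.2.1) k - edgeParam θbar e.1 η ⟨e.2, k⟩ +
    θbar e.1 (Sum.inr ⟨e.2, k⟩)

/-- Each of the d_i hyperedges at i contributes θ_i - μ_{α→i}, and the weight 1 - d_i leaves a
single θ_i. -/
theorem gradBethe_eq_sub (θbar : I.ModelParams) (η : ∀ i, Fin (I.dimV i) → ℝ) (i : V) :
    gradBethe θbar η i =
      natParam (I.ν i) (I.φV i) (η i) - vertexParam (pointMessages θbar η) i := by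
  funext k
  have h : ∀ α : H.Edge, (if h : i ∈ α.1 then
        (edgeParam θbar α η - fun q => θbar α (Sum.inr q)) ⟨⟨i, h⟩, k⟩ else 0) =
      (if i ∈ α.1 then 1 else 0) * natParam (I.ν i) (I.φV i) (η i) k -
        if h : i ∈ α.1 then pointMessages θbar η ⟨α, ⟨i, h⟩⟩ k else 0 := by
    intro α
    by_cases h : i ∈ α.1
    · simp only [h, dif_pos, if_true, pointMessages, Pi.sub_apply]
      ring
    · simp [h]
  have h2 : vertexParam (pointMessages θbar η) i k =
      ∑ α : H.Edge, if h : i ∈ α.1 then pointMessages θbar η ⟨α, ⟨i, h⟩⟩ k else 0 := by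
    rw [vertexParam, Finset.sum_apply]
    refine Finset.sum_congr rfl fun α _ => ?_
    by_cases h : i ∈ α.1 <;> simp [h]
  rw [Pi.sub_apply, h2, gradBethe]
  simp only [gather, LinearMap.coe_mk, AddHom.coe_mk, h, Finset.sum_sub_distrib, ← Finset.sum_mul]
  rw [degree_eq_sum]
  ring

/-- Consistent marginals give the beliefs common means η. Injectivity of the mean maps recovers the
belief parameters from η, and the messages are differences of these. Hence different fixed points
give different stationary points. -/
theorem exists_stationary_of_isFixedPoint (hI : I.IsInferenceFamily) (hreg : I.IsRegular)
    {θbar : I.ModelParams} {μ : I.Messages} (hμ : I.IsFixedPoint θbar μ) :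
    ∃ η ∈ I.restrictedDomain θbar, gradBethe θbar η = 0 ∧ pointMessages θbar η = μ := by
  obtain ⟨h1, h2, h3⟩ := (isFixedPoint_iff θbar μ).1 hμ
  have hV := isRegularMinimal_vertex hI hreg
  have hS := isRegularMinimal_slice hI hreg θbar
  set η : ∀ i, Fin (I.dimV i) → ℝ := fun i => meanMap (I.ν i) (I.φV i) (vertexParam μ i) with hη
  have hnat : ∀ i, natParam (I.ν i) (I.φV i) (η i) = vertexParam μ i := fun i =>
    natParam_meanMap (hV i) (h1 i)
  have hdom : ∀ α, beliefParam θbar μ α ∈ fullDomain (I.edgeBase θbar α) (I.edgeStat α) :=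
    fun α => (mem_fullDomain_slice (measurable_stat α) _ _).2 (h2 α)
  have hrestr : ∀ α, H.restrictEdge α η =
      meanMap (I.edgeBase θbar α) (I.edgeStat α) (beliefParam θbar μ α) := by
    intro α
    funext q
    rw [meanMap_slice (measurable_stat α)]
    change meanMap (I.ν q.1.1) (I.φV q.1.1) (vertexParam μ q.1.1) q.2 = _
    rw [meanMap, ← h3 α q.1, integral_map (measurable_pi_apply q.1).aemeasurable
      ((measurable_pi_apply q.2).comp (I.measurable_φV q.1.1)).aestronglyMeasurable]
    rfl
  have hedge : ∀ α, edgeParam θbar α η = beliefParam θbar μ α := fun α => by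
    rw [edgeParam, hrestr, natParam_meanMap (hS α) (hdom α)]
  have hmsg : pointMessages θbar η = μ := by
    funext e k
    rw [pointMessages, hnat, hedge, vertexParam_eq_add μ e.1 e.2, beliefParam, Pi.add_apply]
    ring
  refine ⟨η, (mem_restrictedDomain_iff hI hreg θbar η).2 ⟨fun i => meanMap_mem (hV i) (h1 i),
    fun α => ?_⟩, ?_, hmsg⟩
  · rw [hrestr]
    exact meanMap_mem (hS α) (hdom α)
  · funext i
    rw [gradBethe_eq_sub, hmsg, hnat, sub_self]
    rfl

/-- At a zero of the gradient the belief parameters built from these messages are those of the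
vertex and slice members with means η. The marginalisation hypothesis then makes the beliefs
consistent. -/
theorem isFixedPoint_pointMessages (hI : I.IsInferenceFamily) (hreg : I.IsRegular)
    {θbar : I.ModelParams} {η : ∀ i, Fin (I.dimV i) → ℝ} (hη : η ∈ I.restrictedDomain θbar)
    (h0 : gradBethe θbar η = 0) : I.IsFixedPoint θbar (pointMessages θbar η) := by
  rw [mem_restrictedDomain_iff hI hreg] at hη
  have hvert : ∀ i, vertexParam (pointMessages θbar η) i = natParam (I.ν i) (I.φV i) (η i) := by
    intro i
    have := gradBethe_eq_sub θbar η i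
    rw [h0] at this
    exact (sub_eq_zero.1 this.symm).symm
  have hbel : ∀ α, beliefParam θbar (pointMessages θbar η) α = edgeParam θbar α η := by
    intro α
    funext q
    have h := congrFun (vertexParam_eq_add (pointMessages θbar η) α q.1) q.2
    rw [hvert, Pi.add_apply, pointMessages] at h
    rw [beliefParam]
    change _ = edgeParam θbar α η ⟨q.1, q.2⟩
    linarith
  refine (isFixedPoint_iff θbar _).2 ⟨fun i => ?_, fun α => ?_, fun α i => ?_⟩
  · rw [hvert]
    exact natParam_mem (isRegularMinimal_vertex hI hreg i) (hη.1 i)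
  · rw [hbel, ← mem_fullDomain_slice (measurable_stat α)]
    exact natParam_mem (isRegularMinimal_slice hI hreg θbar α) (hη.2 α)
  · rw [hbel, hvert, ← law_slice (measurable_stat α), map_law_slice hI hreg (hη.2 α) i]
    rfl

theorem subsingleton_fixedPoints (hI : I.IsInferenceFamily) (hreg : I.IsRegular)
    {θbar : I.ModelParams}
    (hW : spectralRadius ℂ ((H.dirEdgeMatrix (I.weight θbar)).map (algebraMap ℝ ℂ)) < 1) :
    {μ : I.Messages | I.IsFixedPoint θbar μ}.Subsingleton := by
  intro μ hμ μ' hμ'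
  obtain ⟨η, hη, h0, rfl⟩ := exists_stationary_of_isFixedPoint hI hreg hμ
  obtain ⟨η', hη', h0', rfl⟩ := exists_stationary_of_isFixedPoint hI hreg hμ'
  rw [eq_of_gradBethe_eq_zero hI hreg hW hη hη' h0 h0']

end InferenceData

/-! ### Exponential families on finite spaces -/

theorem Matrix.PosDef.exists_norm_le {m : Type*} [Fintype m] {Q : Matrix m m ℝ}
    (hQ : Q.PosDef) : ∃ C, 0 ≤ C ∧ ∀ u : m → ℝ, ‖u‖ ≤ C * √(u ⬝ᵥ Q *ᵥ u) := by
  classical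
  set L : EuclideanSpace ℝ m →L[ℝ] (m → ℝ) :=
    (ExpFamily.mulVecCLM (CFC.sqrt Q)⁻¹).comp
      (EuclideanSpace.equiv m ℝ : EuclideanSpace ℝ m →L[ℝ] (m → ℝ)) with hL
  refine ⟨‖L‖, norm_nonneg _, fun u => ?_⟩
  have h : L (WithLp.toLp 2 (CFC.sqrt Q *ᵥ u)) = u := by
    change (CFC.sqrt Q)⁻¹ *ᵥ (CFC.sqrt Q *ᵥ u) = u
    rw [Matrix.mulVec_mulVec, Matrix.nonsing_inv_mul _ (isUnit_det_sqrt hQ), Matrix.one_mulVec]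
  rw [← norm_sqrt_mulVec hQ.posSemidef]
  nth_rw 1 [← h]
  exact L.le_opNorm _

/-- The finitely many points all lie in one spanning set; singletons need not be measurable. -/
theorem MeasureTheory.isFiniteMeasure_of_finite {Ω : Type*} [MeasurableSpace Ω] [Finite Ω]
    (ν : Measure Ω) [SigmaFinite ν] : IsFiniteMeasure ν := by
  have h : ∃ k, spanningSets ν k = Set.univ := by
    have hx : ∀ x : Ω, ∃ k, x ∈ spanningSets ν k := fun x =>
      Set.mem_iUnion.1 ((iUnion_spanningSets ν).symm ▸ Set.mem_univ x)
    choose k hk using hx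
    obtain ⟨K, hK⟩ := (Set.finite_range k).bddAbove
    exact ⟨K, Set.eq_univ_of_forall fun x =>
      monotone_spanningSets ν (hK (Set.mem_range_self x)) (hk x)⟩
  obtain ⟨k, hk⟩ := h
  exact ⟨hk ▸ measure_spanningSets_lt_top ν k⟩

theorem MeasureTheory.integrable_of_finite {Ω : Type*} [MeasurableSpace Ω] [Finite Ω]
    {ν : Measure Ω} [IsFiniteMeasure ν] {f : Ω → ℝ} (hf : Measurable f) : Integrable f ν := by
  obtain ⟨C, hC⟩ := (Set.finite_range fun x => ‖f x‖).bddAbove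
  exact .of_bound hf.aestronglyMeasurable C
    (Filter.Eventually.of_forall fun x => hC (Set.mem_range_self x))

namespace ExpFamily

variable {Ω n : Type*} [MeasurableSpace Ω] [Fintype n] {ν : Measure Ω} {φ : Ω → n → ℝ}

theorem mem_fullDomain_of_finite [Finite Ω] [SigmaFinite ν] (hφ : Measurable φ) (θ : n → ℝ) :
    θ ∈ fullDomain ν φ := by
  have := isFiniteMeasure_of_finite ν
  exact integrable_of_finite (measurable_exp hφ θ)

/-- A linear functional of the statistic that is nearly constant has a small coefficient. -/
theorem exists_norm_le_of_abs_sub_le (hE : IsRegularMinimal ν φ) (hne : (fullDomain ν φ).Nonempty)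
    (K : ℝ) : ∃ B, ∀ (u : n → ℝ) (c : ℝ), (∀ᵐ x ∂ν, |u ⬝ᵥ φ x - c| ≤ K) → ‖u‖ ≤ B := by
  obtain ⟨θ, hθ⟩ := hne
  obtain ⟨C, hC0, hC⟩ := (hE.posDef_cov θ hθ).exists_norm_le
  refine ⟨C * |K|, fun u c hu => (hC u).trans (mul_le_mul_of_nonneg_left ?_ hC0)⟩
  have := isProbabilityMeasure_law hE.base_ne_zero hθ
  rw [dotProduct_covMatrix_self
    (fun k => memLp_stat hE.measurable_stat hE.base_ne_zero hE.isOpen_fullDomain hθ k)]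
  have hb : ∀ᵐ x ∂(law ν φ θ), u ⬝ᵥ φ x ∈ Set.Icc (c - K) (c + K) := by
    rw [law, ae_normalizedLaw_iff (measurable_exp hE.measurable_stat θ) (fun _ => Real.exp_pos _)
      (integral_exp_pos hE.base_ne_zero hθ)]
    filter_upwards [hu] with x hx
    rw [abs_le] at hx
    constructor <;> linarith
  -- Popoviciu's inequality: values in an interval of length 2K have variance at most K².
  have h := variance_le_sq_of_bounded hb (measurable_dotProduct hE.measurable_stat u).aemeasurable
  refine Real.sqrt_le_iff.2 ⟨abs_nonneg _, h.trans (le_of_eq ?_)⟩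
  rw [sq_abs]
  ring

end ExpFamily

namespace InferenceData

open ExpFamily FactorGraph

variable {V : Type*} {H : FactorGraph V} {X : V → Type*}
  [∀ i, MeasurableSpace (X i)] {I : InferenceData H X}

/-- The hyperedge conditions follow from the vertex conditions. For u ≠ 0 the sets where ⟨u_i, φ_i⟩
> ⟨u_i, η_i⟩, taken for all i with u_i ≠ 0, have positive measure, and their product lies in the
half space of u. Finiteness ensures that the slice has a nonempty parameter domain. -/
theorem mem_restrictedDomain_of_finite [∀ i, Finite (X i)] (hI : I.IsInferenceFamily)
    (hreg : I.IsRegular) {θbar : I.ModelParams} {η : ∀ i, Fin (I.dimV i) → ℝ}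
    (hη : ∀ i, η i ∈ meanParams (I.ν i) (I.φV i)) : η ∈ I.restrictedDomain θbar := by
  classical
  refine (mem_restrictedDomain_iff hI hreg θbar η).2 ⟨hη, fun α => ?_⟩
  have hfin : ∀ i : {i : V // i ∈ α.1}, IsFiniteMeasure (I.ν i.1) :=
    fun i => isFiniteMeasure_of_finite _
  have : IsFiniteMeasure (I.νF α) := by unfold νF; infer_instance
  rw [meanParams_eq_supportInterior (isRegularMinimal_slice hI hreg θbar α)
    ⟨0, (mem_fullDomain_slice (measurable_stat α) _ _).2
      (mem_fullDomain_of_finite (measurable_stat α) _)⟩]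
  intro u hu h0
  have h0' := sliceBase_absolutelyContinuous (measurable_stat α) _ h0
  set s : ∀ i : {i : V // i ∈ α.1}, Set (X i.1) := fun i =>
    if (fun k => u ⟨i, k⟩) = 0 then Set.univ else
      {x | (fun k => u ⟨i, k⟩) ⬝ᵥ η i.1 < (fun k => u ⟨i, k⟩) ⬝ᵥ I.φV i.1 x} with hs
  have hle : ∀ i, ∀ x ∈ s i,
      (fun k => u ⟨i, k⟩) ⬝ᵥ η i.1 ≤ (fun k => u ⟨i, k⟩) ⬝ᵥ I.φV i.1 x := by
    intro i x hx
    by_cases h : (fun k => u ⟨i, k⟩) = 0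
    · rw [h, zero_dotProduct, zero_dotProduct]
    · simp only [hs, if_neg h] at hx
      exact le_of_lt hx
  have hpos : I.νF α (Set.univ.pi s) ≠ 0 := by
    rw [νF, Measure.pi_pi]
    refine Finset.prod_ne_zero_iff.2 fun i _ => ?_
    by_cases h : (fun k => u ⟨i, k⟩) = 0
    · simp only [hs, if_pos h]
      exact Measure.measure_univ_ne_zero.2 (I.ν_ne_zero i.1)
    · simp only [hs, if_neg h]
      exact meanParams_subset_supportInterior (isRegularMinimal_vertex hI hreg i.1) (hη i.1) _ h
  refine hpos (measure_mono_null (fun x hx => ?_) h0')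
  obtain ⟨i₀, hi₀⟩ : ∃ i₀, (fun k => u ⟨i₀, k⟩) ≠ 0 := by
    by_contra! h
    exact hu (funext fun q => congrFun (h q.1) q.2)
  have hx' : ∀ i, x i ∈ s i := fun i => hx i (Set.mem_univ i)
  have h1 := hx' i₀
  simp only [hs, if_neg hi₀] at h1
  change u ⬝ᵥ H.restrictEdge α η < u ⬝ᵥ I.edgeStat α x
  simp only [dotProduct, Fintype.sum_sigma]
  exact Finset.sum_lt_sum (fun i _ => hle i (x i) (hx' i)) ⟨i₀, Finset.mem_univ _, h1⟩

/-- If the vertex marginal of a belief matches, then the message is bounded up to a constant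
factor by the range of the compatibility function. -/
theorem abs_message_sub_le [∀ i, Finite (X i)] {θbar : I.ModelParams} {α : H.Edge} {K : ℝ}
    (hK : ∀ x, |θbar α ⬝ᵥ I.stat α x| ≤ K) (i : {i : V // i ∈ α.1})
    (θ : (Σ i : {i : V // i ∈ α.1}, Fin (I.dimV i.1)) → ℝ) (θi : Fin (I.dimV i.1) → ℝ)
    (hmap : (law (I.νF α) (I.stat α) (fullParam θbar α θ)).map (fun x => x i) =
      law (I.ν i.1) (I.φV i.1) θi) :
    ∃ c, ∀ᵐ x ∂(I.ν i.1),
      |(fun k => θi k - θ ⟨i, k⟩ + θbar α (Sum.inr ⟨i, k⟩)) ⬝ᵥ I.φV i.1 x - c| ≤ K := by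
  classical
  have hfin : ∀ i : {i : V // i ∈ α.1}, IsFiniteMeasure (I.ν i.1) :=
    fun i => isFiniteMeasure_of_finite _
  have : IsFiniteMeasure (I.νF α) := by unfold νF; infer_instance
  obtain ⟨ω, hω, hae⟩ := (map_eval_normalizedLaw_eq_iff i (fun j : {i : V // i ∈ α.1} => I.ν j.1)
    (fun j => I.ν_ne_zero j.1) (measurable_exp (measurable_stat α) (fullParam θbar α θ))
    (fun _ => Real.exp_pos _) (mem_fullDomain_of_finite (ν := I.νF α) (measurable_stat α) _)
    (measurable_exp (I.measurable_φV i.1) θi) (fun _ => Real.exp_pos _)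
    (mem_fullDomain_of_finite (I.measurable_φV i.1) _)).1 hmap
  set P : (∀ j : {j : {i : V // i ∈ α.1} // j ≠ i}, X j.1.1) → ℝ := fun y =>
    ∏ j, Real.exp ((fun k => θ ⟨j.1, k⟩ - θbar α (Sum.inr ⟨j.1, k⟩)) ⬝ᵥ I.φV j.1.1 (y j)) with hP
  have hPpos : ∀ y, 0 < P y := fun y => Finset.prod_pos fun _ _ => Real.exp_pos _
  have hPm : Measurable P := Finset.measurable_fun_prod _ fun j _ =>
    (measurable_exp (I.measurable_φV j.1.1) _).comp (measurable_pi_apply j)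
  set π := Measure.pi fun j : {j : {i : V // i ∈ α.1} // j ≠ i} => I.ν j.1.1 with hπ
  have hPi : Integrable P π := integrable_of_finite hPm
  have hπ0 : π ≠ 0 := by
    rw [← Measure.measure_univ_ne_zero, hπ, Measure.pi_univ]
    exact Finset.prod_ne_zero_iff.2 fun j _ => Measure.measure_univ_ne_zero.2 (I.ν_ne_zero j.1.1)
  have hJ : 0 < ∫ y, P y ∂π := integral_pos_of_pos hπ0 hPpos hPi
  set J := ∫ y, P y ∂π with hJdef
  -- The message equals ω ∫ Ψ_α P, and exp (-K) ≤ Ψ_α ≤ exp K traps it between exp (-K) ω J and exp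
  -- K ω J.
  refine ⟨Real.log (ω * J), ?_⟩
  filter_upwards [hae] with x hx
  set e := Equiv.piSplitAt i fun k : {i : V // i ∈ α.1} => X k.1 with he
  set m : Fin (I.dimV i.1) → ℝ := fun k => θi k - θ ⟨i, k⟩ + θbar α (Sum.inr ⟨i, k⟩) with hm
  set d : Fin (I.dimV i.1) → ℝ := fun k => θ ⟨i, k⟩ - θbar α (Sum.inr ⟨i, k⟩) with hd
  have hCm : Measurable fun y => I.compat θbar α (e.symm (x, y)) :=
    (measurable_exp (measurable_stat α) (θbar α)).comp
      ((measurable_piSplitAt_symm i).comp measurable_prodMk_left)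
  have hsplit : ∀ y, Real.exp (fullParam θbar α θ ⬝ᵥ I.stat α (e.symm (x, y))) =
      Real.exp (d ⬝ᵥ I.φV i.1 x) * (I.compat θbar α (e.symm (x, y)) * P y) := by
    intro y
    rw [exp_fullParam_eq, he, prod_piSplitAt_symm i (X := fun k : {i : V // i ∈ α.1} => X k.1)
      (fun j z => Real.exp ((fun k => θ ⟨j, k⟩ - θbar α (Sum.inr ⟨j, k⟩)) ⬝ᵥ I.φV j.1 z))]
    ring
  have hmsg : Real.exp (m ⬝ᵥ I.φV i.1 x) =
      ω * ∫ y, I.compat θbar α (e.symm (x, y)) * P y ∂π := by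
    have hsum : θi = m + d := by
      funext k
      simp only [hm, hd, Pi.add_apply]
      ring
    rw [hsum, add_dotProduct, Real.exp_add] at hx
    simp only [hsplit] at hx
    rw [integral_const_mul, mul_left_comm, mul_comm] at hx
    exact mul_left_cancel₀ (Real.exp_pos _).ne' hx
  have hCi : Integrable (fun y => I.compat θbar α (e.symm (x, y)) * P y) π :=
    integrable_of_finite (hCm.mul hPm)
  have hlow : Real.exp (-K) * J ≤ ∫ y, I.compat θbar α (e.symm (x, y)) * P y ∂π := by
    rw [hJdef, ← integral_const_mul]
    refine integral_mono (hPi.const_mul _) hCi fun y =>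
      mul_le_mul_of_nonneg_right (Real.exp_le_exp.2 (abs_le.1 (hK _)).1) (hPpos y).le
  have hupp : ∫ y, I.compat θbar α (e.symm (x, y)) * P y ∂π ≤ Real.exp K * J := by
    rw [hJdef, ← integral_const_mul]
    refine integral_mono hCi (hPi.const_mul _) fun y =>
      mul_le_mul_of_nonneg_right (Real.exp_le_exp.2 (abs_le.1 (hK _)).2) (hPpos y).le
  have hωJ : 0 < ω * J := mul_pos hω hJ
  have h1 : Real.exp (Real.log (ω * J) - K) ≤ Real.exp (m ⬝ᵥ I.φV i.1 x) := by
    rw [hmsg, sub_eq_add_neg, Real.exp_add, Real.exp_log hωJ, mul_assoc, mul_comm J]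
    exact mul_le_mul_of_nonneg_left hlow hω.le
  have h2 : Real.exp (m ⬝ᵥ I.φV i.1 x) ≤ Real.exp (Real.log (ω * J) + K) := by
    rw [hmsg, Real.exp_add, Real.exp_log hωJ, mul_assoc, mul_comm J]
    exact mul_le_mul_of_nonneg_left hupp hω.le
  rw [Real.exp_le_exp] at h1 h2
  rw [abs_le]
  constructor <;> linarith

end InferenceData

/-! ### Existence of stationary points on finite spaces -/

namespace InferenceData

open ExpFamily FactorGraph Topology

variable {V : Type*} [Fintype V] [DecidableEq V] {H : FactorGraph V} {X : V → Type*}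
  [∀ i, MeasurableSpace (X i)] {I : InferenceData H X}

/-- The logarithm of a message stays within K of a constant, with K a bound for |log Ψ_α| that does
not depend on η; minimality of the vertex family turns this into a bound on the parameter. -/
theorem exists_norm_pointMessages_le [∀ i, Finite (X i)] (hI : I.IsInferenceFamily)
    (hreg : I.IsRegular) (θbar : I.ModelParams) (e : H.DirEdge) :
    ∃ B, ∀ η ∈ I.restrictedDomain θbar, ‖pointMessages θbar η e‖ ≤ B := by
  obtain ⟨α, i⟩ := e
  obtain ⟨K, hK⟩ := (Set.finite_range fun x => |θbar α ⬝ᵥ I.stat α x|).bddAbove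
  obtain ⟨B, hB⟩ := exists_norm_le_of_abs_sub_le (isRegularMinimal_vertex hI hreg i.1)
    ⟨0, mem_fullDomain_of_finite (I.measurable_φV i.1) _⟩ K
  refine ⟨B, fun η hη => ?_⟩
  rw [mem_restrictedDomain_iff hI hreg] at hη
  have hmap := map_law_slice hI hreg (hη.2 α) i
  rw [law_slice (measurable_stat α)] at hmap
  obtain ⟨c, hc⟩ := abs_message_sub_le (fun x => hK (Set.mem_range_self x)) i _ _ hmap
  exact hB _ c hc

theorem exists_norm_natParam_le [∀ i, Finite (X i)] (hI : I.IsInferenceFamily)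
    (hreg : I.IsRegular) (θbar : I.ModelParams) (i : V) :
    ∃ B, ∀ η ∈ I.restrictedDomain θbar,
      ‖natParam (I.ν i) (I.φV i) (η i)‖ ≤ ‖gradBethe θbar η‖ + B := by
  choose B hB using exists_norm_pointMessages_le hI hreg θbar
  refine ⟨∑ β : H.Edge, if h : i ∈ β.1 then B ⟨β, ⟨i, h⟩⟩ else 0, fun η hη => ?_⟩
  have h1 : natParam (I.ν i) (I.φV i) (η i) =
      gradBethe θbar η i + vertexParam (pointMessages θbar η) i := by
    rw [gradBethe_eq_sub, sub_add_cancel]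
  rw [h1]
  refine norm_add_le_of_le (norm_le_pi_norm _ i) ?_
  refine (norm_sum_le _ _).trans (Finset.sum_le_sum fun β _ => ?_)
  by_cases h : i ∈ β.1
  · simp only [dif_pos h]
    exact hB _ η hη
  · simp [h]

/-- A positive form makes the Hessian injective, hence onto in finite dimension, so the gradient map
is locally open. -/
theorem isOpen_image_gradBethe (hI : I.IsInferenceFamily) (hreg : I.IsRegular)
    {θbar : I.ModelParams}
    (hW : spectralRadius ℂ ((H.dirEdgeMatrix (I.weight θbar)).map (algebraMap ℝ ℂ)) < 1) :
    IsOpen (gradBethe θbar '' I.restrictedDomain θbar) := by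
  rw [isOpen_iff_mem_nhds]
  rintro _ ⟨η, hη, rfl⟩
  have hinj : Function.Injective (hessBethe θbar η) := by
    refine (injective_iff_map_eq_zero _).2 fun v hv => ?_
    by_contra hne
    have := pairing_hessBethe_pos hI hreg hW hη v hne
    rw [hv, map_zero] at this
    exact lt_irrefl _ this
  have hsurj : (hessBethe θbar η).range = ⊤ :=
    LinearMap.range_eq_top.2 (LinearMap.injective_iff_surjective.1 hinj)
  rw [← (hasStrictFDerivAt_gradBethe hI hreg hη).map_nhds_eq_of_surj hsurj]
  exact Filter.image_mem_map ((isOpen_restrictedDomain hI hreg θbar).mem_nhds hη)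

/-- Properness: where the gradient stays near c, the vertex natural parameters stay in fixed balls.
The images of these balls under the mean maps form a compact set K, which lies inside the domain
because on finite spaces every natural parameter is admissible. -/
theorem isClosed_image_gradBethe [∀ i, Finite (X i)] (hI : I.IsInferenceFamily)
    (hreg : I.IsRegular) (θbar : I.ModelParams) :
    IsClosed (gradBethe θbar '' I.restrictedDomain θbar) := by
  choose B hB using exists_norm_natParam_le hI hreg θbar
  have hV := isRegularMinimal_vertex hI hreg
  have hdom : ∀ i θ, θ ∈ fullDomain (I.ν i) (I.φV i) := fun i θ =>
    mem_fullDomain_of_finite (I.measurable_φV i) θ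
  refine isClosed_of_closure_subset fun c hc => ?_
  set K : Set (∀ i, Fin (I.dimV i) → ℝ) := Set.univ.pi fun i =>
    meanMap (I.ν i) (I.φV i) '' Metric.closedBall 0 (‖c‖ + 1 + B i) with hK
  have hKc : IsCompact K := isCompact_univ_pi fun i => (isCompact_closedBall _ _).image
    (continuous_iff_continuousAt.2 fun θ => continuousAt_meanMap (hV i) (hdom i θ))
  have hKD : K ⊆ I.restrictedDomain θbar := fun η hη =>
    mem_restrictedDomain_of_finite hI hreg fun i => by
      obtain ⟨θ, _, h⟩ := hη i (Set.mem_univ i)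
      exact h ▸ meanMap_mem (hV i) (hdom i θ)
  have hGK : IsClosed (gradBethe θbar '' K) := by
    refine (hKc.image_of_continuousOn fun η hη => ?_).isClosed
    exact (hasStrictFDerivAt_gradBethe hI hreg (hKD hη)).hasFDerivAt.continuousAt.continuousWithinAt
  -- The radius ‖c‖ + 1 + B i of the balls in K matches the bound ‖gradient‖ + B i for gradients
  -- within distance 1 of c.
  have hsub : Metric.ball c 1 ∩ gradBethe θbar '' I.restrictedDomain θbar ⊆
      gradBethe θbar '' K := by
    rintro _ ⟨hball, η, hη, rfl⟩
    refine ⟨η, fun i _ => ⟨natParam (I.ν i) (I.φV i) (η i), ?_,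
      meanMap_natParam (((mem_restrictedDomain_iff hI hreg θbar η).1 hη).1 i)⟩, rfl⟩
    rw [mem_closedBall_zero_iff]
    have h0 := hB i η hη
    have h1 := norm_le_norm_add_norm_sub' (gradBethe θbar η) c
    rw [Metric.mem_ball, dist_eq_norm] at hball
    linarith
  have hmem := Metric.isOpen_ball.inter_closure ⟨Metric.mem_ball_self one_pos, hc⟩
  exact Set.image_mono hKD (hGK.closure_subset_iff.2 hsub hmem)

/-- The image of the gradient map is nonempty, open and closed in a connected space. -/
theorem exists_gradBethe_eq_zero [∀ i, Finite (X i)] (hI : I.IsInferenceFamily)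
    (hreg : I.IsRegular) {θbar : I.ModelParams}
    (hW : spectralRadius ℂ ((H.dirEdgeMatrix (I.weight θbar)).map (algebraMap ℝ ℂ)) < 1) :
    ∃ η ∈ I.restrictedDomain θbar, gradBethe θbar η = 0 := by
  have hne : (gradBethe θbar '' I.restrictedDomain θbar).Nonempty :=
    Set.Nonempty.image _ ⟨fun i => meanMap (I.ν i) (I.φV i) 0,
      mem_restrictedDomain_of_finite hI hreg fun i =>
        meanMap_mem (isRegularMinimal_vertex hI hreg i)
          (mem_fullDomain_of_finite (I.measurable_φV i) 0)⟩
  have huniv := IsClopen.eq_univ ⟨isClosed_image_gradBethe hI hreg θbar,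
    isOpen_image_gradBethe hI hreg hW⟩ hne
  exact huniv.symm.subset (Set.mem_univ (0 : ∀ i, Fin (I.dimV i) → ℝ))

end InferenceData

theorem theorem7 {V : Type*} [Fintype V] [DecidableEq V] (H : FactorGraph V)
    (X : V → Type*) [∀ i, MeasurableSpace (X i)] (I : InferenceData H X)
    (hI : I.IsInferenceFamily) (hreg : I.IsRegular) (θbar : I.ModelParams)
    (hW : spectralRadius ℂ ((H.dirEdgeMatrix (I.weight θbar)).map (algebraMap ℝ ℂ)) < 1) :
    StrictConvexOn ℝ (I.restrictedDomain θbar) (I.restrictedBethe θbar) ∧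
      {μ : I.Messages | I.IsFixedPoint θbar μ}.Subsingleton ∧
      ((∀ i, Finite (X i)) → ∃! μ : I.Messages, I.IsFixedPoint θbar μ) := by
  have huniq := InferenceData.subsingleton_fixedPoints hI hreg hW
  refine ⟨InferenceData.strictConvexOn_restrictedBethe hI hreg hW, huniq, fun hX => ?_⟩
  obtain ⟨η, hη, h0⟩ := InferenceData.exists_gradBethe_eq_zero hI hreg hW
  have hfix := InferenceData.isFixedPoint_pointMessages hI hreg hη h0
  exact ⟨_, hfix, fun μ hμ => huniq hμ hfix⟩
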